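/- **Proposition 5.2.** Let $\mathbb K$ be a field and let $\mathcal H$ be a Hopf algebra over $\mathbb K$ with coproduct $\Delta h=\sum h^{(1)}\otimes h^{(2)}$, counit $\varepsilon$ and antipode $S$; put $\mathrm{ad}(h)g=\sum S(h^{(1)})\,g\,h^{(2)}$. Graded algebras are $\mathbb N$-graded, unital and associative; a graded differential algebra is a graded algebra with an antiderivation $d$ of degree $1$ such that $d^2=0$. *Operations.* An operation of $\mathcal H$ in a graded differential algebra $\Omega$ is a linear map $h\mapsto i_h$ from $\mathcal H$ to the homogeneous linear endomorphisms of degree $-1$ of $\Omega$ such that $i_{1}=0$ and such that, with $L_h=d\,i_h+i_h\,d+\varepsilon(h)\,\mathrm{id}_\Omega$, for all $g,h\in\mathcal H$, $$i_h(xy)=\sum i_{h^{(1)}}(x)\,L_{h^{(2)}}(y)+(-1)^a x\,i_h(y)\quad(x\in\Omega^a,\ y\in\Omega),$$ $$i_gL_h=\sum L_{h^{(1)}}\,i_{\mathrm{ad}(h^{(2)})g},\qquad L_hL_g=L_{hg}.$$ *The algebra $C(\mathcal H)$.* Let $C(\mathcal H)=\bigoplus_{n\ge 0}C^n(\mathcal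 H)$, where $C^n(\mathcal H)$ is the space of $n$-linear forms on $\mathcal H$, with the tensor product of multilinear forms and the differential given, for $\Psi\in C^n(\mathcal H)$, by $$d\Psi(h_0,\dots,h_n)=\varepsilon(h_0)\Psi(h_1,\dots,h_n)+\sum_{k=1}^n(-1)^k\Psi(h_0,\dots,h_{k-1}h_k,\dots,h_n)+(-1)^{n+1}\Psi(h_0,\dots,h_{n-1})\varepsilon(h_n).$$ For $h\in\mathcal H$ let $i_h=0$ on $C^0(\mathcal H)$ and, for $\Psi\in C^n(\mathcal H)$ with $n\ge1$, $$i_h(\Psi)(g_1,\dots,g_{n-1})=\sum_{p=0}^{n-1}(-1)^p\sum\Psi\bigl(g_1,\dots,g_p,\,h^{(1)}-\varepsilon(h^{(1)})1,\,\mathrm{ad}(h^{(2)})g_{p+1},\dots,\mathrm{ad}(h^{(n-p)})g_{n-1}\bigr),$$ with the $(n-p)$-fold iterated coproduct of $h$ (which is $h$ itself for $p=n-1$), and let $L_h=d\,i_h+i_h\,d+\varepsilon(h)\,\mathrm{id}$ on $C(\mathcal H)$. *Connections.* Given an operation $h\mapsto i_h$ of $\mathcal H$ in $\Omega$, an algebraic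 connection is a homomorphism of graded algebras $\alpha:C(\mathcal H)\to\Omega$ with $i_h(\alpha(\Psi))=\alpha(i_h(\Psi))$ and $L_h(\alpha(\Psi))=\alpha(L_h(\Psi))$ for all $h\in\mathcal H$, $\Psi\in C(\mathcal H)$. Its curvature is the linear map $\varphi=d\circ\alpha-\alpha\circ d:C(\mathcal H)\to\Omega$. *The Weil algebra.* For a graded algebra $A$, let $\Omega^1_{gr}(A)\subset A\otimes A$ be the kernel of $a\otimes b\mapsto(-1)^s ab$ ($b\in A^s$), with the bimodule structure $x(a\otimes b)y=xa\otimes by$, graded so that $A^r\otimes A^s$ has degree $r+s+1$, and let $d:A\to\Omega^1_{gr}(A)$ be the antiderivation $d(x)=1\otimes x-(-1)^n x\otimes1$ ($x\in A^n$). The differential envelope $\Omega_{gr}(A)$ is the tensor algebra over $A$ of the bimodule $\Omega^1_{gr}(A)$, with the induced grading, for which $A$ and $\Omega^1_{gr}(A)$ keep their gradings, and with the unique differential extending $d:A\to\Omega^1_{gr}(A)$. Let $W(\mathcal H)=\Omega_{gr}(C(\mathcal H))$ and let $\alpha_W:C(\mathcal H)\to W(\mathcal H)$ be the canonical injection. Then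 there is a unique operation $h\mapsto i_h$ of the Hopf algebra $\mathcal H$ in the graded differential algebra $W(\mathcal H)$ for which $\alpha_W$ is an algebraic connection. The curvature of this connection is $\varphi_W=d\circ\alpha_W-\alpha_W\circ d$. -/

import Mathlib

noncomputable section

namespace WeilHopf

open scoped TensorProduct DirectSum

universe u v w

/-! ### Graded differential algebras -/

/-- A graded differential algebra over `K`: a unital associative `ℕ`-graded algebra `Ω = ⨁ Ωⁿ` with
an antiderivation `d` of degree `1` and square zero. -/
structure GradedDiffAlgebra (K : Type u) [Field K] where
  carrier : Type v
  [ring : Ring carrier]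
  [algebra : Algebra K carrier]
  /-- the homogeneous components `Ωⁿ` -/
  deg : ℕ → Submodule K carrier
  [graded : GradedAlgebra deg]
  /-- the differential -/
  d : carrier →ₗ[K] carrier
  d_mem : ∀ (n : ℕ) (x : carrier), x ∈ deg n → d x ∈ deg (n + 1)
  d_mul : ∀ (n : ℕ) (x y : carrier), x ∈ deg n → d (x * y) = d x * y + (-1 : K) ^ n • (x * d y)
  d_d : ∀ x : carrier, d (d x) = 0

instance (K : Type u) [Field K] : CoeSort (GradedDiffAlgebra.{u, v} K) (Type v) :=
  ⟨GradedDiffAlgebra.carrier⟩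

attribute [instance] GradedDiffAlgebra.ring GradedDiffAlgebra.algebra GradedDiffAlgebra.graded

/-! ### Multilinear forms -/

section Multilinear

variable {K : Type u} [Field K] {H : Type v} [AddCommGroup H] [Module K H]

/-- Substitution of a map `F` into a multilinear form, when changing one variable of `F` amounts to
changing one entry of its value linearly. -/
def substitute {ι κ : Type*} [DecidableEq ι] [DecidableEq κ]
    (Ψ : MultilinearMap K (fun _ : κ => H) K) (F : (ι → H) → (κ → H))
    (hF : ∀ (g : ι → H) (i : ι), ∃ (s : κ) (φ : H →ₗ[K] H),
      ∀ x, F (Function.update g i x) = Function.update (F g) s (φ x)) :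
    MultilinearMap K (fun _ : ι => H) K :=
  MultilinearMap.mk' (fun g => Ψ (F g))
    (fun g i x y => by
      obtain ⟨s, φ, h⟩ := hF g i
      simp only [h, map_add, MultilinearMap.map_update_add])
    (fun g i c x => by
      obtain ⟨s, φ, h⟩ := hF g i
      simp only [h, map_smul, MultilinearMap.map_update_smul])

@[simp] theorem substitute_apply {ι κ : Type*} [DecidableEq ι] [DecidableEq κ]
    (Ψ : MultilinearMap K (fun _ : κ => H) K) (F : (ι → H) → (κ → H)) (hF) (g : ι → H) :
    substitute Ψ F hF g = Ψ (F g) := rfl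

variable (K H)

/-- The space `Cⁿ(H)` of `n`-linear forms on `H`. -/
abbrev Form (n : ℕ) : Type (max u v) := MultilinearMap K (fun _ : Fin n => H) K

variable {K H}

/-- The tensor product of multilinear forms,
`(Φ ⊗ Ψ)(g₁, …, g_{m+n}) = Φ(g₁, …, g_m) Ψ(g_{m+1}, …, g_{m+n})`. -/
def formMul {m n : ℕ} (Φ : Form K H m) (Ψ : Form K H n) : Form K H (m + n) :=
  ((LinearMap.mul' K K).compMultilinearMap (Φ.domCoprod Ψ)).domDomCongr finSumFinEquiv

@[simp] theorem formMul_apply {m n : ℕ} (Φ : Form K H m) (Ψ : Form K H n) (g : Fin (m + n) → H) :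
    formMul Φ Ψ g = Φ (fun i => g (Fin.castAdd n i)) * Ψ (fun i => g (Fin.natAdd m i)) := by
  simp [formMul]

/-- The value of a multilinear form on the first terms of a sequence. -/
def ev {n : ℕ} (Ψ : Form K H n) (g : ℕ → H) : K := Ψ (fun i => g i)

theorem form_ext {n : ℕ} {Φ Ψ : Form K H n} (h : ∀ g, ev Φ g = ev Ψ g) : Φ = Ψ := by
  ext v
  have := h (fun i => if hi : i < n then v ⟨i, hi⟩ else 0)
  simpa [ev] using this

theorem gradedForm_ext (a b : GradedMonoid (Form K H)) (h : a.1 = b.1)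
    (h' : ∀ g, ev a.2 g = ev b.2 g) : a = b := by
  obtain ⟨m, a⟩ := a
  obtain ⟨n, b⟩ := b
  obtain rfl : m = n := h
  obtain rfl : a = b := form_ext h'
  rfl

theorem ev_formMul {m n : ℕ} (Φ : Form K H m) (Ψ : Form K H n) (g : ℕ → H) :
    ev (formMul Φ Ψ) g = ev Φ g * ev Ψ (fun i => g (m + i)) := by
  simp [ev]

instance : GradedMonoid.GMul (Form K H) := ⟨formMul⟩

instance : GradedMonoid.GOne (Form K H) := ⟨MultilinearMap.constOfIsEmpty K _ 1⟩

instance : GradedMonoid.GMonoid (Form K H) where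
  one_mul a := gradedForm_ext _ _ (zero_add _) fun g => by
    refine (ev_formMul _ _ g).trans ?_
    simp [ev, GradedMonoid.GOne.one]
  mul_one a := gradedForm_ext _ _ (add_zero _) fun g => by
    refine (ev_formMul _ _ g).trans ?_
    simp [ev, GradedMonoid.GOne.one]
  mul_assoc a b c := gradedForm_ext _ _ (add_assoc _ _ _) fun g => by
    refine (ev_formMul _ _ g).trans ?_
    refine Eq.trans ?_ (ev_formMul _ _ g).symm
    refine (congrArg (· * _) (ev_formMul _ _ g)).trans ?_
    refine Eq.trans ?_ (congrArg (_ * ·) (ev_formMul _ _ _).symm)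
    refine (mul_assoc _ _ _).trans ?_
    congr 2
    congr 1
    funext i
    exact congrArg g (add_assoc _ _ _)

theorem gmul_eq {m n : ℕ} (Φ : Form K H m) (Ψ : Form K H n) :
    GradedMonoid.GMul.mul Φ Ψ = formMul Φ Ψ := rfl

theorem formMul_add {m n : ℕ} (Φ : Form K H m) (Ψ Ψ' : Form K H n) :
    formMul Φ (Ψ + Ψ') = formMul Φ Ψ + formMul Φ Ψ' := by
  ext g; simp [mul_add]

theorem add_formMul {m n : ℕ} (Φ Φ' : Form K H m) (Ψ : Form K H n) :
    formMul (Φ + Φ') Ψ = formMul Φ Ψ + formMul Φ' Ψ := by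
  ext g; simp [add_mul]

instance : DirectSum.GRing (Form K H) where
  mul_zero Φ := by ext g; simp [gmul_eq]
  zero_mul Φ := by ext g; simp [gmul_eq]
  mul_add Φ Ψ Ψ' := formMul_add Φ Ψ Ψ'
  add_mul Φ Φ' Ψ := add_formMul Φ Φ' Ψ
  natCast n := MultilinearMap.constOfIsEmpty K _ (n : K)
  natCast_zero := by ext g; simp
  natCast_succ n := by ext g; simp [GradedMonoid.GOne.one]
  intCast n := MultilinearMap.constOfIsEmpty K _ (n : K)
  intCast_ofNat n := by ext g; simp
  intCast_negSucc_ofNat n := by ext g; simp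

instance : DirectSum.GAlgebra K (Form K H) where
  toFun := (MultilinearMap.constLinearEquivOfIsEmpty (R := K) (M₁ := fun _ : Fin 0 => H)
    (M₂ := K) (S := K)).toLinearMap.toAddMonoidHom
  map_one := rfl
  map_mul r s := gradedForm_ext _ _ rfl fun g => by
    refine Eq.trans ?_ (ev_formMul _ _ g).symm
    rfl
  commutes r a := gradedForm_ext _ _ (Nat.add_comm _ _) fun g => by
    refine (ev_formMul _ _ g).trans (Eq.trans ?_ (ev_formMul _ _ g).symm)
    refine (mul_comm r _).trans (congrArg (· * r) (congrArg a.2 ?_))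
    funext i
    exact congrArg g (Nat.zero_add _)
  smul_def r a := gradedForm_ext _ _ (Nat.zero_add _).symm fun g => by
    refine Eq.trans ?_ (ev_formMul _ _ g).symm
    obtain ⟨n, a⟩ := a
    refine congrArg (r * ·) (congrArg a ?_)
    funext i
    exact congrArg g (Nat.zero_add _).symm

variable (K H)

/-- The algebra `C(H) = ⨁ Cⁿ(H)` of multilinear forms on `H`, with the tensor product of
multilinear forms. -/
def MForms : Type (max u v) := ⨁ n, Form K H n

instance : Ring (MForms K H) := inferInstanceAs (Ring (⨁ n, Form K H n))

instance : Algebra K (MForms K H) := inferInstanceAs (Algebra K (⨁ n, Form K H n))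

/-- The inclusion of `Cⁿ(H)` in `C(H)`. -/
def ofForm (n : ℕ) : Form K H n →ₗ[K] MForms K H := DirectSum.lof K ℕ (Form K H) n

variable {K H} in
theorem ofForm_mul {m n : ℕ} (Φ : Form K H m) (Ψ : Form K H n) :
    ofForm K H m Φ * ofForm K H n Ψ = ofForm K H (m + n) (formMul Φ Ψ) :=
  DirectSum.of_mul_of (A := Form K H) Φ Ψ

variable {K H} in
/-- The linear map on `C(H)` with given restrictions to the components `Cⁿ(H)`. -/
def formsLift {M : Type*} [AddCommMonoid M] [Module K M] (f : ∀ n, Form K H n →ₗ[K] M) :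
    MForms K H →ₗ[K] M :=
  DirectSum.toModule K ℕ M f

@[simp] theorem formsLift_ofForm {M : Type*} [AddCommMonoid M] [Module K M]
    (f : ∀ n, Form K H n →ₗ[K] M) (n : ℕ) (Φ : Form K H n) :
    formsLift f (ofForm K H n Φ) = f n Φ :=
  DirectSum.toModule_lof K n Φ

variable {K H} in
theorem forms_hom_ext {M : Type*} [AddCommMonoid M] [Module K M] {f g : MForms K H →ₗ[K] M}
    (h : ∀ n Φ, f (ofForm K H n Φ) = g (ofForm K H n Φ)) : f = g :=
  DirectSum.linearMap_ext (M := Form K H) K fun n => LinearMap.ext (h n)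

/-- The homogeneous component `Cⁿ(H)` of `C(H)`, as a subspace. -/
def formDeg (n : ℕ) : Submodule K (MForms K H) := LinearMap.range (ofForm K H n)

instance : SetLike.GradedMonoid (formDeg K H) where
  one_mem := ⟨_, rfl⟩
  mul_mem := by
    rintro m n _ _ ⟨Φ, rfl⟩ ⟨Ψ, rfl⟩
    exact ⟨formMul Φ Ψ, (ofForm_mul _ _).symm⟩

instance : DirectSum.Decomposition (formDeg K H) :=
  DirectSum.Decomposition.ofLinearMap _
    (formsLift fun n => DirectSum.lof K ℕ (fun n => formDeg K H n) n ∘ₗ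
        (ofForm K H n).rangeRestrict)
    (forms_hom_ext fun n Φ => by
      simp only [LinearMap.comp_apply, formsLift_ofForm]
      exact DirectSum.coeLinearMap_lof _ _ _)
    (by
      refine DirectSum.linearMap_ext K fun n => LinearMap.ext ?_
      rintro ⟨_, Φ, rfl⟩
      simp only [LinearMap.comp_apply, LinearMap.id_apply]
      rw [DirectSum.coeLinearMap_lof, formsLift_ofForm]
      rfl)

instance : GradedAlgebra (formDeg K H) where

end Multilinear

/-! ### The Hochschild differential -/

section Hochschild

variable {K : Type u} [Field K] {H : Type v} [Ring H] [Bialgebra K H]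

theorem contractNth_update {n : ℕ} (k : Fin n) (g : Fin (n + 1) → H) (i : Fin (n + 1)) :
    ∃ (s : Fin n) (φ : H →ₗ[K] H), ∀ x,
      Fin.contractNth k.castSucc (· * ·) (Function.update g i x) =
        Function.update (Fin.contractNth k.castSucc (· * ·) g) s (φ x) := by
  obtain ⟨k, hk⟩ := k
  obtain ⟨i, hi⟩ := i
  rcases lt_trichotomy i k with h | h | h
  · refine ⟨⟨i, by omega⟩, LinearMap.id, fun x => ?_⟩
    funext ⟨j, hj⟩
    simp only [Fin.contractNth, Function.update_apply, Fin.ext_iff, Fin.val_castSucc, Fin.val_succ,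
      LinearMap.id_apply]
    split_ifs <;> first | rfl | omega
  · refine ⟨⟨i, by omega⟩, LinearMap.mulRight K (g ⟨k + 1, by omega⟩), fun x => ?_⟩
    funext ⟨j, hj⟩
    subst h
    simp only [Fin.contractNth, Function.update_apply, Fin.ext_iff, Fin.val_castSucc, Fin.val_succ,
      LinearMap.mulRight_apply]
    split_ifs <;> first | rfl | omega | (subst_vars; rfl)
  · by_cases h' : i = k + 1
    · refine ⟨⟨k, by omega⟩, LinearMap.mulLeft K (g ⟨k, by omega⟩), fun x => ?_⟩
      funext ⟨j, hj⟩
      subst h'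
      simp only [Fin.contractNth, Function.update_apply, Fin.ext_iff, Fin.val_castSucc,
        Fin.val_succ, LinearMap.mulLeft_apply]
      split_ifs <;> first | rfl | omega | (subst_vars; rfl)
    · refine ⟨⟨i - 1, by omega⟩, LinearMap.id, fun x => ?_⟩
      funext ⟨j, hj⟩
      simp only [Fin.contractNth, Function.update_apply, Fin.ext_iff, Fin.val_castSucc,
        Fin.val_succ, LinearMap.id_apply]
      split_ifs <;> first | rfl | omega

/-- The Hochschild differential `Cⁿ(H) → Cⁿ⁺¹(H)` with coefficients in the trivial bimodule,
see `hochschild_apply`. -/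
def hochschild (n : ℕ) : Form K H n →ₗ[K] Form K H (n + 1) where
  toFun Ψ :=
    ((Coalgebra.counit (R := K) (A := H)).smulRight Ψ).uncurryLeft +
    ∑ k : Fin n, (-1 : K) ^ ((k : ℕ) + 1) •
      substitute Ψ (Fin.contractNth k.castSucc (· * ·)) (contractNth_update k) +
    (-1 : K) ^ (n + 1) • MultilinearMap.uncurryRight
      (((LinearMap.id : K →ₗ[K] K).smulRight
        (Coalgebra.counit (R := K) (A := H))).compMultilinearMap Ψ)
  map_add' Φ Ψ := by
    ext h
    simp [Finset.sum_add_distrib, mul_add]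
    ring
  map_smul' c Ψ := by
    ext h
    simp [Finset.mul_sum]
    refine congrArg₂ _ (congrArg₂ _ (by ring) (Finset.sum_congr rfl fun k _ => by ring)) (by ring)

/-- `(dΨ)(h₀, …, hₙ) = ε(h₀) Ψ(h₁, …, hₙ) + ∑_{1 ≤ k ≤ n} (-1)ᵏ Ψ(h₀, …, hₖ₋₁ hₖ, …, hₙ)
+ (-1)ⁿ⁺¹ Ψ(h₀, …, hₙ₋₁) ε(hₙ)`. -/
theorem hochschild_apply {n : ℕ} (Ψ : Form K H n) (h : Fin (n + 1) → H) :
    hochschild n Ψ h =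
      Coalgebra.counit (R := K) (h 0) * Ψ (Fin.tail h) +
      ∑ k : Fin n, (-1) ^ ((k : ℕ) + 1) * Ψ (Fin.contractNth k.castSucc (· * ·) h) +
      (-1) ^ (n + 1) * (Ψ (Fin.init h) * Coalgebra.counit (R := K) (h (Fin.last n))) := by
  simp [hochschild]

/-- Contraction of two consecutive terms of a sequence. -/
def contr (k : ℕ) (g : ℕ → H) (i : ℕ) : H :=
  if i < k then g i else if i = k then g i * g (i + 1) else g (i + 1)

/-- The part of the Hochschild differential without its first term, on functions of sequences. -/
def barD (K : Type u) [Field K] [Bialgebra K H] (n : ℕ) (F : (ℕ → H) → K) (g : ℕ → H) : K :=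
  ∑ k ∈ Finset.range n, (-1) ^ (k + 1) * F (contr k g) +
    (-1) ^ (n + 1) * (F g * Coalgebra.counit (R := K) (g n))

/-- The Hochschild differential on functions of sequences. -/
def hochD (K : Type u) [Field K] [Bialgebra K H] (n : ℕ) (F : (ℕ → H) → K) (g : ℕ → H) : K :=
  Coalgebra.counit (R := K) (g 0) * F (fun i => g (i + 1)) + barD K n F g

theorem ev_hochschild {n : ℕ} (Ψ : Form K H n) :
    ev (hochschild n Ψ) = hochD K n (ev Ψ) := by
  funext g
  rw [ev, hochschild_apply, hochD, barD, Finset.sum_range]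
  rw [add_assoc]
  rfl

theorem ev_congr {n : ℕ} (Ψ : Form K H n) {g g' : ℕ → H} (h : ∀ i < n, g i = g' i) :
    ev Ψ g = ev Ψ g' :=
  congrArg Ψ (funext fun i => h i i.2)

/-- Putting a term in front of a sequence. -/
def scons {X : Type*} (x : X) (g : ℕ → X) : ℕ → X
  | 0 => x
  | i + 1 => g i

theorem scons_zero {X : Type*} (x : X) (g : ℕ → X) : scons x g 0 = x := rfl

theorem scons_succ {X : Type*} (x : X) (g : ℕ → X) (i : ℕ) : scons x g (i + 1) = g i := rfl

theorem scons_eta {X : Type*} (g : ℕ → X) : g = scons (g 0) (fun i => g (i + 1)) := by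
  funext i; cases i <;> rfl

theorem contr_zero (x : H) (g : ℕ → H) :
    contr 0 (scons x g) = scons (x * g 0) (fun i => g (i + 1)) := by
  funext i; cases i <;> simp [contr, scons]

theorem contr_succ (k : ℕ) (x : H) (g : ℕ → H) :
    contr (k + 1) (scons x g) = scons x (contr k g) := by
  funext i; cases i <;> simp [contr, scons]

theorem barD_succ (n : ℕ) (F : (ℕ → H) → K) (x : H) (g : ℕ → H) :
    barD K (n + 1) F (scons x g) =
      -F (scons (x * g 0) (fun i => g (i + 1))) - barD K n (fun h => F (scons x h)) g := by
  rw [barD, barD, Finset.sum_range_succ']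
  simp only [contr_zero, contr_succ, pow_succ, scons, mul_neg, mul_one, neg_mul,
    Finset.sum_neg_distrib]
  ring

theorem barD_neg_sub (n : ℕ) (F G : (ℕ → H) → K) (g : ℕ → H) :
    barD K n (fun h => -F h - G h) g = -barD K n F g - barD K n G g := by
  simp only [barD, mul_sub, mul_neg, Finset.sum_sub_distrib, Finset.sum_neg_distrib, sub_mul,
    neg_mul]
  ring

theorem barD_add (n : ℕ) (F G : (ℕ → H) → K) (g : ℕ → H) :
    barD K n (fun h => F h + G h) g = barD K n F g + barD K n G g := by
  simp only [barD, mul_add, Finset.sum_add_distrib, add_mul]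
  ring

theorem barD_const_mul (n : ℕ) (c : K) (F : (ℕ → H) → K) (g : ℕ → H) :
    barD K n (fun h => c * F h) g = c * barD K n F g := by
  simp only [barD, mul_add, Finset.mul_sum]
  refine congrArg₂ _ (Finset.sum_congr rfl fun k _ => by ring) (by ring)

theorem barD_barD (n : ℕ) (F : (ℕ → H) → K) (hF : ∀ g g', (∀ i < n, g i = g' i) → F g = F g')
    (g : ℕ → H) : barD K (n + 1) (barD K n F) g = 0 := by
  induction n generalizing F g with
  | zero =>
    have := hF (contr 0 g) g (by simp)
    simp only [barD, zero_add, Finset.range_one, Finset.sum_singleton, Finset.range_zero,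
      Finset.sum_empty, this, contr]
    simp
    ring
  | succ n ih =>
    rw [scons_eta g, scons_eta (fun i => g (i + 1))]
    generalize g 0 = x
    generalize g (0 + 1) = y
    generalize (fun i => g (i + 1 + 1)) = g
    rw [barD_succ]
    simp only [barD_succ _ F x]
    rw [barD_neg_sub, ih (fun h => F (scons x h))]
    · rw [barD_succ, barD_succ]
      simp only [scons_zero, scons_succ, mul_assoc]
      ring
    · intro g g' h
      refine hF _ _ fun i hi => ?_
      cases i with
      | zero => rfl
      | succ i => exact h i (by omega)

theorem hochD_hochD (n : ℕ) (F : (ℕ → H) → K) (hF : ∀ g g', (∀ i < n, g i = g' i) → F g = F g')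
    (g : ℕ → H) : hochD K (n + 1) (hochD K n F) g = 0 := by
  have hb : barD K (n + 1) (hochD K n F) g =
      barD K (n + 1) (fun g => Coalgebra.counit (R := K) (g 0) * F (fun i => g (i + 1))) g :=
    (barD_add _ _ _ _).trans (by rw [barD_barD n F hF, add_zero])
  rw [hochD, hb, hochD]
  rw [scons_eta g]
  generalize g 0 = x
  generalize (fun i => g (i + 1)) = g
  rw [barD_succ]
  simp only [scons_zero, scons_succ, barD_const_mul, Bialgebra.counit_mul]
  ring

theorem hochschild_hochschild {n : ℕ} (Ψ : Form K H n) :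
    hochschild (n + 1) (hochschild n Ψ) = 0 := by
  refine form_ext fun g => ?_
  rw [ev_hochschild, ev_hochschild, hochD_hochD]
  · rfl
  · exact fun g g' h => ev_congr Ψ h

/-- Transport of a form along an equality of degrees. -/
def formCast {m n : ℕ} (h : m = n) (Φ : Form K H m) : Form K H n :=
  Φ.domDomCongr (finCongr h)

theorem ev_formCast {m n : ℕ} (h : m = n) (Φ : Form K H m) (g : ℕ → H) :
    ev (formCast h Φ) g = ev Φ g := by
  subst h; rfl

theorem ofForm_formCast {m n : ℕ} (h : m = n) (Φ : Form K H m) :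
    ofForm K H n (formCast h Φ) = ofForm K H m Φ := by
  subst h; rfl

theorem hochD_mul {m n : ℕ} (Φ : Form K H m) (Ψ : Form K H n) (g : ℕ → H) :
    hochD K (m + n) (ev (formMul Φ Ψ)) g =
      hochD K m (ev Φ) g * ev Ψ (fun i => g (m + 1 + i)) +
        (-1) ^ m * (ev Φ g * hochD K n (ev Ψ) (fun i => g (m + i))) := by
  have h1 : ∀ k ∈ Finset.range m, (-1 : K) ^ (k + 1) * ev (formMul Φ Ψ) (contr k g) =
      (-1) ^ (k + 1) * ev Φ (contr k g) * ev Ψ (fun i => g (m + 1 + i)) := by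
    intro k hk
    rw [Finset.mem_range] at hk
    rw [ev_formMul, mul_assoc]
    congr 3
    funext i
    rw [contr, if_neg (by omega), if_neg (by omega)]
    congr 1
    omega
  have h2 : ∀ k ∈ Finset.range n, (-1 : K) ^ (m + k + 1) * ev (formMul Φ Ψ) (contr (m + k) g) =
      (-1) ^ m * (ev Φ g * ((-1) ^ (k + 1) * ev Ψ (contr k (fun i => g (m + i))))) := by
    intro k hk
    rw [Finset.mem_range] at hk
    rw [ev_formMul, ev_congr Φ (g' := g) fun i hi => by rw [contr, if_pos (by omega)],
      show (fun i => contr (m + k) g (m + i)) = contr k (fun i => g (m + i)) from by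
        funext i; simp only [contr, add_lt_add_iff_left, add_right_inj, add_assoc]]
    rw [add_assoc, pow_add]
    ring
  rw [hochD, hochD, hochD, barD, barD, barD, Finset.sum_range_add, Finset.sum_congr rfl h1,
    Finset.sum_congr rfl h2, ← Finset.sum_mul, ← Finset.mul_sum, ← Finset.mul_sum, ev_formMul,
    ev_formMul]
  have h3 : (fun i => g (m + i + 1)) = fun i => g (m + 1 + i) := by
    funext i; congr 1; omega
  have h4 : (fun i => g (m + (i + 1))) = fun i => g (m + 1 + i) := by
    funext i; congr 1; omega
  simp only [h3, h4, add_zero]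
  ring

variable (K H)

/-- The Hochschild differential of `C(H)`. -/
def formD : MForms K H →ₗ[K] MForms K H :=
  formsLift fun n => ofForm K H (n + 1) ∘ₗ hochschild n

/-- The graded differential algebra `C(H)` of Hochschild cochains of `H` with coefficients in the
trivial bimodule `K`. -/
abbrev cochainAlgebra : GradedDiffAlgebra.{u, max u v} K where
  carrier := MForms K H
  deg := formDeg K H
  d := formD K H
  d_mem := by
    rintro n _ ⟨Φ, rfl⟩
    exact ⟨hochschild n Φ, by simp [formD]⟩
  d_mul := by
    rintro m _ y ⟨Φ, rfl⟩
    have : formD K H ∘ₗ LinearMap.mulLeft K (ofForm K H m Φ) =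
        LinearMap.mulLeft K (formD K H (ofForm K H m Φ)) +
          (-1 : K) ^ m • (LinearMap.mulLeft K (ofForm K H m Φ) ∘ₗ formD K H) := by
      refine forms_hom_ext fun n Ψ => ?_
      simp only [LinearMap.comp_apply, LinearMap.add_apply, LinearMap.smul_apply,
        LinearMap.mulLeft_apply, formD, formsLift_ofForm, ofForm_mul]
      rw [← ofForm_formCast (show m + 1 + n = m + n + 1 by omega),
        ← ofForm_formCast (show m + (n + 1) = m + n + 1 by omega), ← map_smul, ← map_add]
      congr 1
      refine form_ext fun g => ?_
      rw [ev_hochschild, hochD_mul]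
      refine Eq.trans ?_ (congrArg₂ (fun a b => a + (-1 : K) ^ m * b)
        (ev_formCast _ _ g) (ev_formCast _ _ g)).symm
      rw [ev_formMul, ev_formMul, ev_hochschild, ev_hochschild]
    exact LinearMap.congr_fun this y
  d_d x := by
    have : formD K H ∘ₗ formD K H = 0 := forms_hom_ext fun n Φ => by
      simp [formD, hochschild_hochschild]
    exact LinearMap.congr_fun this x

end Hochschild

/-! ### The contractions `i_h` on `C(H)` -/

section Contraction

variable (K : Type u) [Field K] (H : Type v) [Ring H] [HopfAlgebra K H]

/-- The right adjoint action `ad(h) g = ∑ S(h⁽¹⁾) g h⁽²⁾`, with `adR K H h g = ad(h) g`. -/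
def adR : H →ₗ[K] H →ₗ[K] H :=
  TensorProduct.lift
    ((LinearMap.mul K (Module.End K H)).compl₁₂
      (LinearMap.mul K H ∘ₗ HopfAlgebra.antipode K) (LinearMap.mul K H).flip) ∘ₗ
    Coalgebra.comul

/-- The iterated coproduct `H → H^{⊗n}`, `h ↦ ∑ h⁽¹⁾ ⊗ ⋯ ⊗ h⁽ⁿ⁾`; it is the counit for `n = 0` and
the identity for `n = 1`. -/
def iterComul : (n : ℕ) → H →ₗ[K] ⨂[K]^n H
  | 0 => TensorPower.algebraMap₀.toLinearMap ∘ₗ Coalgebra.counit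
  | n + 1 => TensorPower.mulEquiv.toLinearMap ∘ₗ
      TensorProduct.map (iterComul n)
        (PiTensorProduct.subsingletonEquiv (R := K) (s := fun _ : Fin 1 => H) 0).symm.toLinearMap ∘ₗ
      Coalgebra.comul

variable {H}

/-- The tuple `(g₁, …, g_p, a₁ - ε(a₁) 1, ad(a₂) g_{p+1}, …, ad(a_{m+1-p}) g_m)`. -/
def contractionArg {m : ℕ} (p : Fin (m + 1)) (g : Fin m → H) (a : Fin (m + 1 - p) → H)
    (j : Fin (m + 1)) : H :=
  if hj : (j : ℕ) < p then g ⟨j, by omega⟩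
  else if hj' : (j : ℕ) = p then
    a ⟨0, by omega⟩ - Coalgebra.counit (R := K) (a ⟨0, by omega⟩) • (1 : H)
  else adR K H (a ⟨j - p, by omega⟩) (g ⟨j - 1, by omega⟩)

theorem contractionArg_update_right {m : ℕ} (p : Fin (m + 1)) (g : Fin m → H)
    (a : Fin (m + 1 - p) → H) (i : Fin (m + 1 - p)) :
    ∃ (s : Fin (m + 1)) (φ : H →ₗ[K] H), ∀ x, contractionArg K p g (Function.update a i x) =
      Function.update (contractionArg K p g a) s (φ x) := by
  obtain ⟨p, hp⟩ := p
  obtain ⟨i, hi⟩ := i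
  simp only at hi
  by_cases h : i = 0
  · subst h
    refine ⟨⟨p, hp⟩, LinearMap.id - (Coalgebra.counit (R := K)).smulRight (1 : H), fun x => ?_⟩
    funext ⟨j, hj⟩
    simp only [contractionArg, Function.update_apply, Fin.ext_iff, LinearMap.sub_apply,
      LinearMap.id_apply, LinearMap.smulRight_apply]
    split_ifs <;> first | rfl | omega
  · refine ⟨⟨p + i, by omega⟩, (adR K H).flip (g ⟨p + i - 1, by omega⟩), fun x => ?_⟩
    funext ⟨j, hj⟩
    simp only [contractionArg, Function.update_apply, Fin.ext_iff, LinearMap.flip_apply]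
    split_ifs <;> first | rfl | omega | (congr 3; omega)

theorem contractionArg_update_left {m : ℕ} (p : Fin (m + 1)) (a : Fin (m + 1 - p) → H)
    (g : Fin m → H) (i : Fin m) :
    ∃ (s : Fin (m + 1)) (φ : H →ₗ[K] H), ∀ x, contractionArg K p (Function.update g i x) a =
      Function.update (contractionArg K p g a) s (φ x) := by
  obtain ⟨p, hp⟩ := p
  obtain ⟨i, hi⟩ := i
  by_cases h : i < p
  · refine ⟨⟨i, by omega⟩, LinearMap.id, fun x => ?_⟩
    funext ⟨j, hj⟩
    simp only [contractionArg, Function.update_apply, Fin.ext_iff, LinearMap.id_apply]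
    split_ifs <;> first | rfl | omega
  · refine ⟨⟨i + 1, by omega⟩, adR K H (a ⟨i + 1 - p, by simp only; omega⟩), fun x => ?_⟩
    funext ⟨j, hj⟩
    simp only [contractionArg, Function.update_apply, Fin.ext_iff]
    split_ifs <;> first | rfl | omega | (congr 3; omega) | (congr 4; omega)

/-- The `p`-th summand of the contraction of `Ψ`, evaluated on `g₁, …, g_m`, as a multilinear
function of the legs of the iterated coproduct. -/
def contractionTerm {m : ℕ} (p : Fin (m + 1)) (Ψ : Form K H (m + 1)) (g : Fin m → H) :
    MultilinearMap K (fun _ : Fin (m + 1 - p) => H) K :=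
  substitute Ψ (contractionArg K p g) (contractionArg_update_right K p g)

/-- For `Ψ ∈ C^{m+1}(H)`, the form `i_h(Ψ) ∈ C^m(H)` given by
`i_h(Ψ)(g₁, …, g_m) = ∑_{p=0}^{m} (-1)^p ∑
  Ψ(g₁, …, g_p, h⁽¹⁾ - ε(h⁽¹⁾) 1, ad(h⁽²⁾) g_{p+1}, …, ad(h^{(m+1-p)}) g_m)`. -/
def contraction (m : ℕ) : H →ₗ[K] Form K H (m + 1) →ₗ[K] Form K H m :=
  LinearMap.mk₂ K
    (fun h Ψ => MultilinearMap.mk'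
      (fun g => ∑ p : Fin (m + 1), (-1 : K) ^ (p : ℕ) *
        PiTensorProduct.lift (contractionTerm K p Ψ g) (iterComul K H (m + 1 - p) h))
      (fun g i x y => by
        rw [← Finset.sum_add_distrib]
        refine Finset.sum_congr rfl fun p _ => ?_
        rw [← mul_add, ← LinearMap.add_apply, ← map_add]
        congr 3
        ext a
        obtain ⟨s, φ, h⟩ := contractionArg_update_left K p a g i
        simp [contractionTerm, h])
      (fun g i c x => by
        rw [Finset.smul_sum]
        refine Finset.sum_congr rfl fun p _ => ?_
        rw [← mul_smul_comm, ← LinearMap.smul_apply, ← map_smul]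
        congr 3
        ext a
        obtain ⟨s, φ, h⟩ := contractionArg_update_left K p a g i
        simp [contractionTerm, h]))
    (fun h h' Ψ => by ext g; simp [mul_add, Finset.sum_add_distrib])
    (fun c h Ψ => by ext g; simp [Finset.mul_sum, mul_left_comm])
    (fun h Ψ Ψ' => by
      ext g
      simp only [MultilinearMap.mk'_apply, add_apply, ← Finset.sum_add_distrib]
      refine Finset.sum_congr rfl fun p _ => ?_
      rw [← mul_add, ← LinearMap.add_apply, ← map_add]
      rfl)
    (fun c h Ψ => by
      ext g
      simp only [MultilinearMap.mk'_apply, smul_apply, Finset.smul_sum]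
      refine Finset.sum_congr rfl fun p _ => ?_
      rw [← mul_smul_comm, ← LinearMap.smul_apply, ← map_smul]
      rfl)

theorem contraction_apply (m : ℕ) (h : H) (Ψ : Form K H (m + 1)) (g : Fin m → H) :
    contraction K m h Ψ g = ∑ p : Fin (m + 1), (-1) ^ (p : ℕ) *
      PiTensorProduct.lift (contractionTerm K p Ψ g) (iterComul K H (m + 1 - p) h) := rfl

variable (H)

/-- The operation `h ↦ i_h` of `H` in `C(H)`; it vanishes on `C⁰(H)`. -/
def cochainContraction : H →ₗ[K] Module.End K (MForms K H) where
  toFun h := formsLift fun n => match n with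
    | 0 => 0
    | m + 1 => ofForm K H m ∘ₗ contraction K m h
  map_add' h h' := forms_hom_ext fun n Φ => by
    rw [LinearMap.add_apply, formsLift_ofForm, formsLift_ofForm, formsLift_ofForm]
    cases n with
    | zero => simp
    | succ m => simp
  map_smul' c h := forms_hom_ext fun n Φ => by
    rw [LinearMap.smul_apply, formsLift_ofForm, formsLift_ofForm]
    cases n with
    | zero => simp
    | succ m => simp

end Contraction

/-! ### Operations and algebraic connections -/

section Operation

variable {K : Type u} [Field K] {H : Type v} [Ring H] [HopfAlgebra K H]

/-- `L_h = d i_h + i_h d + ε(h) I`. -/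
def lieOp (Ω : GradedDiffAlgebra.{u, w} K) (i : H →ₗ[K] Module.End K Ω) :
    H →ₗ[K] Module.End K Ω :=
  LinearMap.mulLeft K (Ω.d : Module.End K Ω) ∘ₗ i + LinearMap.mulRight K (Ω.d : Module.End K Ω) ∘ₗ i +
    (Coalgebra.counit (R := K) (A := H)).smulRight (1 : Module.End K Ω)

theorem lieOp_apply (Ω : GradedDiffAlgebra.{u, w} K) (i : H →ₗ[K] Module.End K Ω) (h : H) (x : Ω) :
    lieOp Ω i h x = Ω.d (i h x) + i h (Ω.d x) + Coalgebra.counit (R := K) h • x := rfl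

/-- The value `∑ B(h⁽¹⁾, h⁽²⁾)` of a bilinear map on the coproduct of `h`. -/
def sweedler {M : Type*} [AddCommGroup M] [Module K M] (B : H →ₗ[K] H →ₗ[K] M) (h : H) : M :=
  TensorProduct.lift B (Coalgebra.comul h)

/-- An operation `h ↦ i_h` of the Hopf algebra `H` in the graded differential algebra `Ω`. -/
structure IsOperation (Ω : GradedDiffAlgebra.{u, w} K) (i : H →ₗ[K] Module.End K Ω) : Prop where
  /-- `i_h` is homogeneous of degree `-1` (and `Ω` vanishes in negative degrees). -/
  deg_zero : ∀ (h : H) (x : Ω), x ∈ Ω.deg 0 → i h x = 0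
  deg_succ : ∀ (h : H) (n : ℕ) (x : Ω), x ∈ Ω.deg (n + 1) → i h x ∈ Ω.deg n
  /-- `i_1 = 0` -/
  one : i 1 = 0
  /-- `i_h(xy) = ∑ i_{h⁽¹⁾}(x) L_{h⁽²⁾}(y) + (-1)ⁿ x i_h(y)` for `x ∈ Ωⁿ` -/
  mul : ∀ (h : H) (n : ℕ) (x y : Ω), x ∈ Ω.deg n →
    i h (x * y) =
      sweedler ((LinearMap.mul K Ω).compl₁₂ (i.flip x) ((lieOp Ω i).flip y)) h +
        (-1 : K) ^ n • (x * i h y)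
  /-- `i_g L_h = ∑ L_{h⁽¹⁾} i_{ad(h⁽²⁾) g}` -/
  comp_lie : ∀ g h : H,
    i g * lieOp Ω i h =
      sweedler ((LinearMap.mul K (Module.End K Ω)).compl₁₂ (lieOp Ω i) (i ∘ₗ (adR K H).flip g)) h
  /-- `L_h L_g = L_{hg}` -/
  lie_lie : ∀ h g : H, lieOp Ω i h * lieOp Ω i g = lieOp Ω i (h * g)

/-- An algebraic connection on the operation `i` of `H` in `Ω`: a homomorphism of graded algebras
`α : C(H) → Ω` with `i_h α = α i_h` and `L_h α = α L_h`. -/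
structure IsConnection (Ω : GradedDiffAlgebra.{u, w} K) (i : H →ₗ[K] Module.End K Ω)
    (α : cochainAlgebra K H →ₐ[K] Ω) : Prop where
  deg : ∀ (n : ℕ) (Ψ : cochainAlgebra K H), Ψ ∈ (cochainAlgebra K H).deg n → α Ψ ∈ Ω.deg n
  contraction : ∀ (h : H) (Ψ : cochainAlgebra K H), i h (α Ψ) = α (cochainContraction K H h Ψ)
  lie : ∀ (h : H) (Ψ : cochainAlgebra K H),
    lieOp Ω i h (α Ψ) = α (lieOp (cochainAlgebra K H) (cochainContraction K H) h Ψ)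

/-- The curvature `φ = d α - α d` of a connection. -/
def curvature (Ω : GradedDiffAlgebra.{u, w} K) (α : cochainAlgebra K H →ₐ[K] Ω) :
    cochainAlgebra K H →ₗ[K] Ω :=
  Ω.d ∘ₗ α.toLinearMap - α.toLinearMap ∘ₗ (cochainAlgebra K H).d

end Operation

/-! ### Differential envelopes of graded algebras -/

section Envelope

variable {K : Type u} [Field K] {A : Type w} [Ring A] [Algebra K A]

/-- The linear map with value `(-1)ⁿ x` on the homogeneous elements `x` of degree `n`. -/
def gradeInv (𝒜 : ℕ → Submodule K A) [GradedAlgebra 𝒜] : A →ₗ[K] A :=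
  DirectSum.toModule K ℕ A (fun n => (-1 : K) ^ n • (𝒜 n).subtype) ∘ₗ
    (DirectSum.decomposeLinearEquiv 𝒜).toLinearMap

theorem gradeInv_of_mem (𝒜 : ℕ → Submodule K A) [GradedAlgebra 𝒜] {n : ℕ} {x : A} (hx : x ∈ 𝒜 n) :
    gradeInv 𝒜 x = (-1 : K) ^ n • x := by
  simp only [gradeInv, LinearMap.comp_apply, LinearEquiv.coe_coe,
    DirectSum.decomposeLinearEquiv_apply]
  rw [DirectSum.decompose_of_mem 𝒜 hx, ← DirectSum.lof_eq_of K, DirectSum.toModule_lof]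
  rfl

theorem gradeInv_one (𝒜 : ℕ → Submodule K A) [GradedAlgebra 𝒜] : gradeInv 𝒜 1 = 1 := by
  rw [gradeInv_of_mem 𝒜 SetLike.GradedOne.one_mem]; simp

theorem gradeInv_mul (𝒜 : ℕ → Submodule K A) [GradedAlgebra 𝒜] (x y : A) :
    gradeInv 𝒜 (x * y) = gradeInv 𝒜 x * gradeInv 𝒜 y := by
  induction x using DirectSum.Decomposition.inductionOn 𝒜 with
  | zero => simp
  | add x x' h h' => simp only [add_mul, map_add, h, h']
  | @homogeneous m x =>
    induction y using DirectSum.Decomposition.inductionOn 𝒜 with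
    | zero => simp
    | add y y' h h' => simp only [mul_add, map_add, h, h']
    | @homogeneous n y =>
      rw [gradeInv_of_mem 𝒜 x.2, gradeInv_of_mem 𝒜 y.2,
        gradeInv_of_mem 𝒜 (SetLike.GradedMul.mul_mem x.2 y.2), smul_mul_smul_comm, pow_add]

theorem gradeInv_gradeInv (𝒜 : ℕ → Submodule K A) [GradedAlgebra 𝒜] (x : A) :
    gradeInv 𝒜 (gradeInv 𝒜 x) = x := by
  induction x using DirectSum.Decomposition.inductionOn 𝒜 with
  | zero => simp
  | add x x' h h' => simp only [map_add, h, h']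
  | @homogeneous m x =>
    rw [gradeInv_of_mem 𝒜 x.2, map_smul, gradeInv_of_mem 𝒜 x.2, smul_smul, ← mul_pow]
    simp

variable (𝒜 : ℕ → Submodule K A) [GradedAlgebra 𝒜]

/-- The twisted product `A ⊗ A → A`, `a ⊗ b ↦ (-1)ˢ a b` for `b` of degree `s`. -/
def twistedMul : A ⊗[K] A →ₗ[K] A :=
  TensorProduct.lift ((LinearMap.mul K A).compl₂ (gradeInv 𝒜))

@[simp] theorem twistedMul_tmul (a b : A) : twistedMul 𝒜 (a ⊗ₜ b) = a * gradeInv 𝒜 b := rfl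

/-- The `A`-bimodule `Ω¹_gr(A) ⊆ A ⊗ A`, the kernel of the twisted product. -/
def envForms : Submodule K (A ⊗[K] A) := LinearMap.ker (twistedMul 𝒜)

/-- The left action `x (a ⊗ b) = x a ⊗ b` on `Ω¹_gr(A)`. -/
def leftAct (x : A) : envForms 𝒜 →ₗ[K] envForms 𝒜 :=
  ((LinearMap.mulLeft K x).rTensor A).restrict fun t ht => by
    have h : twistedMul 𝒜 ∘ₗ (LinearMap.mulLeft K x).rTensor A =
        LinearMap.mulLeft K x ∘ₗ twistedMul 𝒜 :=
      TensorProduct.ext' fun a b => by simp [mul_assoc]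
    have := LinearMap.congr_fun h t
    simp only [LinearMap.comp_apply, LinearMap.mem_ker.1 ht, map_zero] at this
    exact this

/-- The right action `(a ⊗ b) y = a ⊗ b y` on `Ω¹_gr(A)`. -/
def rightAct (y : A) : envForms 𝒜 →ₗ[K] envForms 𝒜 :=
  ((LinearMap.mulRight K y).lTensor A).restrict fun t ht => by
    have h : twistedMul 𝒜 ∘ₗ (LinearMap.mulRight K y).lTensor A =
        LinearMap.mulRight K (gradeInv 𝒜 y) ∘ₗ twistedMul 𝒜 :=
      TensorProduct.ext' fun a b => by simp [mul_assoc, gradeInv_mul]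
    have := LinearMap.congr_fun h t
    simp only [LinearMap.comp_apply, LinearMap.mem_ker.1 ht, map_zero] at this
    exact this

theorem leftAct_coe (x : A) (m : envForms 𝒜) : (leftAct 𝒜 x m : A ⊗[K] A) =
    (LinearMap.mulLeft K x).rTensor A (m : A ⊗[K] A) := rfl

theorem rightAct_coe (y : A) (m : envForms 𝒜) : (rightAct 𝒜 y m : A ⊗[K] A) =
    (LinearMap.mulRight K y).lTensor A (m : A ⊗[K] A) := rfl

/-- The universal antiderivation `A → Ω¹_gr(A)`, `d x = 1 ⊗ x - (-1)ⁿ x ⊗ 1` for `x` of degree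
`n`. -/
def univD : A →ₗ[K] envForms 𝒜 :=
  (TensorProduct.mk K A A 1 - (TensorProduct.mk K A A).flip 1 ∘ₗ gradeInv 𝒜).codRestrict _
    fun x => by simp [envForms, gradeInv_one]

theorem univD_coe (x : A) :
    (univD 𝒜 x : A ⊗[K] A) = 1 ⊗ₜ x - gradeInv 𝒜 x ⊗ₜ 1 := rfl

theorem univD_mul (x y : A) :
    univD 𝒜 (x * y) = rightAct 𝒜 y (univD 𝒜 x) + leftAct 𝒜 (gradeInv 𝒜 x) (univD 𝒜 y) := by
  refine Subtype.ext ?_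
  simp only [Submodule.coe_add, leftAct_coe, rightAct_coe, univD_coe, map_sub, LinearMap.lTensor_tmul, LinearMap.rTensor_tmul,
    LinearMap.mulLeft_apply, LinearMap.mulRight_apply, gradeInv_mul, one_mul, mul_one]
  abel

/-- The relations defining the tensor algebra over `A` of the bimodule `Ω¹_gr(A)`, as a quotient of
the free algebra on the vector space `A × Ω¹_gr(A)`: the product and the unit are those of `A`, and
the products with elements of `A` are given by the bimodule structure. -/
inductive EnvRel : TensorAlgebra K (A × envForms 𝒜) → TensorAlgebra K (A × envForms 𝒜) → Prop
  | one : EnvRel (TensorAlgebra.ι K (1, 0)) 1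
  | mul (a b : A) : EnvRel (TensorAlgebra.ι K (a * b, 0))
      (TensorAlgebra.ι K (a, 0) * TensorAlgebra.ι K (b, 0))
  | left (a : A) (m : envForms 𝒜) : EnvRel (TensorAlgebra.ι K (0, leftAct 𝒜 a m))
      (TensorAlgebra.ι K (a, 0) * TensorAlgebra.ι K (0, m))
  | right (m : envForms 𝒜) (a : A) : EnvRel (TensorAlgebra.ι K (0, rightAct 𝒜 a m))
      (TensorAlgebra.ι K (0, m) * TensorAlgebra.ι K (a, 0))

/-- The algebra `Ω_gr(A)`, the tensor algebra over `A` of the bimodule `Ω¹_gr(A)`. -/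
def Env : Type (max u w) := RingQuot (EnvRel 𝒜)

instance : Ring (Env 𝒜) := inferInstanceAs (Ring (RingQuot (EnvRel 𝒜)))

instance : Algebra K (Env 𝒜) := inferInstanceAs (Algebra K (RingQuot (EnvRel 𝒜)))

/-- The quotient map. -/
def envMk : TensorAlgebra K (A × envForms 𝒜) →ₐ[K] Env 𝒜 := RingQuot.mkAlgHom K (EnvRel 𝒜)

theorem envMk_rel {s t : TensorAlgebra K (A × envForms 𝒜)} (h : EnvRel 𝒜 s t) :
    envMk 𝒜 s = envMk 𝒜 t :=
  RingQuot.mkAlgHom_rel K h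

/-- The canonical homomorphism `A → Ω_gr(A)`. -/
def envIn : A →ₐ[K] Env 𝒜 :=
  AlgHom.ofLinearMap
    ((envMk 𝒜).toLinearMap ∘ₗ TensorAlgebra.ι K ∘ₗ LinearMap.inl K A (envForms 𝒜))
    ((envMk_rel 𝒜 .one).trans (map_one _))
    (fun a b => (envMk_rel 𝒜 (.mul a b)).trans (map_mul _ _ _))

/-- The canonical map `Ω¹_gr(A) → Ω_gr(A)`. -/
def envInForms : envForms 𝒜 →ₗ[K] Env 𝒜 :=
  (envMk 𝒜).toLinearMap ∘ₗ TensorAlgebra.ι K ∘ₗ LinearMap.inr K A (envForms 𝒜)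

theorem envInForms_left (a : A) (m : envForms 𝒜) :
    envInForms 𝒜 (leftAct 𝒜 a m) = envIn 𝒜 a * envInForms 𝒜 m :=
  (envMk_rel 𝒜 (.left a m)).trans (map_mul _ _ _)

theorem envInForms_right (m : envForms 𝒜) (a : A) :
    envInForms 𝒜 (rightAct 𝒜 a m) = envInForms 𝒜 m * envIn 𝒜 a :=
  (envMk_rel 𝒜 (.right m a)).trans (map_mul _ _ _)

/-- The elements `d a` of `Ω_gr(A)`, for `a` in `A`. -/
def envDiff : A →ₗ[K] Env 𝒜 := envInForms 𝒜 ∘ₗ univD 𝒜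

theorem envDiff_mul (a b : A) :
    envDiff 𝒜 (a * b) = envDiff 𝒜 a * envIn 𝒜 b + envIn 𝒜 (gradeInv 𝒜 a) * envDiff 𝒜 b := by
  simp only [envDiff, LinearMap.comp_apply, univD_mul, map_add, envInForms_left, envInForms_right]

/-- For linear maps `f`, `δ` on `A`, the linear map `a ⊗ b ↦ f(a) δ(b)`. -/
def pairing {B : Type*} [Semiring B] [Algebra K B] (f δ : A →ₗ[K] B) : A ⊗[K] A →ₗ[K] B :=
  TensorProduct.lift ((LinearMap.mul K B).compl₁₂ f δ)

@[simp] theorem pairing_tmul {B : Type*} [Semiring B] [Algebra K B] (f δ : A →ₗ[K] B) (a b : A) :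
    pairing f δ (a ⊗ₜ b) = f a * δ b := rfl

/-- Any element `∑ x ⊗ y` of `Ω¹_gr(A)` is equal to `∑ x d y`. -/
theorem envInForms_eq (m : envForms 𝒜) :
    envInForms 𝒜 m = pairing (envIn 𝒜).toLinearMap (envDiff 𝒜) (m : A ⊗[K] A) := by
  let R : A ⊗[K] A →ₗ[K] envForms 𝒜 := TensorProduct.lift (LinearMap.mk₂ K
    (fun a b => leftAct 𝒜 a (univD 𝒜 b))
    (fun a a' b => Subtype.ext (by simp [leftAct_coe, univD_coe, TensorProduct.add_tmul, add_mul]; abel))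
    (fun c a b => Subtype.ext (by
      simp [leftAct_coe, univD_coe, TensorProduct.smul_tmul', smul_sub]))
    (fun a b b' => by simp) (fun c a b => by simp))
  have h1 : (envForms 𝒜).subtype ∘ₗ R = LinearMap.id -
      (TensorProduct.mk K A A).flip 1 ∘ₗ twistedMul 𝒜 :=
    TensorProduct.ext' fun a b => by simp [R, leftAct_coe, univD_coe]
  have h2 : envInForms 𝒜 ∘ₗ R = pairing (envIn 𝒜).toLinearMap (envDiff 𝒜) :=
    TensorProduct.ext' fun a b => by
      simp [R, envInForms_left, envDiff]
  have h3 : R m = m := Subtype.ext (by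
    have := LinearMap.congr_fun h1 (m : A ⊗[K] A)
    simpa [LinearMap.mem_ker.1 m.2] using this)
  rw [← h2, LinearMap.comp_apply, h3]

theorem env_induction {P : Env 𝒜 → Prop} (hA : ∀ a, P (envIn 𝒜 a)) (hD : ∀ a, P (envDiff 𝒜 a))
    (hadd : ∀ x y, P x → P y → P (x + y)) (hmul : ∀ x y, P x → P y → P (x * y)) (x : Env 𝒜) :
    P x := by
  obtain ⟨t, rfl⟩ := RingQuot.mkAlgHom_surjective K (EnvRel 𝒜) x
  change P (envMk 𝒜 t)
  induction t using TensorAlgebra.induction with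
  | algebraMap r =>
    rw [AlgHom.commutes, ← (envIn 𝒜).commutes]
    exact hA _
  | ι am =>
    obtain ⟨a, m⟩ := am
    have : envMk 𝒜 (TensorAlgebra.ι K (a, m)) = envIn 𝒜 a + envInForms 𝒜 m := by
      have : ((a, m) : A × envForms 𝒜) = (a, 0) + (0, m) := by simp
      rw [this, map_add, map_add]
      rfl
    rw [this]
    refine hadd _ _ (hA a) ?_
    rw [envInForms_eq]
    induction (m : A ⊗[K] A) using TensorProduct.induction_on with
    | zero => rw [map_zero, ← map_zero (envIn 𝒜)]; exact hA 0
    | tmul a b => exact hmul _ _ (hA a) (hD b)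
    | add s t hs ht => rw [map_add]; exact hadd _ _ hs ht
  | mul s t hs ht => rw [map_mul]; exact hmul _ _ hs ht
  | add s t hs ht => rw [map_add]; exact hadd _ _ hs ht

/-- The homomorphism `Ω_gr(A) → B` given by a homomorphism `f : A → B` and an antiderivation
`δ : A → B`. -/
def envLift {B : Type*} [Semiring B] [Algebra K B] (f : A →ₐ[K] B) (δ : A →ₗ[K] B)
    (hδ : ∀ a b, δ (a * b) = δ a * f b + f (gradeInv 𝒜 a) * δ b) : Env 𝒜 →ₐ[K] B :=
  RingQuot.liftAlgHom K ⟨TensorAlgebra.lift K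
    (f.toLinearMap.coprod (pairing f.toLinearMap δ ∘ₗ (envForms 𝒜).subtype)), by
    rintro _ _ (_ | ⟨a, b⟩ | ⟨a, m⟩ | ⟨m, a⟩)
    · simp
    · simp
    · have h : pairing f.toLinearMap δ ∘ₗ (LinearMap.mulLeft K a).rTensor A =
          LinearMap.mulLeft K (f a) ∘ₗ pairing f.toLinearMap δ :=
        TensorProduct.ext' fun x y => by simp [mul_assoc]
      have := LinearMap.congr_fun h (m : A ⊗[K] A)
      simpa [leftAct_coe] using this
    · have h : pairing f.toLinearMap δ ∘ₗ (LinearMap.mulRight K a).lTensor A =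
          LinearMap.mulRight K (f a) ∘ₗ pairing f.toLinearMap δ +
            LinearMap.mulRight K (δ a) ∘ₗ f.toLinearMap ∘ₗ twistedMul 𝒜 :=
        TensorProduct.ext' fun x y => by simp [mul_assoc, hδ, mul_add]
      have := LinearMap.congr_fun h (m : A ⊗[K] A)
      simpa [rightAct_coe, LinearMap.mem_ker.1 m.2] using this⟩

theorem envLift_envIn {B : Type*} [Semiring B] [Algebra K B] (f : A →ₐ[K] B) (δ : A →ₗ[K] B) (hδ)
    (a : A) : envLift 𝒜 f δ hδ (envIn 𝒜 a) = f a := by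
  refine (RingQuot.liftAlgHom_mkAlgHom_apply _ _ _ _).trans ?_
  simp

theorem envLift_envInForms {B : Type*} [Semiring B] [Algebra K B] (f : A →ₐ[K] B) (δ : A →ₗ[K] B) (hδ)
    (m : envForms 𝒜) : envLift 𝒜 f δ hδ (envInForms 𝒜 m) =
      pairing f.toLinearMap δ (m : A ⊗[K] A) := by
  refine (RingQuot.liftAlgHom_mkAlgHom_apply _ _ _ _).trans ?_
  simp

theorem envLift_envDiff {B : Type*} [Semiring B] [Algebra K B] (f : A →ₐ[K] B) (δ : A →ₗ[K] B) (hδ)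
    (a : A) : envLift 𝒜 f δ hδ (envDiff 𝒜 a) = δ a := by
  have h1 : δ 1 = 0 := by
    have h2 : δ 1 = δ 1 + δ 1 := by simpa [gradeInv_one] using hδ 1 1
    have h3 : δ 1 + (-1 : K) • δ 1 = 0 := by
      rw [← map_smul, ← map_add, neg_one_smul, add_neg_cancel, map_zero]
    calc δ 1 = δ 1 + (δ 1 + (-1 : K) • δ 1) := by rw [h3, add_zero]
      _ = 0 := by rw [← add_assoc, ← h2, h3]
  rw [envDiff, LinearMap.comp_apply, envLift_envInForms, univD_coe, sub_eq_add_neg,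
    ← neg_one_smul K, map_add, map_smul]
  simp [h1]

theorem envIn_injective : Function.Injective (envIn 𝒜) :=
  Function.LeftInverse.injective (g := envLift 𝒜 (AlgHom.id K A) 0 (by simp))
    (envLift_envIn 𝒜 _ _ _)

/-! #### The grading of the envelope -/

/-- The homogeneous component of degree `n` of `A ⊗ A`. -/
def tensorDeg (n : ℕ) : Submodule K (A ⊗[K] A) :=
  Submodule.span K {t | ∃ (r s : ℕ) (x y : A), r + s = n ∧ x ∈ 𝒜 r ∧ y ∈ 𝒜 s ∧ t = x ⊗ₜ y}

/-- Products of homogeneous elements of `A` and of `Ω¹_gr(A)`, with their total degree; the degrees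
of the elements of `Ω¹_gr(A) ⊆ A ⊗ A` are shifted by one. -/
inductive EnvHomog : ℕ → Env 𝒜 → Prop
  | ofAlg (n : ℕ) (a : A) (ha : a ∈ 𝒜 n) : EnvHomog n (envIn 𝒜 a)
  | ofForms (n : ℕ) (m : envForms 𝒜) (hm : (m : A ⊗[K] A) ∈ tensorDeg 𝒜 n) :
      EnvHomog (n + 1) (envInForms 𝒜 m)
  | mul (m n : ℕ) (x y : Env 𝒜) (hx : EnvHomog m x) (hy : EnvHomog n y) : EnvHomog (m + n) (x * y)

/-- The homogeneous component of degree `n` of `Ω_gr(A)`. -/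
def envDeg (n : ℕ) : Submodule K (Env 𝒜) := Submodule.span K {x | EnvHomog 𝒜 n x}

theorem envIn_mem {n : ℕ} {a : A} (ha : a ∈ 𝒜 n) : envIn 𝒜 a ∈ envDeg 𝒜 n :=
  Submodule.subset_span (.ofAlg n a ha)

theorem envDiff_mem {n : ℕ} {a : A} (ha : a ∈ 𝒜 n) : envDiff 𝒜 a ∈ envDeg 𝒜 (n + 1) := by
  refine Submodule.subset_span (.ofForms n _ ?_)
  rw [univD_coe, gradeInv_of_mem 𝒜 ha]
  refine Submodule.sub_mem _ (Submodule.subset_span ?_) (Submodule.subset_span ?_)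
  · exact ⟨0, n, 1, a, zero_add n, SetLike.GradedOne.one_mem, ha, rfl⟩
  · exact ⟨n, 0, _, 1, add_zero n, Submodule.smul_mem _ _ ha, SetLike.GradedOne.one_mem, rfl⟩

instance : SetLike.GradedMonoid (envDeg 𝒜) where
  one_mem := by
    rw [← map_one (envIn 𝒜)]
    exact envIn_mem 𝒜 SetLike.GradedOne.one_mem
  mul_mem := by
    intro m n x y hx hy
    have := Submodule.mul_mem_mul hx hy
    rw [envDeg, envDeg, Submodule.span_mul_span] at this
    refine Submodule.span_mono ?_ this
    rintro _ ⟨x, hx, y, hy, rfl⟩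
    exact .mul m n x y hx hy

/-- The linear map from `A` to the external direct sum of the `envDeg 𝒜 n` given by a homogeneous
linear map of degree `s`. -/
def homogLift (s : ℕ) (g : A →ₗ[K] Env 𝒜) (hg : ∀ n, ∀ x ∈ 𝒜 n, g x ∈ envDeg 𝒜 (n + s)) :
    A →ₗ[K] ⨁ n, envDeg 𝒜 n :=
  DirectSum.toModule K ℕ _ (fun n => DirectSum.lof K ℕ (fun n => envDeg 𝒜 n) (n + s) ∘ₗ
    (g ∘ₗ (𝒜 n).subtype).codRestrict (envDeg 𝒜 (n + s)) (fun x => hg n x x.2)) ∘ₗ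
    (DirectSum.decomposeLinearEquiv 𝒜).toLinearMap

theorem homogLift_of_mem (s : ℕ) (g : A →ₗ[K] Env 𝒜) (hg) {n : ℕ} {x : A} (hx : x ∈ 𝒜 n) :
    homogLift 𝒜 s g hg x = DirectSum.of (fun n => envDeg 𝒜 n) (n + s) ⟨g x, hg n x hx⟩ := by
  simp only [homogLift, LinearMap.comp_apply, LinearEquiv.coe_coe,
    DirectSum.decomposeLinearEquiv_apply]
  rw [DirectSum.decompose_of_mem 𝒜 hx, ← DirectSum.lof_eq_of K, DirectSum.toModule_lof]
  rfl

theorem coe_homogLift (s : ℕ) (g : A →ₗ[K] Env 𝒜) (hg) (x : A) :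
    DirectSum.coeAlgHom (envDeg 𝒜) (homogLift 𝒜 s g hg x) = g x := by
  induction x using DirectSum.Decomposition.inductionOn 𝒜 with
  | zero => simp
  | add x x' h h' => simp only [map_add, h, h']
  | @homogeneous m x => rw [homogLift_of_mem 𝒜 s g hg x.2, DirectSum.coeAlgHom_of]

theorem of_env_eq {m n : ℕ} (h : m = n) {x y : Env 𝒜} (hxy : x = y) (hx : x ∈ envDeg 𝒜 m)
    (hy : y ∈ envDeg 𝒜 n) : DirectSum.of (fun n => envDeg 𝒜 n) m ⟨x, hx⟩ =
      DirectSum.of (fun n => envDeg 𝒜 n) n ⟨y, hy⟩ := by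
  subst h hxy; rfl

theorem envIn_mem_add (n : ℕ) (a : A) (ha : a ∈ 𝒜 n) :
    (envIn 𝒜).toLinearMap a ∈ envDeg 𝒜 (n + 0) := envIn_mem 𝒜 ha

theorem envDiff_mem_add (n : ℕ) (a : A) (ha : a ∈ 𝒜 n) :
    envDiff 𝒜 a ∈ envDeg 𝒜 (n + 1) := envDiff_mem 𝒜 ha

/-- The canonical homomorphism from `A` to the external direct sum. -/
def decompIn : A →ₐ[K] ⨁ n, envDeg 𝒜 n :=
  AlgHom.ofLinearMap (homogLift 𝒜 0 (envIn 𝒜).toLinearMap (envIn_mem_add 𝒜))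
    (by
      rw [homogLift_of_mem 𝒜 _ _ _ SetLike.GradedOne.one_mem, DirectSum.one_def]
      exact of_env_eq 𝒜 rfl (map_one (envIn 𝒜)) _ _)
    (fun x y => by
      induction x using DirectSum.Decomposition.inductionOn 𝒜 with
      | zero => simp
      | add x x' h h' => simp only [add_mul, map_add, h, h']
      | @homogeneous m x =>
        induction y using DirectSum.Decomposition.inductionOn 𝒜 with
        | zero => simp
        | add y y' h h' => simp only [mul_add, map_add, h, h']
        | @homogeneous n y =>
          rw [homogLift_of_mem 𝒜 _ _ _ x.2, homogLift_of_mem 𝒜 _ _ _ y.2,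
            homogLift_of_mem 𝒜 _ _ _ (SetLike.GradedMul.mul_mem x.2 y.2), DirectSum.of_mul_of]
          exact of_env_eq 𝒜 rfl (map_mul (envIn 𝒜) _ _) _ _)

/-- The universal antiderivation with values in the external direct sum. -/
def decompDiff : A →ₗ[K] ⨁ n, envDeg 𝒜 n :=
  homogLift 𝒜 1 (envDiff 𝒜) (envDiff_mem_add 𝒜)

theorem decompIn_of_mem {n : ℕ} {x : A} (hx : x ∈ 𝒜 n) :
    decompIn 𝒜 x = DirectSum.of (fun n => envDeg 𝒜 n) n ⟨envIn 𝒜 x, envIn_mem 𝒜 hx⟩ :=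
  homogLift_of_mem 𝒜 0 _ _ hx

theorem decompDiff_of_mem {n : ℕ} {x : A} (hx : x ∈ 𝒜 n) :
    decompDiff 𝒜 x = DirectSum.of (fun n => envDeg 𝒜 n) (n + 1) ⟨envDiff 𝒜 x, envDiff_mem 𝒜 hx⟩ :=
  homogLift_of_mem 𝒜 1 _ _ hx

theorem decompDiff_mul (x y : A) :
    decompDiff 𝒜 (x * y) =
      decompDiff 𝒜 x * decompIn 𝒜 y + decompIn 𝒜 (gradeInv 𝒜 x) * decompDiff 𝒜 y := by
  induction x using DirectSum.Decomposition.inductionOn 𝒜 with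
  | zero => simp
  | add x x' h h' => simp only [add_mul, map_add, h, h']; abel
  | @homogeneous m x =>
    induction y using DirectSum.Decomposition.inductionOn 𝒜 with
    | zero => simp
    | add y y' h h' => simp only [mul_add, map_add, h, h']; abel
    | @homogeneous n y =>
      have hs : gradeInv 𝒜 (x : A) ∈ 𝒜 m := by
        rw [gradeInv_of_mem 𝒜 x.2]; exact Submodule.smul_mem _ _ x.2
      rw [decompDiff_of_mem 𝒜 x.2, decompIn_of_mem 𝒜 y.2, decompIn_of_mem 𝒜 hs,
        decompDiff_of_mem 𝒜 y.2, decompDiff_of_mem 𝒜 (SetLike.GradedMul.mul_mem x.2 y.2),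
        DirectSum.of_mul_of, DirectSum.of_mul_of]
      have h1 : envDiff 𝒜 x * envIn 𝒜 y ∈ envDeg 𝒜 (m + n + 1) := by
        rw [show m + n + 1 = m + 1 + n by omega]
        exact SetLike.GradedMul.mul_mem (envDiff_mem 𝒜 x.2) (envIn_mem 𝒜 y.2)
      have h2 : envIn 𝒜 (gradeInv 𝒜 x) * envDiff 𝒜 y ∈ envDeg 𝒜 (m + n + 1) := by
        rw [add_assoc]
        exact SetLike.GradedMul.mul_mem (envIn_mem 𝒜 hs) (envDiff_mem 𝒜 y.2)
      refine Eq.trans ?_ (congrArg₂ (· + ·)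
        (of_env_eq 𝒜 (show m + n + 1 = m + 1 + n by omega) rfl h1 _)
        (of_env_eq 𝒜 (show m + n + 1 = m + (n + 1) by omega) rfl h2 _))
      rw [← map_add]
      exact of_env_eq 𝒜 rfl (envDiff_mul 𝒜 x y) _ _

/-- The decomposition of the elements of `Ω_gr(A)` in homogeneous components. -/
def envDecompose : Env 𝒜 →ₐ[K] ⨁ n, envDeg 𝒜 n :=
  envLift 𝒜 (decompIn 𝒜) (decompDiff 𝒜) (decompDiff_mul 𝒜)

theorem coe_envDecompose (x : Env 𝒜) :
    DirectSum.coeAlgHom (envDeg 𝒜) (envDecompose 𝒜 x) = x := by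
  induction x using env_induction 𝒜 with
  | hA a => rw [envDecompose, envLift_envIn]; exact coe_homogLift 𝒜 0 _ (envIn_mem_add 𝒜) a
  | hD a => rw [envDecompose, envLift_envDiff]; exact coe_homogLift 𝒜 1 _ (envDiff_mem_add 𝒜) a
  | hadd x y hx hy => rw [map_add, map_add, hx, hy]
  | hmul x y hx hy => rw [map_mul, map_mul, hx, hy]

theorem envDecompose_homog {n : ℕ} {x : Env 𝒜} (hx : EnvHomog 𝒜 n x) :
    envDecompose 𝒜 x ∈ LinearMap.range (DirectSum.lof K ℕ (fun n => envDeg 𝒜 n) n) := by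
  induction hx with
  | ofAlg n a ha =>
    rw [envDecompose, envLift_envIn, decompIn_of_mem 𝒜 ha]
    exact ⟨_, rfl⟩
  | ofForms n m hm =>
    rw [envDecompose, envLift_envInForms]
    generalize (m : A ⊗[K] A) = t at hm
    induction hm using Submodule.span_induction with
    | mem t ht =>
      obtain ⟨r, s, x, y, rfl, hx, hy, rfl⟩ := ht
      rw [pairing_tmul, AlgHom.toLinearMap_apply, decompIn_of_mem 𝒜 hx, decompDiff_of_mem 𝒜 hy,
        DirectSum.of_mul_of]
      exact ⟨_, rfl⟩
    | zero => rw [map_zero]; exact Submodule.zero_mem _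
    | add s t _ _ hs ht => rw [map_add]; exact Submodule.add_mem _ hs ht
    | smul c t _ ht => rw [map_smul]; exact Submodule.smul_mem _ _ ht
  | mul m n x y _ _ hx hy =>
    obtain ⟨x', hx'⟩ := hx
    obtain ⟨y', hy'⟩ := hy
    rw [map_mul, ← hx', ← hy', DirectSum.lof_eq_of, DirectSum.lof_eq_of, DirectSum.of_mul_of]
    exact ⟨_, rfl⟩

theorem envDecompose_mem {n : ℕ} {x : Env 𝒜} (hx : x ∈ envDeg 𝒜 n) :
    envDecompose 𝒜 x ∈ LinearMap.range (DirectSum.lof K ℕ (fun n => envDeg 𝒜 n) n) := by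
  have : envDeg 𝒜 n ≤ (LinearMap.range (DirectSum.lof K ℕ (fun n => envDeg 𝒜 n) n)).comap
      (envDecompose 𝒜).toLinearMap :=
    Submodule.span_le.2 fun x hx => envDecompose_homog 𝒜 hx
  exact this hx

instance : GradedAlgebra (envDeg 𝒜) :=
  GradedAlgebra.ofAlgHom _ (envDecompose 𝒜) (AlgHom.ext (coe_envDecompose 𝒜)) fun i x => by
    obtain ⟨y, hy⟩ := envDecompose_mem 𝒜 x.2
    have := coe_envDecompose 𝒜 x
    rw [← hy, DirectSum.lof_eq_of, DirectSum.coeAlgHom_of] at this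
    rw [← hy, DirectSum.lof_eq_of, Subtype.ext this]

/-! #### The differential of the envelope -/

theorem gradeInv_envIn (a : A) :
    gradeInv (envDeg 𝒜) (envIn 𝒜 a) = envIn 𝒜 (gradeInv 𝒜 a) := by
  induction a using DirectSum.Decomposition.inductionOn 𝒜 with
  | zero => simp
  | add x x' h h' => simp only [map_add, h, h']
  | @homogeneous m x =>
    rw [gradeInv_of_mem 𝒜 x.2, gradeInv_of_mem _ (envIn_mem 𝒜 x.2), map_smul]

theorem gradeInv_envDiff (a : A) :
    gradeInv (envDeg 𝒜) (envDiff 𝒜 a) = -envDiff 𝒜 (gradeInv 𝒜 a) := by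
  induction a using DirectSum.Decomposition.inductionOn 𝒜 with
  | zero => simp
  | add x x' h h' => simp only [map_add, h, h']; abel
  | @homogeneous m x =>
    rw [gradeInv_of_mem 𝒜 x.2, gradeInv_of_mem _ (envDiff_mem 𝒜 x.2), map_smul, pow_succ]
    simp

theorem envDiff_one : envDiff 𝒜 1 = 0 := by
  simpa [gradeInv_one] using envDiff_mul 𝒜 1 1

/-- The homomorphism from `A` to the triangular matrices with entries in `Ω_gr(A)`,
`a ↦ [± a, d a; 0, a]`. -/
def matIn : A →ₐ[K] Matrix (Fin 2) (Fin 2) (Env 𝒜) :=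
  AlgHom.ofLinearMap
    { toFun := fun a => !![envIn 𝒜 (gradeInv 𝒜 a), envDiff 𝒜 a; 0, envIn 𝒜 a]
      map_add' := fun a b => by simp
      map_smul' := fun c a => by simp }
    (by simp [gradeInv_one, envDiff_one, Matrix.one_fin_two])
    (fun a b => by simp [gradeInv_mul, envDiff_mul, add_comm])

/-- The linear map from `A` to the triangular matrices with entries in `Ω_gr(A)`,
`a ↦ [± d a, 0; 0, d a]`. -/
def matDiff : A →ₗ[K] Matrix (Fin 2) (Fin 2) (Env 𝒜) where
  toFun a := !![-envDiff 𝒜 (gradeInv 𝒜 a), 0; 0, envDiff 𝒜 a]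
  map_add' a b := by simp [add_comm]
  map_smul' c a := by simp

theorem matDiff_mul (a b : A) :
    matDiff 𝒜 (a * b) = matDiff 𝒜 a * matIn 𝒜 b + matIn 𝒜 (gradeInv 𝒜 a) * matDiff 𝒜 b := by
  simp [matDiff, matIn, gradeInv_mul, envDiff_mul, gradeInv_gradeInv, add_comm]

/-- The homomorphism `x ↦ [± x, d x; 0, x]` from `Ω_gr(A)` to the triangular matrices with entries
in `Ω_gr(A)`, which encodes the extension of `d` as an antiderivation. -/
def matHom : Env 𝒜 →ₐ[K] Matrix (Fin 2) (Fin 2) (Env 𝒜) :=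
  envLift 𝒜 (matIn 𝒜) (matDiff 𝒜) (matDiff_mul 𝒜)

/-- The differential of `Ω_gr(A)`. -/
def envD : Env 𝒜 →ₗ[K] Env 𝒜 := Matrix.entryLinearMap K (Env 𝒜) 0 1 ∘ₗ (matHom 𝒜).toLinearMap

theorem matHom_apply (x : Env 𝒜) :
    matHom 𝒜 x = !![gradeInv (envDeg 𝒜) x, envD 𝒜 x; 0, x] := by
  suffices h : matHom 𝒜 x 0 0 = gradeInv (envDeg 𝒜) x ∧ matHom 𝒜 x 1 0 = 0 ∧
      matHom 𝒜 x 1 1 = x by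
    rw [Matrix.eta_fin_two (matHom 𝒜 x), h.1, h.2.1, h.2.2]
    rfl
  induction x using env_induction 𝒜 with
  | hA a => simp [matHom, envLift_envIn, matIn, gradeInv_envIn]
  | hD a => simp [matHom, envLift_envDiff, matDiff, gradeInv_envDiff]
  | hadd x y hx hy => simp [hx, hy]
  | hmul x y hx hy =>
    simp [Matrix.mul_apply, Fin.sum_univ_two, hx, hy, gradeInv_mul]

theorem envD_envIn (a : A) : envD 𝒜 (envIn 𝒜 a) = envDiff 𝒜 a := by
  simp [envD, matHom, envLift_envIn, matIn]

theorem envD_envInForms (m : envForms 𝒜) :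
    envD 𝒜 (envInForms 𝒜 m) = pairing (envDiff 𝒜) (envDiff 𝒜) (m : A ⊗[K] A) := by
  have h : Matrix.entryLinearMap K (Env 𝒜) 0 1 ∘ₗ pairing (matIn 𝒜).toLinearMap (matDiff 𝒜) =
      pairing (envDiff 𝒜) (envDiff 𝒜) :=
    TensorProduct.ext' fun x y => by simp [matIn, matDiff]
  rw [← h]
  simp [envD, matHom, envLift_envInForms]

theorem envD_envDiff (a : A) : envD 𝒜 (envDiff 𝒜 a) = 0 := by
  simp [envD, matHom, envLift_envDiff, matDiff]

theorem envD_mul' (x y : Env 𝒜) :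
    envD 𝒜 (x * y) = envD 𝒜 x * y + gradeInv (envDeg 𝒜) x * envD 𝒜 y := by
  have h := congrFun (congrFun (map_mul (matHom 𝒜) x y) 0) 1
  rw [matHom_apply, matHom_apply, matHom_apply, Matrix.mul_fin_two] at h
  simpa [add_comm] using h

theorem envD_mul {n : ℕ} {x : Env 𝒜} (y : Env 𝒜) (hx : x ∈ envDeg 𝒜 n) :
    envD 𝒜 (x * y) = envD 𝒜 x * y + (-1 : K) ^ n • (x * envD 𝒜 y) := by
  rw [envD_mul', gradeInv_of_mem _ hx, smul_mul_assoc]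

theorem envD_homog {n : ℕ} {x : Env 𝒜} (hx : EnvHomog 𝒜 n x) : envD 𝒜 x ∈ envDeg 𝒜 (n + 1) := by
  induction hx with
  | ofAlg n a ha => rw [envD_envIn]; exact envDiff_mem 𝒜 ha
  | ofForms n m hm =>
    rw [envD_envInForms]
    generalize (m : A ⊗[K] A) = t at hm
    induction hm using Submodule.span_induction with
    | mem t ht =>
      obtain ⟨r, s, x, y, rfl, hx, hy, rfl⟩ := ht
      rw [show r + s + 1 + 1 = (r + 1) + (s + 1) by omega]
      exact SetLike.GradedMul.mul_mem (envDiff_mem 𝒜 hx) (envDiff_mem 𝒜 hy)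
    | zero => rw [map_zero]; exact Submodule.zero_mem _
    | add s t _ _ hs ht => rw [map_add]; exact Submodule.add_mem _ hs ht
    | smul c t _ ht => rw [map_smul]; exact Submodule.smul_mem _ _ ht
  | mul m n x y hx' hy' hx hy =>
    have hx' : x ∈ envDeg 𝒜 m := Submodule.subset_span hx'
    have hy' : y ∈ envDeg 𝒜 n := Submodule.subset_span hy'
    rw [envD_mul 𝒜 y hx']
    refine Submodule.add_mem _ ?_ (Submodule.smul_mem _ _ ?_)
    · rw [show m + n + 1 = m + 1 + n by omega]
      exact SetLike.GradedMul.mul_mem hx hy'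
    · rw [add_assoc]
      exact SetLike.GradedMul.mul_mem hx' hy

theorem envD_mem {n : ℕ} {x : Env 𝒜} (hx : x ∈ envDeg 𝒜 n) : envD 𝒜 x ∈ envDeg 𝒜 (n + 1) := by
  have : envDeg 𝒜 n ≤ (envDeg 𝒜 (n + 1)).comap (envD 𝒜) :=
    Submodule.span_le.2 fun x hx => envD_homog 𝒜 hx
  exact this hx

theorem gradeInv_envD (x : Env 𝒜) :
    gradeInv (envDeg 𝒜) (envD 𝒜 x) = -envD 𝒜 (gradeInv (envDeg 𝒜) x) := by
  induction x using DirectSum.Decomposition.inductionOn (envDeg 𝒜) with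
  | zero => simp
  | add x x' h h' => simp only [map_add, h, h']; abel
  | @homogeneous m x =>
    rw [gradeInv_of_mem _ x.2, gradeInv_of_mem _ (envD_mem 𝒜 x.2), map_smul, pow_succ]
    simp

theorem envD_envD (x : Env 𝒜) : envD 𝒜 (envD 𝒜 x) = 0 := by
  induction x using env_induction 𝒜 with
  | hA a => rw [envD_envIn, envD_envDiff]
  | hD a => rw [envD_envDiff, map_zero]
  | hadd x y hx hy => rw [map_add, map_add, hx, hy, add_zero]
  | hmul x y hx hy =>
    rw [envD_mul', map_add, envD_mul', envD_mul', hx, hy, gradeInv_envD]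
    simp

/-- The differential envelope `Ω_gr(A)` of the graded algebra `A`. -/
abbrev envelope : GradedDiffAlgebra.{u, max u w} K where
  carrier := Env 𝒜
  deg := envDeg 𝒜
  d := envD 𝒜
  d_mem _ _ hx := envD_mem 𝒜 hx
  d_mul _ _ y hx := envD_mul 𝒜 y hx
  d_d := envD_envD 𝒜

end Envelope

/-! ### The Weil algebra -/

section Weil

variable (K : Type u) [Field K] (H : Type v) [Ring H] [HopfAlgebra K H]

/-- The graded differential algebra `W(H) = Ω_gr(C(H))`. -/
abbrev weilAlgebra : GradedDiffAlgebra.{u, max u v} K := envelope (cochainAlgebra K H).deg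

/-- The canonical injection `α_W : C(H) → W(H)`. -/
def weilConnection : cochainAlgebra K H →ₐ[K] weilAlgebra K H := envIn (cochainAlgebra K H).deg

theorem weilConnection_injective : Function.Injective (weilConnection K H) := envIn_injective _

end Weil

end WeilHopf

end

noncomputable section

namespace WeilHopf

open scoped TensorProduct DirectSum

universe u v w

/-! ### Sums over coproducts -/

section Multilinearity

variable {K : Type*} [Field K] {C : Type*} [AddCommGroup C] [Module K C]
  {M : Type*} [AddCommGroup M] [Module K M]

/-! Uniqueness holds because everything is forced. `W(H)` is generated by the elements `a` and `da`
with `a` in `C(H)`. A connection prescribes `i_h(a)` and `L_h(a)`; the definition of `L_h` and `d² =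
0` then give `i_h(da) = L_h(a) - d(i_h(a)) - ε(h) a` and `L_h(da) = d(L_h(a))`, and the product
rules for `i_h` and `L_h` do the rest (`IsOperation.eq_of_envIn`).

The same formulas give existence, for the envelope of any graded differential algebra `A` carrying
an operation; the differential of `A` enters only through `L_h`. The product rules say exactly that
`x ↦ [± x ε, i(x); 0, L(x)]` is multiplicative, with values in the `2 × 2` matrices over the
convolution algebra of linear maps from `H` to `Ω_gr(A)`. The universal property `envLift` therefore
produces `i` and `L` together (`operationHom`), and the remaining axioms are checked on the
generators and propagated to products (`isOperation_envContraction`).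

It remains that the explicit `i_h` on `C(H)` form an operation (`isOperation_cochainContraction`).
An element of `C(H)` is determined by its component of degree `0` and by the forms obtained by
fixing the first variable (`forms_ext`), and fixing a variable lowers the degree
(`forms_induction`). Every operator involved satisfies a recursion in the first variable, so the
identities are proved by induction on the degree instead of by manipulating alternating sums. The
central one is Cartan's formula `lie_eq`, which identifies `d i_h + i_h d + ε(h)` with the adjoint
action on all variables.

The Hopf algebra input is that the adjoint action is a conjugation in a convolution algebra
(`conv_adR`). It yields `ad(h)(xy) = ∑ ad(h⁽¹⁾)x ad(h⁽²⁾)y`, the exchange identity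
`IsBilin.sw_comul_adR` behind the relation for `i_g L_h`, and `∑ h⁽¹⁾ ad(h⁽²⁾)g = gh`. -/

variable (K) in
/-- Bilinearity of a function of two variables. -/
structure IsBilin (F : C → C → M) : Prop where
  add_left : ∀ a a' b, F (a + a') b = F a b + F a' b
  smul_left : ∀ (c : K) (a b : C), F (c • a) b = c • F a b
  add_right : ∀ a b b', F a (b + b') = F a b + F a b'
  smul_right : ∀ (c : K) (a b : C), F a (c • b) = c • F a b

variable (K) in
/-- Trilinearity of a function of three variables. -/
structure IsTrilin (F : C → C → C → M) : Prop where
  add_fst : ∀ a a' b c, F (a + a') b c = F a b c + F a' b c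
  smul_fst : ∀ (r : K) (a b c : C), F (r • a) b c = r • F a b c
  add_snd : ∀ a b b' c, F a (b + b') c = F a b c + F a b' c
  smul_snd : ∀ (r : K) (a b c : C), F a (r • b) c = r • F a b c
  add_trd : ∀ a b c c', F a b (c + c') = F a b c + F a b c'
  smul_trd : ∀ (r : K) (a b c : C), F a b (r • c) = r • F a b c

theorem isBilin_apply (B : C →ₗ[K] C →ₗ[K] M) : IsBilin K fun a b => B a b := by
  constructor <;> simp

theorem IsBilin.exists_eq {F : C → C → M} (hF : IsBilin K F) :
    ∃ B : C →ₗ[K] C →ₗ[K] M, F = fun a b => B a b :=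
  ⟨LinearMap.mk₂ K F hF.1 hF.2 hF.3 hF.4, rfl⟩

theorem IsTrilin.exists_eq {F : C → C → C → M} (hF : IsTrilin K F) :
    ∃ T : C →ₗ[K] C →ₗ[K] C →ₗ[K] M, F = fun a b c => T a b c :=
  ⟨LinearMap.mk₂ K (fun a b => ⟨⟨F a b, hF.5 a b⟩, fun r c => hF.6 r a b c⟩)
    (fun a a' b => LinearMap.ext fun c => hF.1 a a' b c)
    (fun r a b => LinearMap.ext fun c => hF.2 r a b c)
    (fun a b b' => LinearMap.ext fun c => hF.3 a b b' c)
    (fun r a b => LinearMap.ext fun c => hF.4 r a b c), rfl⟩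

end Multilinearity

/-! ### Sweedler sums over a coalgebra. -/

section Sweedler

open Coalgebra LinearMap

variable {K : Type*} [Field K] {C : Type*} [AddCommGroup C] [Module K C] [Coalgebra K C]
  {M N : Type*} [AddCommGroup M] [AddCommGroup N]

variable (K) in
/-- The sum `∑ F(h⁽¹⁾, h⁽²⁾)`. -/
def sw (h : C) (F : C → C → M) : M :=
  ∑ i ∈ (Coalgebra.Repr.arbitrary K h).index,
    F ((Coalgebra.Repr.arbitrary K h).left i) ((Coalgebra.Repr.arbitrary K h).right i)

theorem sw_congr {F G : C → C → M} (h : C) (hFG : ∀ a b, F a b = G a b) :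
    sw K h F = sw K h G :=
  Finset.sum_congr rfl fun _ _ => hFG _ _

theorem sw_add (h : C) (F G : C → C → M) :
    (sw K h fun a b => F a b + G a b) = sw K h F + sw K h G :=
  Finset.sum_add_distrib

theorem sw_sub (h : C) (F G : C → C → M) :
    (sw K h fun a b => F a b - G a b) = sw K h F - sw K h G :=
  Finset.sum_sub_distrib _ _

theorem sw_neg (h : C) (F : C → C → M) : (sw K h fun a b => -F a b) = -sw K h F :=
  Finset.sum_neg_distrib _

theorem sw_zero (h : C) : (sw K h fun _ _ => (0 : M)) = 0 :=
  Finset.sum_const_zero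

theorem sw_comm {D : Type*} [AddCommGroup D] [Module K D] [Coalgebra K D] (g : C) (h : D)
    (F : C → C → D → D → M) :
    (sw K g fun a b => sw K h fun c d => F a b c d) =
      sw K h fun c d => sw K g fun a b => F a b c d :=
  Finset.sum_comm

variable [Module K M] [Module K N]

/-- `sw` sums over an arbitrarily chosen representation of the coproduct. Termwise rewriting and
exchange of sums hold for any function, whereas additivity in `h` and coassociativity need
independence of that choice, which this formula provides for bilinear functions. Hence the separate
predicates `IsBilin` and `IsTrilin`. -/
theorem lift_comul (B : C →ₗ[K] C →ₗ[K] M) (h : C) :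
    TensorProduct.lift B (comul h) = sw K h fun a b => B a b := by
  rw [← (Coalgebra.Repr.arbitrary K h).eq, map_sum]
  simp [sw]

theorem comul_eq_sw (h : C) : comul h = sw K h fun a b => a ⊗ₜ[K] b :=
  (Coalgebra.Repr.arbitrary K h).eq.symm

theorem map_sw (T : M →ₗ[K] N) (h : C) (F : C → C → M) :
    T (sw K h F) = sw K h fun a b => T (F a b) :=
  map_sum T _ _

theorem smul_sw (r : K) (h : C) (F : C → C → M) :
    r • sw K h F = sw K h fun a b => r • F a b :=
  Finset.smul_sum

theorem sw_apply (h : C) (F : C → C → M →ₗ[K] N) (x : M) :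
    sw K h F x = sw K h fun a b => F a b x :=
  LinearMap.sum_apply _ _ _

theorem sw_mul_const {R : Type*} [Ring R] [Module K R] (h : C) (F : C → C → R) (x : R) :
    sw K h F * x = sw K h fun a b => F a b * x :=
  Finset.sum_mul _ _ _

theorem mul_sw {R : Type*} [Ring R] [Module K R] (h : C) (F : C → C → R) (x : R) :
    x * sw K h F = sw K h fun a b => x * F a b :=
  Finset.mul_sum _ _ _

theorem IsBilin.sw_add {F : C → C → M} (hF : IsBilin K F) (g h : C) :
    sw K (g + h) F = sw K g F + sw K h F := by
  obtain ⟨B, rfl⟩ := hF.exists_eq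
  simp only [← lift_comul, map_add]

theorem IsBilin.sw_smul {F : C → C → M} (hF : IsBilin K F) (r : K) (h : C) :
    sw K (r • h) F = r • sw K h F := by
  obtain ⟨B, rfl⟩ := hF.exists_eq
  simp only [← lift_comul, map_smul]

theorem IsTrilin.sw_assoc {F : C → C → C → M} (hF : IsTrilin K F) (h : C) :
    (sw K h fun a b => sw K a fun c d => F c d b) =
      sw K h fun a b => sw K b fun c d => F a c d := by
  obtain ⟨T, rfl⟩ := hF.exists_eq
  have := congrArg (TensorProduct.lift (TensorProduct.uncurry (.id K) C C M ∘ₗ T))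
    (Coalgebra.sum_tmul_tmul_eq (Coalgebra.Repr.arbitrary K h)
    (fun i => Coalgebra.Repr.arbitrary K _) (fun i => Coalgebra.Repr.arbitrary K _))
  simpa [map_sum, sw] using this

theorem sw_counit_smul (f : C →ₗ[K] M) (h : C) :
    (sw K h fun a b => counit (R := K) a • f b) = f h := by
  conv_rhs => rw [← Coalgebra.sum_counit_smul (Coalgebra.Repr.arbitrary K h)]
  simp [sw, map_sum]

theorem sw_smul_counit (f : C →ₗ[K] M) (h : C) :
    (sw K h fun a b => counit (R := K) b • f a) = f h := by
  have := congrArg (TensorProduct.lift (LinearMap.lsmul K M).flip ∘ₗ TensorProduct.map f .id)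
    (Coalgebra.sum_tmul_counit_eq (Coalgebra.Repr.arbitrary K h))
  simp only [map_sum, LinearMap.comp_apply, TensorProduct.map_tmul, TensorProduct.lift.tmul,
    LinearMap.flip_apply, LinearMap.lsmul_apply, LinearMap.id_apply, one_smul] at this
  exact this

end Sweedler

/-! ### Coproducts of products, and the adjoint action. -/

section SweedlerMul

open Coalgebra LinearMap

variable {K : Type*} [Field K] {H : Type*} [Ring H] {M : Type*} [AddCommGroup M] [Module K M]

theorem IsBilin.sw_mul [Bialgebra K H] {F : H → H → M} (hF : IsBilin K F) (g h : H) :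
    sw K (g * h) F = sw K g fun a b => sw K h fun c d => F (a * c) (b * d) := by
  obtain ⟨B, rfl⟩ := hF.exists_eq
  rw [← lift_comul, Bialgebra.comul_mul, comul_eq_sw g, comul_eq_sw h, sw_mul_const]
  simp only [mul_sw, map_sw, Algebra.TensorProduct.tmul_mul_tmul, TensorProduct.lift.tmul]

theorem IsBilin.sw_one [Bialgebra K H] {F : H → H → M} (hF : IsBilin K F) :
    sw K 1 F = F 1 1 := by
  obtain ⟨B, rfl⟩ := hF.exists_eq
  rw [← lift_comul, Bialgebra.comul_one]
  rfl

variable [HopfAlgebra K H]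

theorem adR_apply (h g : H) :
    adR K H h g = sw K h fun a b => HopfAlgebra.antipode K a * g * b := by
  rw [adR, LinearMap.comp_apply, lift_comul, sw_apply]
  exact sw_congr _ fun a b => (mul_assoc _ _ _).symm

theorem counit_adR (h g : H) :
    counit (R := K) (adR K H h g) = counit (R := K) h * counit (R := K) g := by
  rw [adR_apply, map_sw]
  simp only [Bialgebra.counit_mul, HopfAlgebra.counit_antipode]
  have := sw_counit_smul ((counit (R := K) (A := H)).smulRight (counit (R := K) g)) h
  simpa [mul_comm, mul_assoc, mul_left_comm] using this

theorem adR_one (h : H) : adR K H h 1 = counit (R := K) h • 1 := by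
  rw [adR_apply]
  simp only [mul_one]
  exact HopfAlgebra.sum_antipode_mul_eq_smul _

/-- The antipode reverses products, so `ad` is a right action. Substituting it into forms turns it
back into a left action, whence `L_h L_g = L_{hg}`. -/
theorem adR_mul (h g x : H) : adR K H (h * g) x = adR K H g (adR K H h x) := by
  rw [adR_apply, IsBilin.sw_mul]
  · rw [adR_apply h, map_sw]
    refine sw_congr _ fun a b => ?_
    rw [adR_apply]
    refine sw_congr _ fun c d => ?_
    rw [HopfAlgebra.antipode_mul_antidistrib]
    simp only [mul_assoc]
  · constructor <;> simp [add_mul, mul_add]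

end SweedlerMul

/-! ### The adjoint action in the convolution algebra -/

section Convolution

open Coalgebra LinearMap WithConv HopfAlgebra

variable {K : Type*} [Field K] {H : Type*} [Ring H] {R : Type*} [Ring R] [Algebra K R]

theorem convMul_eq_sw [Bialgebra K H] (f g : WithConv (H →ₗ[K] R)) (h : H) :
    (f * g) h = sw K h fun a b => f a * g b :=
  Coalgebra.Repr.convMul_apply _ f g

variable (K H) in
/-- The element `h ↦ ε(h) x` of the convolution algebra. -/
def convConst [Bialgebra K H] (x : R) : WithConv (H →ₗ[K] R) :=
  toConv ((counit (R := K) (A := H)).smulRight x)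

theorem convConst_apply [Bialgebra K H] (x : R) (h : H) :
    convConst K H x h = counit (R := K) h • x := rfl

theorem convConst_mul_apply [Bialgebra K H] (x : R) (f : WithConv (H →ₗ[K] R)) (h : H) :
    (convConst K H x * f) h = x * f h := by
  rw [convMul_eq_sw]
  simp only [convConst_apply, smul_mul_assoc]
  exact sw_counit_smul (LinearMap.mulLeft K x ∘ₗ f.ofConv) h

theorem mul_convConst_apply [Bialgebra K H] (x : R) (f : WithConv (H →ₗ[K] R)) (h : H) :
    (f * convConst K H x) h = f h * x := by
  rw [convMul_eq_sw]
  simp only [convConst_apply, mul_smul_comm]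
  exact sw_smul_counit (LinearMap.mulRight K x ∘ₗ f.ofConv) h

theorem convConst_mul [Bialgebra K H] (x y : R) :
    convConst K H x * convConst K H y = convConst K H (x * y) := by
  refine WithConv.ext (LinearMap.ext fun h => ?_)
  exact (convConst_mul_apply x _ h).trans (mul_smul_comm _ _ _)

variable [HopfAlgebra K H]

/-- Composition with an algebra homomorphism respects convolution, so it carries the convolution
inverse `S` of the identity to an inverse of `f`. -/
theorem algHom_mul_algHom_antipode (f : H →ₐ[K] R) :
    toConv f.toLinearMap * toConv (f.toLinearMap ∘ₗ antipode K) = 1 := by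
  have := algHom_comp_convMul_distrib f (toConv (LinearMap.id : H →ₗ[K] H)) (toConv (antipode K))
  rw [id_mul_antipode] at this
  refine Eq.trans ?_ ((congrArg toConv this).symm.trans ?_)
  · rfl
  · refine WithConv.ext (LinearMap.ext fun h => ?_)
    exact f.commutes _

theorem algHom_antipode_mul_algHom (f : H →ₐ[K] R) :
    toConv (f.toLinearMap ∘ₗ antipode K) * toConv f.toLinearMap = 1 := by
  have := algHom_comp_convMul_distrib f (toConv (antipode K)) (toConv (LinearMap.id : H →ₗ[K] H))
  rw [antipode_mul_id] at this
  refine Eq.trans ?_ ((congrArg toConv this).symm.trans ?_)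
  · rfl
  · refine WithConv.ext (LinearMap.ext fun h => ?_)
    exact f.commutes _

/-- The adjoint action is the conjugate of the constant `f(g)` by `f` in the convolution algebra.
Sweedler identities for `ad` thereby become cancellations of inverse elements. -/
theorem conv_adR (f : H →ₐ[K] R) (g : H) :
    toConv (f.toLinearMap ∘ₗ antipode K) * convConst K H (f g) * toConv f.toLinearMap =
      toConv (f.toLinearMap ∘ₗ (adR K H).flip g) := by
  refine WithConv.ext (LinearMap.ext fun h => ?_)
  refine (convMul_eq_sw _ _ h).trans ?_
  simp only [mul_convConst_apply]
  refine Eq.trans ?_ (congrArg f (adR_apply h g)).symm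
  refine Eq.trans ?_ (map_sw f.toLinearMap _ _).symm
  exact sw_congr _ fun a b => by simp

/-- Conjugation is multiplicative: between the two conjugates the identity meets its convolution
inverse. -/
theorem sw_adR_mul_adR (h x y : H) :
    (sw K h fun a b => adR K H a x * adR K H b y) = adR K H h (x * y) := by
  have h1 := conv_adR (AlgHom.id K H) x
  have h2 := conv_adR (AlgHom.id K H) y
  have h3 := conv_adR (AlgHom.id K H) (x * y)
  have h4 := algHom_mul_algHom_antipode (AlgHom.id K H)
  have : toConv ((AlgHom.id K H).toLinearMap ∘ₗ (adR K H).flip x) *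
      toConv ((AlgHom.id K H).toLinearMap ∘ₗ (adR K H).flip y) =
      toConv ((AlgHom.id K H).toLinearMap ∘ₗ (adR K H).flip (x * y)) := by
    rw [← h1, ← h2, ← h3, map_mul, ← convConst_mul (K := K)]
    simp only [mul_assoc]
    rw [← mul_assoc (toConv (AlgHom.id K H).toLinearMap), h4, one_mul]
  refine Eq.trans ?_ (congrArg (fun f : WithConv (H →ₗ[K] H) => f h) this)
  exact (convMul_eq_sw (toConv ((AlgHom.id K H).toLinearMap ∘ₗ (adR K H).flip x))
    (toConv ((AlgHom.id K H).toLinearMap ∘ₗ (adR K H).flip y)) h).symm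

-- With `j₁`, `j₂` the two inclusions of `H` in `H ⊗ H`, the coproduct is the convolution product
-- `j₁ * j₂`. Conjugating `Δ(g)` by it and multiplying on the left by `j₂` leaves `j₂ * (j₁ * j₂)⁻¹
-- = j₁⁻¹` in front.
open Algebra.TensorProduct in
theorem conv_includeRight_comul_adR (g : H) :
    toConv (includeRight : H →ₐ[K] H ⊗[K] H).toLinearMap *
        toConv ((comul : H →ₗ[K] H ⊗[K] H) ∘ₗ (adR K H).flip g) =
      toConv ((includeLeft : H →ₐ[K] H ⊗[K] H).toLinearMap ∘ₗ antipode K) *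
        convConst K H (comul (R := K) g) *
        toConv (includeLeft : H →ₐ[K] H ⊗[K] H).toLinearMap *
        toConv (includeRight : H →ₐ[K] H ⊗[K] H).toLinearMap := by
  have hD : toConv (includeLeft : H →ₐ[K] H ⊗[K] H).toLinearMap *
      toConv (includeRight : H →ₐ[K] H ⊗[K] H).toLinearMap =
      toConv (Bialgebra.comulAlgHom K H).toLinearMap := by
    refine WithConv.ext (LinearMap.ext fun h => ?_)
    refine (convMul_eq_sw _ _ h).trans (Eq.trans ?_ (comul_eq_sw h).symm)
    exact sw_congr _ fun a b => by simp
  have h1 := algHom_mul_algHom_antipode (includeLeft : H →ₐ[K] H ⊗[K] H)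
  have h1' := algHom_antipode_mul_algHom (includeLeft : H →ₐ[K] H ⊗[K] H)
  have h2 := algHom_mul_algHom_antipode (includeRight : H →ₐ[K] H ⊗[K] H)
  have h3 := algHom_mul_algHom_antipode (Bialgebra.comulAlgHom K H)
  have h4 := conv_adR (Bialgebra.comulAlgHom K H) g
  set j₁ := toConv (includeLeft : H →ₐ[K] H ⊗[K] H).toLinearMap
  set j₂ := toConv (includeRight : H →ₐ[K] H ⊗[K] H).toLinearMap
  set s₁ := toConv ((includeLeft : H →ₐ[K] H ⊗[K] H).toLinearMap ∘ₗ antipode K)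
  set s := toConv ((Bialgebra.comulAlgHom K H).toLinearMap ∘ₗ antipode K)
  have h5 : j₂ * s = s₁ := by
    rw [← hD] at h3
    calc j₂ * s = s₁ * (j₁ * j₂ * s) := by rw [mul_assoc j₁, ← mul_assoc s₁, h1', one_mul]
      _ = s₁ := by rw [h3, mul_one]
  refine (congrArg (j₂ * ·) h4.symm).trans ?_
  rw [← mul_assoc, ← mul_assoc, h5, ← hD, ← mul_assoc]
  rfl

open Algebra.TensorProduct in
/-- `∑ (ad(h⁽²⁾) g)⁽¹⁾ ⊗ h⁽¹⁾ (ad(h⁽²⁾) g)⁽²⁾ = ∑ ad(h⁽¹⁾) g⁽¹⁾ ⊗ g⁽²⁾ h⁽²⁾`. -/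
theorem IsBilin.sw_comul_adR {M : Type*} [AddCommGroup M] [Module K M] {F : H → H → M}
    (hF : IsBilin K F) (g h : H) :
    (sw K h fun a b => sw K (adR K H b g) fun u v => F u (a * v)) =
      sw K h fun a b => sw K g fun u v => F (adR K H a u) (v * b) := by
  obtain ⟨B, rfl⟩ := hF.exists_eq
  have := congrArg (fun f : WithConv (H →ₗ[K] H ⊗[K] H) => TensorProduct.lift B (f h))
    (conv_includeRight_comul_adR (K := K) g)
  simp only [convMul_eq_sw _ _ h, map_sw] at this
  refine Eq.trans ?_ (this.trans ?_)
  · refine sw_congr _ fun a b => ?_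
    change _ = TensorProduct.lift B ((1 ⊗ₜ a) * comul (adR K H b g))
    rw [comul_eq_sw, mul_sw, map_sw]
    exact sw_congr _ fun u v => by simp
  · refine sw_congr _ fun a b => ?_
    -- Conjugation of `Δ(g)` by the left inclusion applies the adjoint action to the first leg only.
    have h1 : (toConv ((includeLeft : H →ₐ[K] H ⊗[K] H).toLinearMap ∘ₗ antipode K) *
        convConst K H (comul (R := K) g) *
        toConv (includeLeft : H →ₐ[K] H ⊗[K] H).toLinearMap) a =
        sw K g fun u v => (adR K H a u) ⊗ₜ v := by
      rw [convMul_eq_sw]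
      simp only [mul_convConst_apply]
      rw [comul_eq_sw]
      simp only [mul_sw, sw_mul_const]
      rw [sw_comm]
      refine sw_congr _ fun u v => ?_
      refine Eq.trans ?_ ((congrArg ((TensorProduct.mk K H H).flip v) (adR_apply a u)).trans
        (map_sw _ _ _)).symm
      exact sw_congr _ fun c d => by simp
    rw [h1, sw_mul_const, map_sw]
    refine sw_congr _ fun u v => ?_
    change TensorProduct.lift B ((adR K H a u ⊗ₜ v) * (1 ⊗ₜ b)) = _
    simp

/-- Obtained by applying `ε` to the first leg of `IsBilin.sw_comul_adR`. It is what makes Cartan's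
formula work on `C(H)`, and the relation for `i_g L_h` on the elements `da` of the envelope. -/
theorem sw_mul_adR (g h : H) : (sw K h fun a b => a * adR K H b g) = g * h := by
  have h1 := IsBilin.sw_comul_adR (K := K) (F := fun u v : H => counit (R := K) u • v)
    (isBilin_apply (LinearMap.lsmul K H ∘ₗ counit)) g h
  simp only [← mul_smul_comm, ← mul_sw] at h1
  simp only [counit_adR, mul_smul] at h1
  have h2 : ∀ x : H, (sw K x fun u v => counit (R := K) u • v) = x :=
    sw_counit_smul LinearMap.id
  simp only [h2] at h1
  rw [h1]
  refine Eq.trans (sw_congr _ fun a b => ?_) (sw_counit_smul (LinearMap.mulLeft K g) h)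
  simp only [mul_smul_comm, ← smul_sw]
  simp only [← smul_mul_assoc, ← sw_mul_const, h2]
  simp

end Convolution

/-! ### Substitution of the first variable -/

section FirstVariable

variable (K : Type u) [Field K] (H : Type v) [AddCommGroup H] [Module K H]

/-- The component of degree `0` of an element of `C(H)`. -/
def aug : MForms K H →ₗ[K] K :=
  formsLift fun n => match n with
    | 0 => ⟨⟨fun Φ => Φ 0, fun _ _ => rfl⟩, fun _ _ => rfl⟩
    | _ + 1 => 0

/-- Substitution of `x` for the first variable; it vanishes on `C⁰(H)`. -/
def del : H →ₗ[K] Module.End K (MForms K H) :=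
  LinearMap.flip <| formsLift fun n => match n with
    | 0 => 0
    | n + 1 => LinearMap.compRight K (ofForm K H n) ∘ₗ
        (multilinearCurryLeftEquiv K (fun _ : Fin (n + 1) => H) K).toLinearMap

variable {K H}

theorem aug_ofForm_zero (Φ : Form K H 0) : aug K H (ofForm K H 0 Φ) = Φ 0 := by
  simp [aug]

theorem aug_ofForm_succ {n : ℕ} (Φ : Form K H (n + 1)) : aug K H (ofForm K H (n + 1) Φ) = 0 := by
  simp [aug]

theorem aug_ofForm_of_ne {n : ℕ} (h : n ≠ 0) (Φ : Form K H n) : aug K H (ofForm K H n Φ) = 0 := by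
  obtain ⟨n, rfl⟩ := Nat.exists_eq_succ_of_ne_zero h
  exact aug_ofForm_succ Φ

theorem del_ofForm_zero (x : H) (Φ : Form K H 0) : del K H x (ofForm K H 0 Φ) = 0 := by
  simp [del]

theorem del_ofForm_succ {n : ℕ} (x : H) (Φ : Form K H (n + 1)) :
    del K H x (ofForm K H (n + 1) Φ) = ofForm K H n (Φ.curryLeft x) := by
  simp [del]

theorem ev_curryLeft {n : ℕ} (x : H) (Φ : Form K H (n + 1)) (g : ℕ → H) :
    ev (Φ.curryLeft x) g = ev Φ (scons x g) := by
  rw [ev, ev, MultilinearMap.curryLeft_apply]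
  congr 1
  funext i
  cases i using Fin.cases <;> rfl

theorem ofForm_congr {m n : ℕ} (h : m = n) {Φ : Form K H m} {Ψ : Form K H n}
    (hev : ∀ g, ev Φ g = ev Ψ g) : ofForm K H m Φ = ofForm K H n Ψ := by
  subst h
  rw [form_ext hev]

theorem del_ofForm {m n : ℕ} (h : m = n + 1) (x : H) (Φ : Form K H m) (Ψ : Form K H n)
    (hev : ∀ g, ev Φ (scons x g) = ev Ψ g) : del K H x (ofForm K H m Φ) = ofForm K H n Ψ := by
  subst h
  rw [del_ofForm_succ]
  exact ofForm_congr rfl fun g => (ev_curryLeft x Φ g).trans (hev g)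

theorem ofForm_zero_eq (Φ : Form K H 0) : ofForm K H 0 Φ = Φ 0 • (1 : MForms K H) := by
  have h : (1 : MForms K H) = ofForm K H 0 (MultilinearMap.constOfIsEmpty K _ 1) := rfl
  rw [h, ← map_smul]
  congr 1
  ext g
  simp [Subsingleton.elim g 0]

theorem aug_one : aug K H 1 = 1 := aug_ofForm_zero _

theorem del_one (x : H) : del K H x 1 = 0 := del_ofForm_zero _ _

theorem aug_mul (f g : MForms K H) : aug K H (f * g) = aug K H f * aug K H g := by
  suffices h : LinearMap.compr₂ (LinearMap.mul K (MForms K H)) (aug K H) =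
      (LinearMap.mul K K).compl₁₂ (aug K H) (aug K H) from
    LinearMap.congr_fun (LinearMap.congr_fun h f) g
  refine forms_hom_ext fun m Φ => ?_
  cases m with
  | zero =>
    refine LinearMap.ext fun g => ?_
    simp [ofForm_zero_eq, aug_one]
  | succ m =>
    refine forms_hom_ext fun n Ψ => ?_
    simp only [LinearMap.compr₂_apply, LinearMap.mul_apply', LinearMap.compl₁₂_apply, ofForm_mul,
      aug_ofForm_succ, zero_mul]
    exact aug_ofForm_of_ne (by omega) _

/-- The first variable of a tensor product belongs to the left factor unless that factor is a
constant, so `del x` is a derivation relative to the augmentation, with no sign. -/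
theorem del_mul (x : H) (f g : MForms K H) :
    del K H x (f * g) = del K H x f * g + aug K H f • del K H x g := by
  suffices h : LinearMap.compr₂ (LinearMap.mul K (MForms K H)) (del K H x) =
      LinearMap.mul K (MForms K H) ∘ₗ del K H x +
        (LinearMap.lsmul K (MForms K H)).compl₁₂ (aug K H) (del K H x) from
    LinearMap.congr_fun (LinearMap.congr_fun h f) g
  refine forms_hom_ext fun m Φ => ?_
  cases m with
  | zero =>
    refine LinearMap.ext fun g => ?_
    simp [ofForm_zero_eq, aug_one, del_one]
  | succ m =>
    refine forms_hom_ext fun n Ψ => ?_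
    simp only [LinearMap.compr₂_apply, LinearMap.mul_apply', LinearMap.compl₁₂_apply, ofForm_mul,
      LinearMap.add_apply, LinearMap.comp_apply, aug_ofForm_succ, map_zero, LinearMap.zero_apply,
      add_zero, del_ofForm_succ]
    refine del_ofForm (by omega) x _ _ fun g => ?_
    rw [ev_formMul, ev_formMul, ev_curryLeft]
    congr 2
    funext i
    rw [show m + 1 + i = m + i + 1 by omega, scons_succ]

variable (K H) in
/-- The component of degree `n` of an element of `C(H)`. -/
def formComponent (n : ℕ) : MForms K H →ₗ[K] Form K H n := DirectSum.component K ℕ (Form K H) n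

theorem formComponent_ofForm (n : ℕ) (Φ : Form K H n) :
    formComponent K H n (ofForm K H n Φ) = Φ :=
  DirectSum.component.lof_self K n Φ

theorem formComponent_ofForm_of_ne {m n : ℕ} (h : m ≠ n) (Φ : Form K H m) :
    formComponent K H n (ofForm K H m Φ) = 0 :=
  DFinsupp.single_eq_of_ne h.symm

theorem formComponent_del (n : ℕ) (x : H) (f : MForms K H) :
    formComponent K H n (del K H x f) = (formComponent K H (n + 1) f).curryLeft x := by
  suffices h : formComponent K H n ∘ₗ del K H x =
      (LinearMap.applyₗ x ∘ₗ
        (multilinearCurryLeftEquiv K (fun _ : Fin (n + 1) => H) K).toLinearMap) ∘ₗ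
        formComponent K H (n + 1) from LinearMap.congr_fun h f
  refine forms_hom_ext fun m Φ => ?_
  cases m with
  | zero =>
    rw [LinearMap.comp_apply, LinearMap.comp_apply, del_ofForm_zero,
      formComponent_ofForm_of_ne (by omega), map_zero, map_zero]
  | succ m =>
    rw [LinearMap.comp_apply, LinearMap.comp_apply, del_ofForm_succ]
    by_cases h : m = n
    · subst h
      rw [formComponent_ofForm, formComponent_ofForm]
      rfl
    · rw [formComponent_ofForm_of_ne h, formComponent_ofForm_of_ne (by omega), map_zero]

theorem formComponent_zero (f : MForms K H) : formComponent K H 0 f 0 = aug K H f := by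
  suffices h : (⟨⟨fun Φ => Φ 0, fun _ _ => rfl⟩, fun _ _ => rfl⟩ : Form K H 0 →ₗ[K] K) ∘ₗ
      formComponent K H 0 = aug K H from LinearMap.congr_fun h f
  refine forms_hom_ext fun m Φ => ?_
  rw [LinearMap.comp_apply]
  cases m with
  | zero => rw [aug_ofForm_zero, formComponent_ofForm]; rfl
  | succ m => rw [aug_ofForm_succ, formComponent_ofForm_of_ne (by omega), map_zero]

/-- A form of positive degree is determined by its restrictions to fixed values of the first
variable, and a constant by its value. This reduces an identity between operators to their
recursions in the first variable. -/
theorem forms_ext {f g : MForms K H} (h0 : aug K H f = aug K H g)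
    (h1 : ∀ x, del K H x f = del K H x g) : f = g := by
  refine DirectSum.ext_component (M := Form K H) K fun n => ?_
  change formComponent K H n f = formComponent K H n g
  cases n with
  | zero =>
    ext v
    rw [Subsingleton.elim v 0, formComponent_zero, h0, formComponent_zero]
  | succ n =>
    ext v
    have h : ∀ f : MForms K H, formComponent K H (n + 1) f v =
        formComponent K H n (del K H (v 0) f) (Fin.tail v) := fun f => by
      rw [formComponent_del, MultilinearMap.curryLeft_apply, Fin.cons_self_tail]
    rw [h, h, h1]

/-- Induction on the degree. There is no separate base case: `del x` kills the constants, for which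
the premise of `step` is `P 0`. -/
theorem forms_induction {P : MForms K H → Prop} (zero : P 0) (add : ∀ f g, P f → P g → P (f + g))
    (step : ∀ f, (∀ x, P (del K H x f)) → P f) (f : MForms K H) : P f := by
  refine DirectSum.induction_on f zero (fun n Φ => ?_) add
  change P (ofForm K H n Φ)
  induction n with
  | zero => exact step _ fun x => by rwa [del_ofForm_zero]
  | succ n ih => exact step _ fun x => by rw [del_ofForm_succ]; exact ih _

theorem gradeInv_ofForm (n : ℕ) (Φ : Form K H n) :
    gradeInv (formDeg K H) (ofForm K H n Φ) = (-1 : K) ^ n • ofForm K H n Φ :=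
  gradeInv_of_mem _ ⟨Φ, rfl⟩

theorem aug_gradeInv (f : MForms K H) : aug K H (gradeInv (formDeg K H) f) = aug K H f := by
  suffices h : aug K H ∘ₗ gradeInv (formDeg K H) = aug K H from LinearMap.congr_fun h f
  refine forms_hom_ext fun n Φ => ?_
  rw [LinearMap.comp_apply, gradeInv_ofForm, map_smul]
  cases n with
  | zero => simp
  | succ n => simp [aug_ofForm_succ]

theorem del_gradeInv (x : H) (f : MForms K H) :
    del K H x (gradeInv (formDeg K H) f) = -gradeInv (formDeg K H) (del K H x f) := by
  suffices h : del K H x ∘ₗ gradeInv (formDeg K H) = -(gradeInv (formDeg K H) ∘ₗ del K H x) from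
    LinearMap.congr_fun h f
  refine forms_hom_ext fun n Φ => ?_
  rw [LinearMap.comp_apply, LinearMap.neg_apply, LinearMap.comp_apply, gradeInv_ofForm, map_smul]
  cases n with
  | zero => simp [del_ofForm_zero]
  | succ n => rw [del_ofForm_succ, gradeInv_ofForm, pow_succ]; simp

end FirstVariable

/-! ### The Hochschild differential seen from the first variable. -/

section Differential

open Coalgebra

variable {K : Type u} [Field K] {H : Type v} [Ring H] [Bialgebra K H]

theorem formD_ofForm (n : ℕ) (Φ : Form K H n) :
    formD K H (ofForm K H n Φ) = ofForm K H (n + 1) (hochschild n Φ) := by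
  simp [formD]

theorem aug_formD (f : MForms K H) : aug K H (formD K H f) = 0 := by
  suffices h : aug K H ∘ₗ formD K H = 0 from LinearMap.congr_fun h f
  exact forms_hom_ext fun n Φ => by simp [formD_ofForm, aug_ofForm_succ]

/-- The component of degree one of `d f` comes from the constant term `c` of `f`, and is `ε(x) c - c
ε(x) = 0`. -/
theorem aug_del_formD (x : H) (f : MForms K H) : aug K H (del K H x (formD K H f)) = 0 := by
  suffices h : aug K H ∘ₗ del K H x ∘ₗ formD K H = 0 from LinearMap.congr_fun h f
  refine forms_hom_ext fun n Φ => ?_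
  simp only [LinearMap.comp_apply, formD_ofForm, del_ofForm_succ]
  cases n with
  | zero =>
    obtain ⟨c, rfl⟩ : ∃ c, Φ = MultilinearMap.constOfIsEmpty K _ c :=
      ⟨Φ 0, MultilinearMap.ext fun v => by simp [Subsingleton.elim v 0]⟩
    rw [aug_ofForm_zero, MultilinearMap.curryLeft_apply, hochschild_apply]
    simp [mul_comm]
  | succ n => rw [aug_ofForm_succ]; rfl

/-- The product `xy` couples the first two variables, so the recursion closes only after both are
fixed. The terms not involving `x` in a product are those of `-d(f(x, …))`, except for its leading
term `ε(y) f(x, …)`, which the third summand restores. -/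
theorem del_del_formD (x y : H) (f : MForms K H) :
    del K H y (del K H x (formD K H f)) =
      counit (R := K) x • del K H y f - del K H (x * y) f + counit (R := K) y • del K H x f -
        del K H y (formD K H (del K H x f)) := by
  suffices h : del K H y ∘ₗ del K H x ∘ₗ formD K H = counit (R := K) x • del K H y -
      del K H (x * y) + counit (R := K) y • del K H x - del K H y ∘ₗ formD K H ∘ₗ del K H x from
    LinearMap.congr_fun h f
  refine forms_hom_ext fun n Φ => ?_
  simp only [LinearMap.comp_apply, LinearMap.sub_apply, LinearMap.add_apply, LinearMap.smul_apply,
    formD_ofForm, del_ofForm_succ]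
  cases n with
  | zero => simp [del_ofForm_zero]
  | succ n =>
    simp only [formD_ofForm, del_ofForm_succ, ← map_smul (ofForm K H n),
      ← map_sub (ofForm K H n), ← map_add (ofForm K H n)]
    refine ofForm_congr rfl fun g => ?_
    have h : ∀ z, ev (Φ.curryLeft z) g = ev Φ (scons z g) := fun z => ev_curryLeft z Φ g
    rw [ev_curryLeft, ev_curryLeft, ev_hochschild, hochD, barD_succ]
    refine Eq.trans ?_ (show counit (R := K) x * ev (Φ.curryLeft y) g -
      ev (Φ.curryLeft (x * y)) g + counit (R := K) y * ev (Φ.curryLeft x) g -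
      ev ((hochschild n (Φ.curryLeft x)).curryLeft y) g = _ from rfl)
    rw [ev_curryLeft y (hochschild n _), ev_hochschild, hochD, h, h, h]
    simp only [scons_zero, scons_succ]
    rw [show ev (Φ.curryLeft x) = fun g => ev Φ (scons x g) from
      funext fun g => ev_curryLeft x Φ g]
    ring

end Differential

/-! ### Multilinear maps on iterated coproducts -/

section Iterated

open Coalgebra

variable {K : Type u} [Field K] {H : Type v} [Ring H] [HopfAlgebra K H]
  {N : Type*} [AddCommGroup N] [Module K N] {N' : Type*} [AddCommGroup N'] [Module K N']

/-- The value `∑ Θ(h⁽¹⁾, …, h⁽ⁿ⁾)` of a multilinear map on the iterated coproduct of `h`. -/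
def evalIter {n : ℕ} : MultilinearMap K (fun _ : Fin n => H) N →ₗ[K] H →ₗ[K] N :=
  LinearMap.lcomp K N (iterComul K H n) ∘ₗ PiTensorProduct.lift.toLinearMap

theorem evalIter_apply {n : ℕ} (Θ : MultilinearMap K (fun _ : Fin n => H) N) (h : H) :
    evalIter Θ h = PiTensorProduct.lift Θ (iterComul K H n h) := rfl

theorem lift_compMultilinearMap {n : ℕ} (T : N →ₗ[K] N')
    (Θ : MultilinearMap K (fun _ : Fin n => H) N) :
    PiTensorProduct.lift (T.compMultilinearMap Θ) = T ∘ₗ PiTensorProduct.lift Θ :=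
  PiTensorProduct.ext (MultilinearMap.ext fun v => by simp)

theorem evalIter_comp {n : ℕ} (T : N →ₗ[K] N') (Θ : MultilinearMap K (fun _ : Fin n => H) N)
    (h : H) : evalIter (T.compMultilinearMap Θ) h = T (evalIter Θ h) := by
  rw [evalIter_apply, lift_compMultilinearMap]
  rfl

theorem evalIter_congr {m n : ℕ} (hmn : m = n) {Θ : MultilinearMap K (fun _ : Fin m => H) N}
    {Θ' : MultilinearMap K (fun _ : Fin n => H) N} (hΘ : ∀ a, Θ (fun i => a (Fin.cast hmn i)) = Θ' a)
    (h : H) : evalIter Θ h = evalIter Θ' h := by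
  subst hmn
  rw [show Θ = Θ' from MultilinearMap.ext hΘ]

theorem evalIter_zero (Θ : MultilinearMap K (fun _ : Fin 0 => H) N) (h : H) :
    evalIter Θ h = counit (R := K) h • Θ 0 := by
  rw [evalIter_apply, iterComul]
  refine (congrArg _ (TensorPower.algebraMap₀_eq_smul_one _)).trans ?_
  rw [map_smul, TensorPower.gOne_def, PiTensorProduct.lift.tprod, Subsingleton.elim Fin.elim0]

/-- The iterated coproduct is constructed by adding a last leg; this reads the construction on pure
tensors. -/
theorem evalIter_succ_right {n : ℕ} (Θ : MultilinearMap K (fun _ : Fin (n + 1) => H) N) (h : H) :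
    evalIter Θ h = sw K h fun a b => evalIter Θ.curryRight a b := by
  have key : ∀ (t : ⨂[K]^n H) (b : H),
      PiTensorProduct.lift Θ (TensorPower.mulEquiv (t ⊗ₜ
        (PiTensorProduct.subsingletonEquiv (R := K) (s := fun _ : Fin 1 => H) 0).symm b)) =
        PiTensorProduct.lift Θ.curryRight t b := by
    intro t b
    induction t using PiTensorProduct.induction_on with
    | smul_tprod r a =>
      rw [map_smul, LinearMap.smul_apply, PiTensorProduct.lift.tprod, ← TensorProduct.smul_tmul',
        map_smul, map_smul]
      congr 1
      have h1 : (PiTensorProduct.subsingletonEquiv (R := K) (s := fun _ : Fin 1 => H) 0).symm b =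
          PiTensorProduct.tprod K fun _ => b := by
        rw [LinearEquiv.symm_apply_eq]
        simp
      rw [h1, ← TensorPower.gMul_def, TensorPower.tprod_mul_tprod, PiTensorProduct.lift.tprod,
        MultilinearMap.curryRight_apply, Fin.append_right_eq_snoc]
    | add s t hs ht => simp only [TensorProduct.add_tmul, map_add, hs, ht, LinearMap.add_apply]
  rw [evalIter_apply, iterComul, LinearMap.comp_apply, LinearMap.comp_apply, comul_eq_sw,
    map_sw, map_sw, map_sw]
  exact sw_congr _ fun a b => key _ b

/-- Coassociativity allows the first leg to be split off instead of the last. The operators on forms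
need this version, since their recursions consume the first variable. -/
theorem evalIter_succ_left {n : ℕ} (Θ : MultilinearMap K (fun _ : Fin (n + 1) => H) K) (h : H) :
    evalIter Θ h = sw K h fun a b => evalIter (Θ.curryLeft a) b := by
  induction n generalizing h with
  | zero =>
    rw [evalIter_succ_right]
    simp only [evalIter_zero]
    refine Eq.trans (sw_counit_smul (Θ.curryRight 0) h) (Eq.trans ?_ (sw_smul_counit
      (⟨⟨fun a => Θ.curryLeft a 0, by simp⟩, by simp⟩ : H →ₗ[K] K) h).symm)
    refine congrArg Θ (funext fun i => ?_)
    fin_cases i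
    rfl
  | succ n ih =>
    -- The inductive hypothesis is about scalar-valued forms, so the last variable is first
    -- evaluated at `b`.
    have h1 : ∀ a b, evalIter Θ.curryRight a b =
        sw K a fun c d => evalIter (Θ.curryRight.curryLeft c) d b := fun a b => by
      refine (evalIter_comp (LinearMap.applyₗ b) Θ.curryRight a).symm.trans ((ih _ a).trans ?_)
      exact sw_congr _ fun c d => evalIter_comp (LinearMap.applyₗ b) (Θ.curryRight.curryLeft c) d
    rw [evalIter_succ_right]
    simp only [h1]
    rw [IsTrilin.sw_assoc]
    · refine sw_congr _ fun a b => ?_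
      rw [evalIter_succ_right]
      refine sw_congr _ fun c d => ?_
      exact congrArg (fun T : MultilinearMap K (fun _ : Fin n => H) (H →ₗ[K] K) =>
        evalIter T c d) (MultilinearMap.ext fun v => LinearMap.ext fun x =>
        congrArg Θ (Fin.cons_snoc_eq_snoc_cons _ _ _).symm)
    · constructor <;> simp

end Iterated

/-! ### The operators `L_h` and `i_h` on `C(H)` -/

section Lie

open Coalgebra

variable (K : Type u) [Field K] {H : Type v} [Ring H] [HopfAlgebra K H]

/-- The tuple `(ad(a₁) g₁, …, ad(aₙ) gₙ)`. -/
def adArg {n : ℕ} (g a : Fin n → H) (j : Fin n) : H := adR K H (a j) (g j)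

theorem adArg_update_right {n : ℕ} (g a : Fin n → H) (i : Fin n) :
    ∃ (s : Fin n) (φ : H →ₗ[K] H), ∀ x,
      adArg K g (Function.update a i x) = Function.update (adArg K g a) s (φ x) := by
  refine ⟨i, (adR K H).flip (g i), fun x => funext fun j => ?_⟩
  by_cases h : j = i
  · subst h; simp [adArg]
  · simp [adArg, h]

theorem adArg_update_left {n : ℕ} (a g : Fin n → H) (i : Fin n) :
    ∃ (s : Fin n) (φ : H →ₗ[K] H), ∀ x,
      adArg K (Function.update g i x) a = Function.update (adArg K g a) s (φ x) := by
  refine ⟨i, adR K H (a i), fun x => funext fun j => ?_⟩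
  by_cases h : j = i
  · subst h; simp [adArg]
  · simp [adArg, h]

/-- The value of `Ψ` on `ad(a₁) g₁, …, ad(aₙ) gₙ`, as a multilinear function of `a₁, …, aₙ`. -/
def lieTerm {n : ℕ} (Ψ : Form K H n) (g : Fin n → H) : Form K H n :=
  substitute Ψ (adArg K g) (adArg_update_right K g)

variable (H)

/-- The action `L_h(Ψ)(g₁, …, gₙ) = ∑ Ψ(ad(h⁽¹⁾) g₁, …, ad(h⁽ⁿ⁾) gₙ)` on `Cⁿ(H)`. -/
def lieForm (n : ℕ) : H →ₗ[K] Form K H n →ₗ[K] Form K H n :=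
  LinearMap.mk₂ K
    (fun h Ψ => MultilinearMap.mk' (fun g => evalIter (lieTerm K Ψ g) h)
      (fun g i x y => by
        rw [← LinearMap.add_apply, ← map_add]
        congr 2
        ext a
        obtain ⟨s, φ, h⟩ := adArg_update_left K a g i
        simp [lieTerm, h])
      (fun g i c x => by
        rw [← LinearMap.smul_apply, ← map_smul]
        congr 2
        ext a
        obtain ⟨s, φ, h⟩ := adArg_update_left K a g i
        simp [lieTerm, h]))
    (fun h h' Ψ => by ext g; simp)
    (fun c h Ψ => by ext g; simp)
    (fun h Ψ Ψ' => by
      ext g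
      simp only [MultilinearMap.mk'_apply, add_apply, ← LinearMap.add_apply, ← map_add]
      rfl)
    (fun c h Ψ => by
      ext g
      exact congrArg (fun T : H →ₗ[K] K => T h) (map_smul evalIter c (lieTerm K Ψ g)))

variable {H}

theorem lieForm_apply {n : ℕ} (h : H) (Ψ : Form K H n) (g : Fin n → H) :
    lieForm K H n h Ψ g = evalIter (lieTerm K Ψ g) h := rfl

theorem sw_form_apply {n : ℕ} (h : H) (F : H → H → Form K H n) (g : Fin n → H) :
    sw K h F g = sw K h fun a b => F a b g :=
  sum_apply _ _ _

theorem curryLeft_lieForm {n : ℕ} (h x : H) (Ψ : Form K H (n + 1)) :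
    (lieForm K H (n + 1) h Ψ).curryLeft x =
      sw K h fun a b => lieForm K H n b (Ψ.curryLeft (adR K H a x)) := by
  ext g
  rw [MultilinearMap.curryLeft_apply, lieForm_apply, evalIter_succ_left, sw_form_apply]
  refine sw_congr _ fun a b => ?_
  rw [lieForm_apply]
  refine congrArg (fun T => evalIter T b) (MultilinearMap.ext fun v => congrArg Ψ ?_)
  funext j
  cases j using Fin.cases <;> rfl

variable (H) in
/-- The linear map `h ↦ h - ε(h) 1`. -/
def reduced : H →ₗ[K] H := LinearMap.id - (counit (R := K)).smulRight (1 : H)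

theorem reduced_apply (h : H) : reduced K H h = h - counit (R := K) h • (1 : H) := rfl

/-- The contribution to `i_h(Ψ)` of the substitution of `h` for the first variable. -/
def leadForm {n : ℕ} (h : H) (Ψ : Form K H (n + 1)) : Form K H n :=
  sw K h fun a b => lieForm K H n b (Ψ.curryLeft (reduced K H a))

/-- For `p = 0` the first argument is `h⁽¹⁾ - ε(h⁽¹⁾) 1` and the remaining legs act on all of `g₁,
…, g_m` by the adjoint action. -/
theorem lift_contractionTerm_zero {m : ℕ} (h : H) (Ψ : Form K H (m + 1)) (g : Fin m → H) :
    PiTensorProduct.lift (contractionTerm K 0 Ψ g)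
      (iterComul K H (m + 1 - ((0 : Fin (m + 1)) : ℕ)) h) = leadForm K h Ψ g := by
  have hm : m + 1 - ((0 : Fin (m + 1)) : ℕ) = m + 1 := rfl
  rw [← evalIter_apply, evalIter_congr hm
    (Θ := contractionTerm K 0 Ψ g) (Θ' := (contractionTerm K 0 Ψ g).domDomCongr (finCongr hm)) (fun a => rfl),
    evalIter_succ_left, leadForm, sw_form_apply]
  refine sw_congr _ fun a b => ?_
  rw [lieForm_apply]
  refine congrArg (fun T => evalIter T b) (MultilinearMap.ext fun v => congrArg Ψ ?_)
  funext j
  cases j using Fin.cases <;> rfl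

/-- For positive `p` the first argument is `g₁`, untouched by `h`. Fixing it lowers the degree and
`p` together, so the number of legs of `h` does not change. -/
theorem lift_contractionTerm_succ {m : ℕ} (p : Fin (m + 1)) (h : H) (Ψ : Form K H (m + 2))
    (g : Fin (m + 1) → H) :
    PiTensorProduct.lift (contractionTerm K p.succ Ψ g) (iterComul K H (m + 2 - p.succ) h) =
      PiTensorProduct.lift (contractionTerm K p (Ψ.curryLeft (g 0)) (Fin.tail g))
        (iterComul K H (m + 1 - p) h) := by
  have hm : m + 2 - (p.succ : ℕ) = m + 1 - p := by simp
  rw [← evalIter_apply, ← evalIter_apply]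
  refine evalIter_congr hm (fun a => congrArg Ψ ?_) h
  funext j
  obtain ⟨p, hp⟩ := p
  cases j using Fin.cases with
  | zero => simp [contractionArg]
  | succ j =>
    obtain ⟨j, hj⟩ := j
    change _ = contractionArg K ⟨p, hp⟩ (Fin.tail g) a ⟨j, hj⟩
    simp only [contractionArg, Fin.succ_mk]
    split_ifs <;> first | rfl | omega | skip
    exact congrArg₂ (fun u v => adR K H u v)
      (congrArg a (Fin.ext (show j + 1 - (p + 1) = j - p by omega)))
      (congrArg g (Fin.ext (show j + 1 - 1 = j - 1 + 1 by omega)))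

theorem contraction_zero (h : H) (Ψ : Form K H 1) : contraction K 0 h Ψ = leadForm K h Ψ := by
  ext g
  rw [contraction_apply, Fin.sum_univ_one, lift_contractionTerm_zero]
  simp

/-- Shifting `p` by one changes the sign `(-1)^p`; hence the contraction of `Ψ(x, …)` appears with a
minus sign. -/
theorem curryLeft_contraction {m : ℕ} (h x : H) (Ψ : Form K H (m + 2)) :
    (contraction K (m + 1) h Ψ).curryLeft x =
      (leadForm K h Ψ).curryLeft x - contraction K m h (Ψ.curryLeft x) := by
  ext g
  rw [MultilinearMap.curryLeft_apply, contraction_apply, Fin.sum_univ_succ,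
    lift_contractionTerm_zero, sub_apply, contraction_apply,
    MultilinearMap.curryLeft_apply, sub_eq_add_neg, ← Finset.sum_neg_distrib]
  refine congrArg₂ (· + ·) (by simp) (Finset.sum_congr rfl fun p _ => ?_)
  rw [lift_contractionTerm_succ, Fin.val_succ, pow_succ]
  simp

variable (H)

/-- The action `L_h` on `C(H)`. -/
def lie : H →ₗ[K] Module.End K (MForms K H) :=
  LinearMap.flip <| formsLift fun n =>
    LinearMap.compRight K (ofForm K H n) ∘ₗ (lieForm K H n).flip

/-- The contribution to `i_h` of the substitution of `h` for the first variable. -/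
def lead : H →ₗ[K] Module.End K (MForms K H) :=
  TensorProduct.lift ((LinearMap.mul K (Module.End K (MForms K H))).flip.compl₁₂
    (del K H ∘ₗ reduced K H) (lie K H)) ∘ₗ comul

variable {H}

theorem lie_ofForm (h : H) (n : ℕ) (Φ : Form K H n) :
    lie K H h (ofForm K H n Φ) = ofForm K H n (lieForm K H n h Φ) := by
  simp [lie]

theorem lead_apply (h : H) (f : MForms K H) :
    lead K H h f = sw K h fun a b => lie K H b (del K H (reduced K H a) f) := by
  rw [lead, LinearMap.comp_apply, lift_comul, sw_apply]
  rfl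

theorem aug_lie (h : H) (f : MForms K H) :
    aug K H (lie K H h f) = counit (R := K) h * aug K H f := by
  suffices hs : aug K H ∘ₗ lie K H h = counit (R := K) h • aug K H from LinearMap.congr_fun hs f
  refine forms_hom_ext fun n Φ => ?_
  rw [LinearMap.comp_apply, LinearMap.smul_apply, lie_ofForm]
  cases n with
  | zero =>
    rw [aug_ofForm_zero, aug_ofForm_zero, lieForm_apply, evalIter_zero]
    exact congrArg (fun v => counit (R := K) h • Φ v) (Subsingleton.elim _ _)
  | succ n => rw [aug_ofForm_succ, aug_ofForm_succ, smul_zero]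

theorem del_lie (h x : H) (f : MForms K H) :
    del K H x (lie K H h f) = sw K h fun a b => lie K H b (del K H (adR K H a x) f) := by
  suffices hs : del K H x ∘ₗ lie K H h =
      sw K h fun a b => lie K H b ∘ₗ del K H (adR K H a x) by
    have := LinearMap.congr_fun hs f
    rwa [sw_apply] at this
  refine forms_hom_ext fun n Φ => ?_
  rw [sw_apply]
  simp only [LinearMap.comp_apply, lie_ofForm]
  cases n with
  | zero => simp [del_ofForm_zero, sw_zero]
  | succ n =>
    simp only [del_ofForm_succ, lie_ofForm]
    rw [curryLeft_lieForm, map_sw]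

theorem lead_ofForm_succ (h : H) {n : ℕ} (Φ : Form K H (n + 1)) :
    lead K H h (ofForm K H (n + 1) Φ) = ofForm K H n (leadForm K h Φ) := by
  rw [lead_apply, leadForm, map_sw]
  exact sw_congr _ fun a b => by rw [del_ofForm_succ, lie_ofForm]

theorem lead_ofForm_zero (h : H) (Φ : Form K H 0) : lead K H h (ofForm K H 0 Φ) = 0 := by
  rw [lead_apply]
  simp [del_ofForm_zero, sw_zero]

theorem cochainContraction_ofForm_zero (h : H) (Φ : Form K H 0) :
    cochainContraction K H h (ofForm K H 0 Φ) = 0 := by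
  simp [cochainContraction]

theorem cochainContraction_ofForm_succ (h : H) {n : ℕ} (Φ : Form K H (n + 1)) :
    cochainContraction K H h (ofForm K H (n + 1) Φ) = ofForm K H n (contraction K n h Φ) := by
  simp [cochainContraction]

theorem aug_cochainContraction (h : H) (f : MForms K H) :
    aug K H (cochainContraction K H h f) = aug K H (lead K H h f) := by
  suffices hs : aug K H ∘ₗ cochainContraction K H h = aug K H ∘ₗ lead K H h from
    LinearMap.congr_fun hs f
  refine forms_hom_ext fun n Φ => ?_
  simp only [LinearMap.comp_apply]
  match n, Φ with
  | 0, Φ => rw [cochainContraction_ofForm_zero, lead_ofForm_zero]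
  | 1, Φ => rw [cochainContraction_ofForm_succ, lead_ofForm_succ, contraction_zero]
  | n + 2, Φ =>
    rw [cochainContraction_ofForm_succ, lead_ofForm_succ, aug_ofForm_succ, aug_ofForm_succ]

/-- Together with `aug_cochainContraction` this replaces the alternating sum over `p` in the
inductions below: only the summand `p = 0`, collected in `lead`, has to be treated by hand. -/
theorem del_cochainContraction (h x : H) (f : MForms K H) :
    del K H x (cochainContraction K H h f) =
      del K H x (lead K H h f) - cochainContraction K H h (del K H x f) := by
  suffices hs : del K H x ∘ₗ cochainContraction K H h =
      del K H x ∘ₗ lead K H h - cochainContraction K H h ∘ₗ del K H x from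
    LinearMap.congr_fun hs f
  refine forms_hom_ext fun n Φ => ?_
  simp only [LinearMap.comp_apply, LinearMap.sub_apply]
  match n, Φ with
  | 0, Φ => simp [cochainContraction_ofForm_zero, lead_ofForm_zero, del_ofForm_zero]
  | 1, Φ =>
    rw [cochainContraction_ofForm_succ, lead_ofForm_succ, del_ofForm_zero, del_ofForm_zero,
      del_ofForm_succ, cochainContraction_ofForm_zero, sub_zero]
  | n + 2, Φ =>
    rw [cochainContraction_ofForm_succ, lead_ofForm_succ, del_ofForm_succ, del_ofForm_succ,
      del_ofForm_succ, cochainContraction_ofForm_succ, curryLeft_contraction, map_sub]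

end Lie

/-! ### The operation of `H` in `C(H)` -/

section CochainOperation

open Coalgebra

variable {K : Type u} [Field K] {H : Type v} [Ring H] [HopfAlgebra K H]

theorem counit_reduced (h : H) : counit (R := K) (reduced K H h) = 0 := by
  simp [reduced_apply]

theorem reduced_one : reduced K H (1 : H) = 0 := by
  simp [reduced_apply]

theorem adR_reduced (h g : H) : adR K H h (reduced K H g) = reduced K H (adR K H h g) := by
  simp [reduced_apply, adR_one, counit_adR, smul_smul, mul_comm]

theorem sw_counit_mul_counit (h : H) (c : K) :
    (sw K h fun a b => counit (R := K) a * (counit (R := K) b * c)) = counit (R := K) h * c :=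
  sw_counit_smul ((counit (R := K) (A := H)).smulRight c) h

theorem sw_counit_mul (f : H →ₗ[K] K) (h : H) :
    (sw K h fun a b => counit (R := K) b * f a) = f h :=
  sw_smul_counit f h

theorem lie_one_form (h : H) : lie K H h (1 : MForms K H) = counit (R := K) h • 1 := by
  refine forms_ext ?_ fun x => ?_
  · rw [aug_lie, map_smul, smul_eq_mul]
  · rw [del_lie, map_smul, del_one]
    simp [del_one, sw_zero]

/-- After fixing the first variable, coassociativity regroups the legs when that variable lies in
`f`. When `f` contributes only its constant term, the factor `ε(h⁽¹⁾)` is absorbed by the counit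
axiom. -/
theorem lie_mul (h : H) (f g : MForms K H) :
    lie K H h (f * g) = sw K h fun a b => lie K H a f * lie K H b g := by
  induction f using forms_induction generalizing h with
  | zero => simp [sw_zero]
  | add f f' hf hf' => simp only [add_mul, map_add, hf, hf', sw_add]
  | step f ih =>
    refine forms_ext ?_ fun x => ?_
    · rw [map_sw]
      simp only [aug_lie, aug_mul]
      refine ((sw_congr _ fun a b => ?_).trans (sw_counit_mul_counit h _)).symm
      ring
    · rw [map_sw, del_lie]
      simp only [del_mul, map_add, map_smul, sw_add, ← smul_sw, ih, aug_lie]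
      congr 1
      · simp only [del_lie, sw_mul_const]
        refine (IsTrilin.sw_assoc
          (F := fun a c d => lie K H c (del K H (adR K H a x) f) * lie K H d g) ?_ h).symm
        constructor <;> simp [add_mul, mul_add]
      · rw [← del_lie]
        refine (Eq.trans (sw_congr _ fun a b => ?_) (sw_counit_smul
          ((aug K H f) • (del K H x ∘ₗ (lie K H).flip g)) h)).symm
        rw [mul_smul]
        rfl

theorem lie_lie (h g : H) (f : MForms K H) :
    lie K H h (lie K H g f) = lie K H (h * g) f := by
  induction f using forms_induction generalizing h g with
  | zero => simp
  | add f f' hf hf' => simp only [map_add, hf, hf']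
  | step f ih =>
    refine forms_ext ?_ fun x => ?_
    · simp only [aug_lie, Bialgebra.counit_mul, mul_assoc]
    · rw [del_lie, del_lie, IsBilin.sw_mul]
      · refine sw_congr _ fun a b => ?_
        rw [del_lie, map_sw]
        exact sw_congr _ fun c d => by rw [ih, adR_mul]
      · constructor <;> simp

/-- The operator `f ↦ f(x ·, …) - f(x, …) ε` on `C(H)`, in terms of the differential. -/
def barOp (x : H) (f : MForms K H) : MForms K H :=
  counit (R := K) x • (f - aug K H f • 1) - formD K H (del K H x f) - del K H x (formD K H f)

/-- `barOp` is defined so as to make this recursion tautological; its content is in `aug_barOp` and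
`del_barOp`, which describe it without the differential. -/
theorem del_formD (x : H) (f : MForms K H) :
    del K H x (formD K H f) =
      counit (R := K) x • (f - aug K H f • 1) - barOp x f - formD K H (del K H x f) := by
  rw [barOp]; abel

theorem aug_barOp (x : H) (f : MForms K H) : aug K H (barOp x f) = 0 := by
  simp [barOp, aug_formD, aug_del_formD, aug_one]

theorem del_barOp (x y : H) (f : MForms K H) :
    del K H y (barOp x f) = del K H (x * y) f - counit (R := K) y • del K H x f := by
  simp only [barOp, map_sub, map_smul, del_one, del_del_formD, smul_zero, sub_zero]
  abel

/-- Equivariance of `barOp`: it involves only the product `xy` and the counit, and the adjoint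
action respects both, by `sw_adR_mul_adR` and `counit_adR`. -/
theorem sw_lie_barOp (h x : H) (f : MForms K H) :
    (sw K h fun a b => lie K H b (barOp (adR K H a x) f)) = barOp x (lie K H h f) := by
  refine forms_ext ?_ fun y => ?_
  · rw [map_sw, aug_barOp]
    simp [aug_lie, aug_barOp, sw_zero]
  · rw [map_sw, del_barOp, del_lie, del_lie, smul_sw, ← sw_sub]
    have h1 : ∀ a b, del K H y (lie K H b (barOp (adR K H a x) f)) =
        (sw K b fun c d => lie K H d (del K H (adR K H a x * adR K H c y) f)) -
          counit (R := K) y • lie K H b (del K H (adR K H a x) f) := fun a b => by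
      rw [del_lie]
      simp only [del_barOp, map_sub, sw_sub, counit_adR, map_smul]
      congr 1
      refine Eq.trans (sw_congr _ fun c d => ?_) (sw_counit_smul
        (counit (R := K) y • (lie K H).flip (del K H (adR K H a x) f)) b)
      rw [mul_smul]
      rfl
    simp only [h1, sw_sub]
    congr 1
    refine (IsTrilin.sw_assoc (F := fun a c d =>
      lie K H d (del K H (adR K H a x * adR K H c y) f)) ?_ h).symm.trans ?_
    · constructor <;> simp [add_mul, mul_add]
    · refine sw_congr _ fun a b => ?_
      rw [← sw_adR_mul_adR]
      exact (map_sw (lie K H b ∘ₗ (del K H).flip f) a _).symm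

/-- Proved directly for the adjoint action on forms, from the equivariance of `barOp`. It cannot be
deduced from Cartan's formula at this stage, since the proof of that formula uses it through
`lead_formD`. -/
theorem lie_formD (h : H) (f : MForms K H) :
    lie K H h (formD K H f) = formD K H (lie K H h f) := by
  induction f using forms_induction generalizing h with
  | zero => simp
  | add f f' hf hf' => simp only [map_add, hf, hf']
  | step f ih =>
    refine forms_ext ?_ fun x => ?_
    · rw [aug_lie, aug_formD, aug_formD, mul_zero]
    · rw [del_lie, del_formD, del_lie, map_sw]
      simp only [del_formD, map_sub, sw_sub, sw_lie_barOp, ih]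
      congr 2
      rw [aug_lie]
      refine Eq.trans (sw_congr _ fun a b => ?_) ((sw_counit_smul
        (counit (R := K) x • (lie K H).flip (f - aug K H f • 1)) h).trans ?_)
      · rw [counit_adR, map_smul, mul_smul]
        simp
      · simp [lie_one_form, smul_smul, mul_comm]

theorem aug_lead (h : H) (f : MForms K H) :
    aug K H (lead K H h f) = aug K H (del K H (reduced K H h) f) := by
  rw [lead_apply, map_sw]
  simp only [aug_lie]
  exact sw_counit_mul (aug K H ∘ₗ (del K H).flip f ∘ₗ reduced K H) h

theorem lead_mul (h : H) (f g : MForms K H) :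
    lead K H h (f * g) = (sw K h fun a b => lead K H a f * lie K H b g) +
      aug K H f • lead K H h g := by
  simp only [lead_apply, del_mul, map_add, map_smul, sw_add, ← smul_sw, lie_mul, sw_mul_const]
  congr 1
  refine (IsTrilin.sw_assoc
    (F := fun a c d => lie K H c (del K H (reduced K H a) f) * lie K H d g) ?_ h).symm
  constructor <;> simp [add_mul, mul_add]

/-- The `lead` part obeys `lead_mul`. The recursion for the rest is consistent because the minus
sign in `del_cochainContraction` matches the anticommutation of `del x` with the sign involution. -/
theorem cochainContraction_mul (h : H) (f g : MForms K H) :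
    cochainContraction K H h (f * g) =
      (sw K h fun a b => cochainContraction K H a f * lie K H b g) +
        gradeInv (formDeg K H) f * cochainContraction K H h g := by
  induction f using forms_induction generalizing h with
  | zero => simp [sw_zero]
  | add f f' hf hf' => simp only [add_mul, map_add, hf, hf', sw_add]; abel
  | step f ih =>
    refine forms_ext ?_ fun x => ?_
    · simp only [aug_cochainContraction, lead_mul, map_add, map_sw, aug_mul, aug_gradeInv, map_smul,
        smul_eq_mul]
    · simp only [del_cochainContraction, lead_mul, map_add, map_sw, del_mul, aug_gradeInv,
        map_smul, ih, del_gradeInv, aug_cochainContraction, sub_mul, sw_add, sw_sub, neg_mul,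
        smul_sub]
      abel

/-- The sum on the left is, up to sign, the anticommutator of `d` and `lead h` (see `lead_formD`).
Its expansion is where the term `L_h` of Cartan's formula first appears. -/
theorem sw_lie_barOp_reduced (h : H) (f : MForms K H) (x : H) :
    del K H x (sw K h fun a b => lie K H b (barOp (reduced K H a) f)) =
      (sw K h fun a b => lie K H b (del K H (x * a) f)) - del K H x (lie K H h f) -
        counit (R := K) x • lead K H h f := by
  rw [map_sw]
  have h1 : ∀ a b, del K H x (lie K H b (barOp (reduced K H a) f)) =
      (sw K b fun c d => lie K H d (del K H (reduced K H a * adR K H c x) f)) -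
        counit (R := K) x • lie K H b (del K H (reduced K H a) f) := fun a b => by
    rw [del_lie]
    simp only [del_barOp, map_sub, sw_sub, counit_adR, map_smul]
    congr 1
    refine Eq.trans (sw_congr _ fun c d => ?_) (sw_counit_smul
      (counit (R := K) x • (lie K H).flip (del K H (reduced K H a) f)) b)
    rw [mul_smul]
    rfl
  simp only [h1, sw_sub, ← smul_sw, ← lead_apply]
  congr 1
  refine (IsTrilin.sw_assoc (F := fun a c d =>
    lie K H d (del K H (reduced K H a * adR K H c x) f)) ?_ h).symm.trans ?_
  · constructor <;> simp [add_mul, mul_add]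
  · rw [del_lie, ← sw_sub]
    refine sw_congr _ fun a b => ?_
    refine (map_sw (lie K H b ∘ₗ (del K H).flip f) a _).symm.trans ?_
    -- The first term is `∑ a⁽¹⁾ ad(a⁽²⁾)x = xa`; the counit part of `reduced` contributes `ad(a)x`.
    have h2 : (sw K a fun c d => reduced K H c * adR K H d x) = x * a - adR K H a x := by
      simp only [reduced_apply, sub_mul, sw_sub, sw_mul_adR, smul_mul_assoc, one_mul]
      congr 1
      exact sw_counit_smul ((adR K H).flip x) a
    rw [h2]
    simp

theorem lead_barOp (h x : H) (f : MForms K H) :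
    lead K H h (barOp x f) =
      (sw K h fun a b => lie K H b (del K H (x * a) f)) - lie K H h (del K H x f) := by
  rw [lead_apply]
  simp only [del_barOp, counit_reduced, zero_smul, sub_zero]
  simp only [reduced_apply, mul_sub, map_sub, LinearMap.sub_apply, sw_sub, mul_smul_comm, mul_one, map_smul, LinearMap.smul_apply]
  congr 1
  exact sw_counit_smul ((lie K H).flip (del K H x f)) h

theorem lead_formD (h : H) (f : MForms K H) :
    lead K H h (formD K H f) = -(sw K h fun a b => lie K H b (barOp (reduced K H a) f)) -
      formD K H (lead K H h f) := by
  simp only [lead_apply, del_formD, counit_reduced, zero_smul, zero_sub, map_sub, map_neg, sw_sub,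
    sw_neg, map_sw, lie_formD]

/-- `barOp x` acts on the first variable alone, and the summands with `p > 0` leave that variable
free. So `i_h` and `barOp x` commute up to the summand `p = 0`, that is, up to `lead`. -/
theorem cochainContraction_barOp (h x : H) (f : MForms K H) :
    cochainContraction K H h (barOp x f) =
      barOp x (cochainContraction K H h f) - barOp x (lead K H h f) + lead K H h (barOp x f) := by
  refine forms_ext ?_ fun y => ?_
  · simp [aug_cochainContraction, aug_barOp]
  · simp only [del_cochainContraction, map_sub, map_add, del_barOp, map_smul, smul_sub]
    abel

theorem cochainContraction_one_form (h : H) : cochainContraction K H h (1 : MForms K H) = 0 := by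
  have : (1 : MForms K H) = ofForm K H 0 (MultilinearMap.constOfIsEmpty K _ 1) := rfl
  rw [this, cochainContraction_ofForm_zero]

/-- Cartan's formula on `C(H)`. -/
theorem lie_eq (h : H) (f : MForms K H) :
    lie K H h f = formD K H (cochainContraction K H h f) +
      cochainContraction K H h (formD K H f) + counit (R := K) h • f := by
  induction f using forms_induction with
  | zero => simp
  | add f f' hf hf' => simp only [map_add, hf, hf', smul_add]; abel
  | step f ih =>
    refine forms_ext ?_ fun x => ?_
    · simp [aug_lie, aug_formD, aug_cochainContraction, aug_lead, aug_del_formD]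
    -- In the expansion the sum `∑ L_{h⁽²⁾} f(x h⁽¹⁾, …)` comes with a minus sign from `h1` and a
    -- plus sign from `h2` through `h3`. The term `-L_h(f(x, …))` of `h2` cancels against the
    -- inductive hypothesis for `del K H x f`, and the differentials of `lead` cancel in pairs. What
    -- is left is the value of `L_h f` at `x`, supplied by `h1`.
    · have h1 := sw_lie_barOp_reduced h f x
      have h2 := lead_barOp h x f
      have h3 := cochainContraction_barOp h x f
      have h4 := ih x
      have h5 : del K H x (formD K H (cochainContraction K H h f)) =
          counit (R := K) x • (cochainContraction K H h f - aug K H (lead K H h f) • 1) -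
            barOp x (cochainContraction K H h f) - formD K H (del K H x (lead K H h f)) +
            formD K H (cochainContraction K H h (del K H x f)) := by
        rw [del_formD, aug_cochainContraction, del_cochainContraction, map_sub]; abel
      have h6 := del_formD x (lead K H h f)
      have h7 : cochainContraction K H h (del K H x (formD K H f)) =
          counit (R := K) x • cochainContraction K H h f - cochainContraction K H h (barOp x f) -
            cochainContraction K H h (formD K H (del K H x f)) := by
        rw [del_formD]
        simp [cochainContraction_one_form]
      rw [map_add, map_add, map_smul, h5, del_cochainContraction, lead_formD, map_sub, map_neg,
        h6, h7, h1, h3, h2, h4]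
      simp only [smul_sub]
      abel

/-- On the left one leg of `g` is substituted after acting by `ad(h⁽¹⁾)`, on the right `ad(h⁽²⁾)g`
is split by the coproduct; `IsBilin.sw_comul_adR` exchanges the two, and `reduced` commutes with the
adjoint action. -/
theorem lead_lie (g h : H) (f : MForms K H) :
    lead K H g (lie K H h f) = sw K h fun a b => lie K H a (lead K H (adR K H b g) f) := by
  have h1 := IsBilin.sw_comul_adR (K := K) (F := fun u v => lie K H v (del K H (reduced K H u) f))
    (by constructor <;> simp) g h
  simp only [lead_apply, del_lie, map_sw, lie_lie, h1]
  rw [sw_comm]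
  simp only [adR_reduced]

theorem cochainContraction_lie (g h : H) (f : MForms K H) :
    cochainContraction K H g (lie K H h f) =
      sw K h fun a b => lie K H a (cochainContraction K H (adR K H b g) f) := by
  induction f using forms_induction generalizing g h with
  | zero => simp [sw_zero]
  | add f f' hf hf' => simp only [map_add, hf, hf', sw_add]
  | step f ih =>
    refine forms_ext ?_ fun x => ?_
    · rw [aug_cochainContraction, lead_lie, map_sw, map_sw]
      simp only [aug_lie, aug_cochainContraction]
    · rw [del_cochainContraction, lead_lie, map_sw, map_sw]
      simp only [del_lie, del_cochainContraction, map_sub, sw_sub, map_sw, ih]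
      congr 1
      refine (IsTrilin.sw_assoc (F := fun a c d => lie K H c
        (cochainContraction K H (adR K H d g) (del K H (adR K H a x) f))) ?_ h).symm
      constructor <;> simp

theorem cochainContraction_one (f : MForms K H) : cochainContraction K H (1 : H) f = 0 := by
  have h1 : ∀ f, lead K H (1 : H) f = 0 := fun f => by
    rw [lead_apply, IsBilin.sw_one]
    · simp [reduced_one]
    · constructor <;> simp
  induction f using forms_induction with
  | zero => simp
  | add f f' hf hf' => rw [map_add, hf, hf', add_zero]
  | step f ih =>
    refine forms_ext ?_ fun x => ?_
    · rw [aug_cochainContraction, h1]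
    · rw [del_cochainContraction, h1, ih, sub_zero]

/-- By Cartan's formula the axioms stated with `d i_h + i_h d + ε(h)` are the identities already
proved for the adjoint action on forms. -/
theorem lieOp_cochainContraction :
    lieOp (cochainAlgebra K H) (cochainContraction K H) = lie K H := by
  ext h f
  rw [lieOp_apply]
  exact (lie_eq h f).symm

theorem sweedler_eq {M : Type*} [AddCommGroup M] [Module K M] (B : H →ₗ[K] H →ₗ[K] M) (h : H) :
    sweedler B h = sw K h fun a b => B a b :=
  lift_comul B h

variable (K H) in
theorem isOperation_cochainContraction :
    IsOperation (cochainAlgebra K H) (cochainContraction K H) where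
  deg_zero := by
    rintro h _ ⟨Φ, rfl⟩
    exact cochainContraction_ofForm_zero K h Φ
  deg_succ := by
    rintro h n _ ⟨Φ, rfl⟩
    rw [cochainContraction_ofForm_succ]
    exact ⟨_, rfl⟩
  one := LinearMap.ext cochainContraction_one
  mul h n f g hf := by
    rw [sweedler_eq, lieOp_cochainContraction, ← smul_mul_assoc]
    refine (cochainContraction_mul h f g).trans ?_
    rw [gradeInv_of_mem _ hf]
    rfl
  comp_lie g h := by
    rw [sweedler_eq, lieOp_cochainContraction]
    refine LinearMap.ext fun f => ?_
    rw [sw_apply]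
    exact cochainContraction_lie g h f
  lie_lie h g := by
    rw [lieOp_cochainContraction]
    exact LinearMap.ext (lie_lie h g)

end CochainOperation

/-! ### Operations in graded differential algebras -/

section GeneralOperation

open Coalgebra

variable {K : Type u} [Field K]

theorem sw_mem {C M : Type*} [AddCommGroup C] [Module K C] [Coalgebra K C] [AddCommGroup M]
    [Module K M] (p : Submodule K M) (h : C) {F : C → C → M} (hF : ∀ a b, F a b ∈ p) :
    sw K h F ∈ p :=
  p.sum_mem fun _ _ => hF _ _

/-- The component of degree `n - 1` of a graded differential algebra, zero for `n = 0`. -/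
def degPred (Ω : GradedDiffAlgebra.{u, w} K) : ℕ → Submodule K Ω
  | 0 => ⊥
  | n + 1 => Ω.deg n

variable (Ω : GradedDiffAlgebra.{u, w} K)

theorem degPred_mul_mem {m n : ℕ} {x y : Ω} (hx : x ∈ degPred Ω m) (hy : y ∈ Ω.deg n) :
    x * y ∈ degPred Ω (m + n) := by
  cases m with
  | zero =>
    rw [(Submodule.mem_bot K).1 hx, zero_mul]
    exact Submodule.zero_mem _
  | succ m =>
    rw [Nat.succ_add]
    exact SetLike.GradedMul.mul_mem (A := Ω.deg) hx hy

theorem mul_degPred_mem {m n : ℕ} {x y : Ω} (hx : x ∈ Ω.deg m) (hy : y ∈ degPred Ω n) :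
    x * y ∈ degPred Ω (m + n) := by
  cases n with
  | zero =>
    rw [(Submodule.mem_bot K).1 hy, mul_zero]
    exact Submodule.zero_mem _
  | succ n => exact SetLike.GradedMul.mul_mem (A := Ω.deg) hx hy

theorem d_mem_of_degPred {n : ℕ} {x : Ω} (hx : x ∈ degPred Ω n) : Ω.d x ∈ Ω.deg n := by
  cases n with
  | zero =>
    rw [(Submodule.mem_bot K).1 hx, map_zero]
    exact Submodule.zero_mem _
  | succ n => exact Ω.d_mem n x hx

theorem gradeInv_of_mem_degPred {n : ℕ} {x : Ω} (hx : x ∈ degPred Ω n) :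
    gradeInv Ω.deg x = -((-1 : K) ^ n • x) := by
  cases n with
  | zero => rw [(Submodule.mem_bot K).1 hx, map_zero, smul_zero, neg_zero]
  | succ n => rw [gradeInv_of_mem Ω.deg hx, pow_succ]; simp

theorem gradeInv_mem {n : ℕ} {x : Ω} (hx : x ∈ Ω.deg n) : gradeInv Ω.deg x ∈ Ω.deg n := by
  rw [gradeInv_of_mem Ω.deg hx]
  exact Submodule.smul_mem _ _ hx

theorem gradeInv_d (x : Ω) : gradeInv Ω.deg (Ω.d x) = -Ω.d (gradeInv Ω.deg x) := by
  induction x using DirectSum.Decomposition.inductionOn Ω.deg with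
  | zero => simp
  | add x x' h h' => simp only [map_add, h, h']; abel
  | @homogeneous m x =>
    rw [gradeInv_of_mem _ x.2, gradeInv_of_mem _ (Ω.d_mem m x x.2), map_smul, pow_succ]
    simp

theorem d_mul_eq (x y : Ω) : Ω.d (x * y) = Ω.d x * y + gradeInv Ω.deg x * Ω.d y := by
  induction x using DirectSum.Decomposition.inductionOn Ω.deg with
  | zero => simp
  | add x x' h h' => simp only [map_add, add_mul, h, h']; abel
  | @homogeneous m x => rw [Ω.d_mul m x y x.2, gradeInv_of_mem _ x.2, smul_mul_assoc]

theorem gradeInv_comp_of_degPred {T : Module.End K Ω}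
    (hT : ∀ n, ∀ x ∈ Ω.deg n, T x ∈ degPred Ω n) (x : Ω) :
    gradeInv Ω.deg (T x) = -T (gradeInv Ω.deg x) := by
  induction x using DirectSum.Decomposition.inductionOn Ω.deg with
  | zero => simp
  | add x x' h h' => simp only [map_add, h, h']; abel
  | @homogeneous m x =>
    rw [gradeInv_of_mem _ x.2, gradeInv_of_mem_degPred _ (hT m x x.2), map_smul]

theorem gradeInv_comp_of_deg {T : Module.End K Ω}
    (hT : ∀ n, ∀ x ∈ Ω.deg n, T x ∈ Ω.deg n) (x : Ω) :
    gradeInv Ω.deg (T x) = T (gradeInv Ω.deg x) := by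
  induction x using DirectSum.Decomposition.inductionOn Ω.deg with
  | zero => simp
  | add x x' h h' => simp only [map_add, h, h']
  | @homogeneous m x =>
    rw [gradeInv_of_mem _ x.2, gradeInv_of_mem _ (hT m x x.2), map_smul]

variable {H : Type v} [Ring H] [HopfAlgebra K H]

theorem lieOp_d (i : H →ₗ[K] Module.End K Ω) (h : H) (x : Ω) :
    lieOp Ω i h (Ω.d x) = Ω.d (lieOp Ω i h x) := by
  simp only [lieOp_apply, map_add, map_smul, Ω.d_d, map_zero, add_zero, zero_add]

/-- The product rule for `L_h = d i_h + i_h d + ε(h)`, when `i_h` satisfies the product rule with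
some operators `L'_h` which agree with the operators `L_h` on the factors. -/
theorem lieOp_mul_of {i L : H →ₗ[K] Module.End K Ω}
    (hσ : ∀ h x, gradeInv Ω.deg (i h x) = -i h (gradeInv Ω.deg x))
    (hmul : ∀ h x y, i h (x * y) =
      (sw K h fun a b => i a x * L b y) + gradeInv Ω.deg x * i h y)
    {x y : Ω} (hx : ∀ a, L a x = lieOp Ω i a x) (hy : ∀ a, L a y = lieOp Ω i a y)
    (hdy : ∀ a, L a (Ω.d y) = Ω.d (L a y)) (h : H) :
    lieOp Ω i h (x * y) = sw K h fun a b => L a x * L b y := by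
  have h1 : (sw K h fun a b => L a x * L b y) =
      (sw K h fun a b => Ω.d (i a x) * L b y) + (sw K h fun a b => i a (Ω.d x) * L b y) +
        x * L h y := by
    have h2 : (sw K h fun a b => (counit (R := K) a • x) * L b y) = x * L h y := by
      simp only [smul_mul_assoc]
      exact sw_counit_smul (LinearMap.mulLeft K x ∘ₗ L.flip y) h
    rw [← h2, ← sw_add, ← sw_add]
    simp only [hx, lieOp_apply, add_mul]
  -- With `x'` for `x` multiplied by its sign, the terms `i_a(x') d(L_b y)` and `d(x') i_h(y)` each
  -- occur twice, with opposite signs; the rest assembles into `L` of the two factors.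
  rw [h1, lieOp_apply, hmul, d_mul_eq, map_add, map_add, hmul, hmul, d_mul_eq, map_sw]
  simp only [d_mul_eq, sw_add, hσ, hdy, gradeInv_gradeInv, gradeInv_d, neg_mul, sw_neg]
  rw [hy, lieOp_apply, mul_add, mul_add, mul_smul_comm]
  abel

variable {Ω} {i : H →ₗ[K] Module.End K Ω}

theorem IsOperation.mem_degPred (hi : IsOperation Ω i) (h : H) (n : ℕ) (x : Ω) (hx : x ∈ Ω.deg n) :
    i h x ∈ degPred Ω n := by
  cases n with
  | zero => exact (Submodule.mem_bot K).2 (hi.deg_zero h x hx)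
  | succ n => exact hi.deg_succ h n x hx

theorem lieOp_mem (hi : ∀ h n, ∀ x ∈ Ω.deg n, i h x ∈ degPred Ω n) (h : H) (n : ℕ) (x : Ω)
    (hx : x ∈ Ω.deg n) : lieOp Ω i h x ∈ Ω.deg n := by
  rw [lieOp_apply]
  exact Submodule.add_mem _ (Submodule.add_mem _ (d_mem_of_degPred Ω (hi h n x hx))
    (hi h (n + 1) _ (Ω.d_mem n x hx))) (Submodule.smul_mem _ _ hx)

theorem IsOperation.gradeInv_apply (hi : IsOperation Ω i) (h : H) (x : Ω) :
    gradeInv Ω.deg (i h x) = -i h (gradeInv Ω.deg x) :=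
  gradeInv_comp_of_degPred Ω (hi.mem_degPred h) x

theorem IsOperation.gradeInv_lieOp (hi : IsOperation Ω i) (h : H) (x : Ω) :
    gradeInv Ω.deg (lieOp Ω i h x) = lieOp Ω i h (gradeInv Ω.deg x) :=
  gradeInv_comp_of_deg Ω (lieOp_mem hi.mem_degPred h) x

theorem IsOperation.apply_mul (hi : IsOperation Ω i) (h : H) (x y : Ω) :
    i h (x * y) = (sw K h fun a b => i a x * lieOp Ω i b y) + gradeInv Ω.deg x * i h y := by
  induction x using DirectSum.Decomposition.inductionOn Ω.deg with
  | zero => simp [sw_zero]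
  | add x x' h h' => simp only [map_add, add_mul, h, h', sw_add]; abel
  | @homogeneous m x =>
    rw [hi.mul h m x y x.2, gradeInv_of_mem _ x.2, smul_mul_assoc, sweedler_eq]
    rfl

theorem IsOperation.lieOp_mul (hi : IsOperation Ω i) (h : H) (x y : Ω) :
    lieOp Ω i h (x * y) = sw K h fun a b => lieOp Ω i a x * lieOp Ω i b y :=
  lieOp_mul_of Ω hi.gradeInv_apply hi.apply_mul (fun _ => rfl) (fun _ => rfl)
    (fun _ => lieOp_d Ω i _ _) h

theorem IsOperation.apply_lieOp (hi : IsOperation Ω i) (g h : H) (x : Ω) :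
    i g (lieOp Ω i h x) = sw K h fun a b => lieOp Ω i a (i (adR K H b g) x) := by
  have := LinearMap.congr_fun (hi.comp_lie g h) x
  rw [sweedler_eq, sw_apply] at this
  exact this

theorem IsOperation.lieOp_lieOp (hi : IsOperation Ω i) (h g : H) (x : Ω) :
    lieOp Ω i h (lieOp Ω i g x) = lieOp Ω i (h * g) x :=
  LinearMap.congr_fun (hi.lie_lie h g) x

end GeneralOperation

/-! ### Extension of an operation to the differential envelope -/

section EnvelopeOperation

open Coalgebra WithConv

variable {K : Type u} [Field K] {H : Type v} [Ring H] [HopfAlgebra K H]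
  {A : GradedDiffAlgebra.{u, w} K} (i : H →ₗ[K] Module.End K A)

/-- The maps `a ↦ i_h(a)` from `A` to `Ω_gr(A)`. -/
def inContraction : H →ₗ[K] A →ₗ[K] Env A.deg := i.compr₂ (envIn A.deg).toLinearMap

/-- The maps `a ↦ L_h(a)` from `A` to `Ω_gr(A)`. -/
def inLie : H →ₗ[K] A →ₗ[K] Env A.deg := (lieOp A i).compr₂ (envIn A.deg).toLinearMap

/-- The maps `a ↦ L_h(a) - d(i_h(a)) - ε(h) a` from `A` to `Ω_gr(A)`. -/
def diffContraction : H →ₗ[K] A →ₗ[K] Env A.deg :=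
  inLie i - i.compr₂ (envDiff A.deg) -
    (counit (R := K) (A := H)).smulRight (envIn A.deg).toLinearMap

/-- The maps `a ↦ d(L_h(a))` from `A` to `Ω_gr(A)`. -/
def diffLie : H →ₗ[K] A →ₗ[K] Env A.deg := (lieOp A i).compr₂ (envDiff A.deg)

theorem inContraction_apply (h : H) (a : A) : inContraction i h a = envIn A.deg (i h a) := rfl

theorem inLie_apply (h : H) (a : A) : inLie i h a = envIn A.deg (lieOp A i h a) := rfl

theorem diffContraction_apply (h : H) (a : A) : diffContraction i h a =
    envIn A.deg (lieOp A i h a) - envDiff A.deg (i h a) - counit (R := K) h • envIn A.deg a := rfl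

theorem diffLie_apply (h : H) (a : A) : diffLie i h a = envDiff A.deg (lieOp A i h a) := rfl

/-- A bilinear map on `H × V`, as a linear map from `V` to the convolution algebra. -/
def toConvMap {V R : Type*} [AddCommGroup V] [Module K V] [Ring R] [Algebra K R]
    (T : H →ₗ[K] V →ₗ[K] R) : V →ₗ[K] WithConv (H →ₗ[K] R) :=
  (WithConv.linearEquiv K (H →ₗ[K] R)).symm.toLinearMap ∘ₗ T.flip

theorem toConvMap_apply {V R : Type*} [AddCommGroup V] [Module K V] [Ring R] [Algebra K R]
    (T : H →ₗ[K] V →ₗ[K] R) (x : V) (h : H) : toConvMap T x h = T h x := rfl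

theorem conv_ext {R : Type*} [Ring R] [Algebra K R] {f g : WithConv (H →ₗ[K] R)}
    (hfg : ∀ h, f h = g h) : f = g :=
  WithConv.ext (LinearMap.ext hfg)

variable (K H) in
theorem convConst_add {R : Type*} [Ring R] [Algebra K R] (x y : R) :
    convConst K H (x + y) = convConst K H x + convConst K H y :=
  conv_ext fun _ => smul_add _ _ _

variable (K H) in
theorem convConst_smul {R : Type*} [Ring R] [Algebra K R] (c : K) (x : R) :
    convConst K H (c • x) = c • convConst K H x :=
  conv_ext fun _ => smul_comm _ _ _

variable (K H) in
theorem convConst_one {R : Type*} [Ring R] [Algebra K R] : convConst K H (1 : R) = 1 :=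
  conv_ext fun _ => (Algebra.algebraMap_eq_smul_one _).symm

variable (K H) in
theorem convConst_neg {R : Type*} [Ring R] [Algebra K R] (x : R) :
    convConst K H (-x) = -convConst K H x :=
  conv_ext fun _ => smul_neg _ _

variable {i} (hi : IsOperation A i)

include hi

theorem IsOperation.apply_one_right (h : H) : i h 1 = 0 :=
  hi.deg_zero h 1 SetLike.GradedOne.one_mem

theorem IsOperation.lieOp_one_right (h : H) : lieOp A i h 1 = counit (R := K) h • 1 := by
  have h1 : A.d 1 = 0 := by simpa using A.d_mul 0 1 1 SetLike.GradedOne.one_mem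
  rw [lieOp_apply, h1, hi.apply_one_right]
  simp

/-- As a function of `h`, the Sweedler sum in the product rule is a convolution product; this is the
upper right entry of a product of triangular matrices. -/
theorem toConvMap_inContraction_mul (a b : A) :
    toConvMap (inContraction i) (a * b) =
      convConst K H (envIn A.deg (gradeInv A.deg a)) * toConvMap (inContraction i) b +
        toConvMap (inContraction i) a * toConvMap (inLie i) b := by
  refine conv_ext fun h => ?_
  rw [ofConv_add, LinearMap.add_apply, convConst_mul_apply, convMul_eq_sw]
  simp only [toConvMap_apply, inContraction_apply, inLie_apply]
  rw [hi.apply_mul, map_add, map_mul, ← AlgHom.toLinearMap_apply, map_sw, add_comm]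
  simp

theorem toConvMap_inLie_mul (a b : A) :
    toConvMap (inLie i) (a * b) = toConvMap (inLie i) a * toConvMap (inLie i) b := by
  refine conv_ext fun h => ?_
  rw [convMul_eq_sw]
  simp only [toConvMap_apply, inLie_apply]
  rw [hi.lieOp_mul, ← AlgHom.toLinearMap_apply, map_sw]
  simp

theorem toConvMap_diffLie_mul (a b : A) :
    toConvMap (diffLie i) (a * b) = toConvMap (diffLie i) a * toConvMap (inLie i) b +
      toConvMap (inLie i) (gradeInv A.deg a) * toConvMap (diffLie i) b := by
  refine conv_ext fun h => ?_
  rw [ofConv_add, LinearMap.add_apply, convMul_eq_sw, convMul_eq_sw]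
  simp only [toConvMap_apply, inLie_apply, diffLie_apply]
  rw [hi.lieOp_mul, map_sw]
  simp only [envDiff_mul, sw_add, hi.gradeInv_lieOp]

/-- The consistency check for the forced value of `i_h(da)`: expanding `i_h(d(ab))` by that formula
agrees with applying the product rule to `da · b ± a · db`. -/
theorem toConvMap_diffContraction_mul (a b : A) :
    toConvMap (diffContraction i) (a * b) =
      convConst K H (-envDiff A.deg (gradeInv A.deg a)) * toConvMap (inContraction i) b +
        toConvMap (diffContraction i) a * toConvMap (inLie i) b +
      (convConst K H (envIn A.deg a) * toConvMap (diffContraction i) b +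
        toConvMap (inContraction i) (gradeInv A.deg a) * toConvMap (diffLie i) b) := by
  refine conv_ext fun h => ?_
  simp only [ofConv_add, LinearMap.add_apply, convConst_mul_apply]
  rw [convMul_eq_sw, convMul_eq_sw]
  simp only [toConvMap_apply, inLie_apply, inContraction_apply, diffLie_apply,
    diffContraction_apply, sub_mul, sw_sub]
  rw [hi.lieOp_mul, hi.apply_mul, ← AlgHom.toLinearMap_apply, map_sw, map_add, map_sw]
  -- This is the counit part of `i_h(da)` in the convolution with `L(b)`; it cancels the term `a
  -- L_h(b)` coming from `a · i_h(db)`.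
  have h1 : (sw K h fun c d => (counit (R := K) c • envIn A.deg a) * envIn A.deg (lieOp A i d b)) =
      envIn A.deg a * envIn A.deg (lieOp A i h b) := by
    simp only [smul_mul_assoc]
    exact sw_counit_smul (LinearMap.mulLeft K (envIn A.deg a) ∘ₗ (inLie i).flip b) h
  rw [h1]
  simp only [AlgHom.toLinearMap_apply, map_mul, envDiff_mul, sw_add, hi.gradeInv_apply,
    gradeInv_gradeInv, map_neg, neg_mul, sw_neg, mul_sub, mul_smul_comm]
  abel

/-- The homomorphism `a ↦ [± a ε, i(a); 0, L(a)]` from `A` to the triangular matrices with entries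
in the convolution algebra of linear maps from `H` to `Ω_gr(A)`. -/
def operationIn : A →ₐ[K] Matrix (Fin 2) (Fin 2) (WithConv (H →ₗ[K] Env A.deg)) :=
  AlgHom.ofLinearMap
    { toFun := fun a => !![convConst K H (envIn A.deg (gradeInv A.deg a)),
        toConvMap (inContraction i) a; 0, toConvMap (inLie i) a]
      map_add' := fun a b => by simp [convConst_add]
      map_smul' := fun c a => by simp [convConst_smul] }
    (by
      have h1 : toConvMap (inContraction i) 1 = 0 := conv_ext fun h => by
        rw [toConvMap_apply, inContraction_apply, hi.apply_one_right, map_zero]; rfl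
      have h2 : toConvMap (inLie i) 1 = 1 := conv_ext fun h => by
        rw [toConvMap_apply, inLie_apply, hi.lieOp_one_right, map_smul, map_one,
          ← Algebra.algebraMap_eq_smul_one]; rfl
      simp [gradeInv_one, convConst_one, Matrix.one_fin_two, h1, h2])
    (fun a b => by
      simp [gradeInv_mul, ← convConst_mul, toConvMap_inContraction_mul hi, toConvMap_inLie_mul hi])

omit hi in
variable (i) in
/-- The linear map `a ↦ [± da ε, i(da); 0, L(da)]`, with `i_h(da) = L_h(a) - d(i_h(a)) - ε(h) a` and
`L_h(da) = d(L_h(a))`. -/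
def operationDiff : A →ₗ[K] Matrix (Fin 2) (Fin 2) (WithConv (H →ₗ[K] Env A.deg)) where
  toFun a := !![convConst K H (-envDiff A.deg (gradeInv A.deg a)),
    toConvMap (diffContraction i) a; 0, toConvMap (diffLie i) a]
  map_add' a b := by simp [convConst_neg, convConst_add, add_comm]
  map_smul' c a := by simp [convConst_neg, convConst_smul]

/-- This antiderivation rule is the hypothesis of the universal property `envLift`; the diagonal
entry `h1` is the rule for `d` in the envelope twisted by signs. -/
theorem operationDiff_mul (a b : A) : operationDiff i (a * b) =
    operationDiff i a * operationIn hi b + operationIn hi (gradeInv A.deg a) * operationDiff i b := by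
  have h1 : convConst K H (-envDiff A.deg (gradeInv A.deg (a * b))) =
      convConst K H (-envDiff A.deg (gradeInv A.deg a)) *
        convConst K H (envIn A.deg (gradeInv A.deg b)) +
      convConst K H (envIn A.deg a) * convConst K H (-envDiff A.deg (gradeInv A.deg b)) := by
    rw [convConst_mul, convConst_mul, ← convConst_add, gradeInv_mul, envDiff_mul,
      gradeInv_gradeInv]
    congr 1
    simp [add_comm]
  simp [operationDiff, operationIn, h1, toConvMap_diffContraction_mul hi,
    toConvMap_diffLie_mul hi, gradeInv_gradeInv]

/-- The homomorphism `x ↦ [± x ε, i(x); 0, L(x)]` from `Ω_gr(A)` to the triangular matrices with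
entries in the convolution algebra of linear maps from `H` to `Ω_gr(A)`. -/
def operationHom : Env A.deg →ₐ[K] Matrix (Fin 2) (Fin 2) (WithConv (H →ₗ[K] Env A.deg)) :=
  envLift A.deg (operationIn hi) (operationDiff i) (operationDiff_mul hi)

/-- The extension of the operators `i_h` to `Ω_gr(A)`. -/
def envContraction : H →ₗ[K] Module.End K (Env A.deg) :=
  LinearMap.flip ((WithConv.linearEquiv K (H →ₗ[K] Env A.deg)).toLinearMap ∘ₗ
    Matrix.entryLinearMap K _ 0 1 ∘ₗ (operationHom hi).toLinearMap)

/-- The extension of the operators `L_h` to `Ω_gr(A)`. -/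
def envLie : H →ₗ[K] Module.End K (Env A.deg) :=
  LinearMap.flip ((WithConv.linearEquiv K (H →ₗ[K] Env A.deg)).toLinearMap ∘ₗ
    Matrix.entryLinearMap K _ 1 1 ∘ₗ (operationHom hi).toLinearMap)

theorem envContraction_eq (h : H) (x : Env A.deg) :
    envContraction hi h x = operationHom hi x 0 1 h := rfl

theorem envLie_eq (h : H) (x : Env A.deg) : envLie hi h x = operationHom hi x 1 1 h := rfl

theorem envContraction_envIn (h : H) (a : A) :
    envContraction hi h (envIn A.deg a) = envIn A.deg (i h a) := by
  rw [envContraction_eq, operationHom, envLift_envIn]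
  rfl

theorem envLie_envIn (h : H) (a : A) :
    envLie hi h (envIn A.deg a) = envIn A.deg (lieOp A i h a) := by
  rw [envLie_eq, operationHom, envLift_envIn]
  rfl

theorem envContraction_envDiff (h : H) (a : A) : envContraction hi h (envDiff A.deg a) =
    envIn A.deg (lieOp A i h a) - envDiff A.deg (i h a) - counit (R := K) h • envIn A.deg a := by
  rw [envContraction_eq, operationHom, envLift_envDiff]
  rfl

theorem envLie_envDiff (h : H) (a : A) :
    envLie hi h (envDiff A.deg a) = envDiff A.deg (lieOp A i h a) := by
  rw [envLie_eq, operationHom, envLift_envDiff]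
  rfl

/-- Once the first column is known, the remaining entries of the multiplicativity of `operationHom`
are the product rules for `i_h` and `L_h` on the whole envelope. -/
theorem operationHom_diag (x : Env A.deg) :
    operationHom hi x 0 0 = convConst K H (gradeInv (envDeg A.deg) x) ∧
      operationHom hi x 1 0 = 0 := by
  induction x using env_induction A.deg with
  | hA a =>
    rw [operationHom, envLift_envIn, gradeInv_envIn]
    exact ⟨rfl, rfl⟩
  | hD a =>
    rw [operationHom, envLift_envDiff, gradeInv_envDiff]
    exact ⟨rfl, rfl⟩
  | hadd x y hx hy => simp [hx, hy, convConst_add]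
  | hmul x y hx hy =>
    simp [Matrix.mul_apply, Fin.sum_univ_two, hx, hy, gradeInv_mul, convConst_mul]

theorem envContraction_mul (h : H) (x y : Env A.deg) : envContraction hi h (x * y) =
    (sw K h fun a b => envContraction hi a x * envLie hi b y) +
      gradeInv (envDeg A.deg) x * envContraction hi h y := by
  rw [envContraction_eq, map_mul, Matrix.mul_apply, Fin.sum_univ_two, (operationHom_diag hi x).1,
    ofConv_add, LinearMap.add_apply, convConst_mul_apply, convMul_eq_sw, add_comm]
  rfl

theorem envLie_mul (h : H) (x y : Env A.deg) :
    envLie hi h (x * y) = sw K h fun a b => envLie hi a x * envLie hi b y := by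
  rw [envLie_eq, map_mul, Matrix.mul_apply, Fin.sum_univ_two, (operationHom_diag hi x).2, zero_mul,
    zero_add, convMul_eq_sw]
  rfl

end EnvelopeOperation

/-! ### Verification of the axioms for the extended operators, and uniqueness. -/

section EnvelopeOperation

open Coalgebra

variable {K : Type u} [Field K] {H : Type v} [Ring H] [HopfAlgebra K H]
  {A : GradedDiffAlgebra.{u, w} K} {i : H →ₗ[K] Module.End K A} (hi : IsOperation A i)

include hi

theorem envContraction_envIn_mem (h : H) {n : ℕ} {a : A} (ha : a ∈ A.deg n) :
    envContraction hi h (envIn A.deg a) ∈ degPred (envelope A.deg) n := by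
  rw [envContraction_envIn]
  cases n with
  | zero =>
    rw [hi.deg_zero h a ha, map_zero]
    exact Submodule.zero_mem _
  | succ n => exact envIn_mem A.deg (hi.deg_succ h n a ha)

theorem envContraction_envDiff_mem (h : H) {n : ℕ} {a : A} (ha : a ∈ A.deg n) :
    envContraction hi h (envDiff A.deg a) ∈ envDeg A.deg n := by
  rw [envContraction_envDiff]
  refine Submodule.sub_mem _ (Submodule.sub_mem _
    (envIn_mem A.deg (lieOp_mem hi.mem_degPred h n a ha)) ?_)
    (Submodule.smul_mem _ _ (envIn_mem A.deg ha))
  cases n with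
  | zero =>
    rw [hi.deg_zero h a ha, map_zero]
    exact Submodule.zero_mem _
  | succ n => exact envDiff_mem A.deg (hi.deg_succ h n a ha)

theorem envContraction_envLie_mul_mem {m n : ℕ} {x y : Env A.deg} (hx : x ∈ envDeg A.deg m)
    (hxL : ∀ h, envLie hi h x ∈ envDeg A.deg m)
    (hxi : ∀ h, envContraction hi h x ∈ degPred (envelope A.deg) m)
    (hyL : ∀ h, envLie hi h y ∈ envDeg A.deg n)
    (hyi : ∀ h, envContraction hi h y ∈ degPred (envelope A.deg) n) :
    (∀ h, envLie hi h (x * y) ∈ envDeg A.deg (m + n)) ∧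
      ∀ h, envContraction hi h (x * y) ∈ degPred (envelope A.deg) (m + n) := by
  refine ⟨fun h => ?_, fun h => ?_⟩
  · rw [envLie_mul]
    exact sw_mem _ _ fun a b => SetLike.GradedMul.mul_mem (hxL a) (hyL b)
  · rw [envContraction_mul]
    exact Submodule.add_mem _ (sw_mem _ _ fun a b => degPred_mul_mem (envelope A.deg) (hxi a) (hyL b))
      (mul_degPred_mem (envelope A.deg) (gradeInv_mem (envelope A.deg) hx) (hyi h))

/-- Both degrees have to be followed at once, because the product rule for `i_h` involves `L_h` of
the second factor. -/
theorem envContraction_envLie_homog {n : ℕ} {x : Env A.deg} (hx : EnvHomog A.deg n x) :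
    (∀ h, envLie hi h x ∈ envDeg A.deg n) ∧
      ∀ h, envContraction hi h x ∈ degPred (envelope A.deg) n := by
  induction hx with
  | ofAlg n a ha =>
    exact ⟨fun h => by
      rw [envLie_envIn]; exact envIn_mem A.deg (lieOp_mem hi.mem_degPred h n a ha),
      fun h => envContraction_envIn_mem hi h ha⟩
  | ofForms n m hm =>
    rw [envInForms_eq]
    generalize (m : A ⊗[K] A) = t at hm
    induction hm using Submodule.span_induction with
    | mem t ht =>
      obtain ⟨r, s, x, y, rfl, hx, hy, rfl⟩ := ht
      rw [pairing_tmul, AlgHom.toLinearMap_apply, add_assoc]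
      refine envContraction_envLie_mul_mem hi (envIn_mem A.deg hx) (fun h => ?_)
        (fun h => envContraction_envIn_mem hi h hx) (fun h => ?_)
        (fun h => envContraction_envDiff_mem hi h hy)
      · rw [envLie_envIn]; exact envIn_mem A.deg (lieOp_mem hi.mem_degPred h r x hx)
      · rw [envLie_envDiff]; exact envDiff_mem A.deg (lieOp_mem hi.mem_degPred h s y hy)
    | zero => simp [map_zero]
    | add s t _ _ hs ht =>
      simp only [map_add]
      exact ⟨fun h => Submodule.add_mem _ (hs.1 h) (ht.1 h),
        fun h => Submodule.add_mem _ (hs.2 h) (ht.2 h)⟩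
    | smul c t _ ht =>
      simp only [map_smul]
      exact ⟨fun h => Submodule.smul_mem _ _ (ht.1 h), fun h => Submodule.smul_mem _ _ (ht.2 h)⟩
  | mul m n x y hx' hy' hx hy =>
    exact envContraction_envLie_mul_mem hi (Submodule.subset_span hx') hx.1 hx.2 hy.1 hy.2

theorem envLie_mem (h : H) (n : ℕ) (x : Env A.deg) (hx : x ∈ envDeg A.deg n) :
    envLie hi h x ∈ envDeg A.deg n := by
  have : envDeg A.deg n ≤ (envDeg A.deg n).comap (envLie hi h) :=
    Submodule.span_le.2 fun x hx => (envContraction_envLie_homog hi hx).1 h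
  exact this hx

theorem envContraction_mem (h : H) (n : ℕ) (x : Env A.deg) (hx : x ∈ envDeg A.deg n) :
    envContraction hi h x ∈ degPred (envelope A.deg) n := by
  have : envDeg A.deg n ≤ (degPred (envelope A.deg) n).comap (envContraction hi h) :=
    Submodule.span_le.2 fun x hx => (envContraction_envLie_homog hi hx).2 h
  exact this hx

theorem gradeInv_envContraction (h : H) (x : Env A.deg) :
    gradeInv (envDeg A.deg) (envContraction hi h x) =
      -envContraction hi h (gradeInv (envDeg A.deg) x) :=
  gradeInv_comp_of_degPred (envelope A.deg) (envContraction_mem hi h) x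

theorem gradeInv_envLie (h : H) (x : Env A.deg) :
    gradeInv (envDeg A.deg) (envLie hi h x) = envLie hi h (gradeInv (envDeg A.deg) x) :=
  gradeInv_comp_of_deg (envelope A.deg) (envLie_mem hi h) x

/-- On `A` the first identity holds by the choice of `i_h(da)`. On products it requires that `L_h`
commute with `d` on the second factor, so the two assertions are carried through the induction
together. -/
theorem envLie_eq_lieOp_and (x : Env A.deg) :
    (∀ h, envLie hi h x = lieOp (envelope A.deg) (envContraction hi) h x) ∧
      ∀ h, envLie hi h (envD A.deg x) = envD A.deg (envLie hi h x) := by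
  induction x using env_induction A.deg with
  | hA a =>
    refine ⟨fun h => ?_, fun h => ?_⟩
    · change _ = envD A.deg (envContraction hi h (envIn A.deg a)) +
        envContraction hi h (envD A.deg (envIn A.deg a)) + counit (R := K) h • envIn A.deg a
      rw [envContraction_envIn, envD_envIn, envD_envIn, envContraction_envDiff, envLie_envIn]
      abel
    · rw [envD_envIn, envLie_envDiff, envLie_envIn, envD_envIn]
  | hD a =>
    refine ⟨fun h => ?_, fun h => ?_⟩
    · change _ = envD A.deg (envContraction hi h (envDiff A.deg a)) +
        envContraction hi h (envD A.deg (envDiff A.deg a)) + counit (R := K) h • envDiff A.deg a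
      rw [envContraction_envDiff, envD_envDiff, map_sub, map_sub, map_smul, envD_envDiff,
        envD_envIn, envD_envIn, envLie_envDiff, map_zero]
      abel
    · rw [envD_envDiff, map_zero, envLie_envDiff, envD_envDiff]
  | hadd x y hx hy =>
    simp only [map_add, hx.1, hy.1, hx.2, hy.2, implies_true, and_self]
  | hmul x y hx hy =>
    refine ⟨fun h => ?_, fun h => ?_⟩
    · rw [envLie_mul]
      -- The product rule for `envContraction` is known with `envLie`, which is not yet identified
      -- with the Cartan operator; `lieOp_mul_of` asks for that identification only on the factors.
      exact (lieOp_mul_of (envelope A.deg) (gradeInv_envContraction hi) (envContraction_mul hi)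
        hx.1 hy.1 hy.2 h).symm
    · rw [envD_mul', map_add, envLie_mul, envLie_mul, envLie_mul, map_sw, ← sw_add]
      refine sw_congr _ fun a b => ?_
      rw [envD_mul', hx.2, hy.2, gradeInv_envLie]

theorem lieOp_envContraction : lieOp (envelope A.deg) (envContraction hi) = envLie hi :=
  LinearMap.ext fun h => LinearMap.ext fun x => ((envLie_eq_lieOp_and hi x).1 h).symm

theorem envContraction_one (x : Env A.deg) : envContraction hi 1 x = 0 := by
  have h1 : ∀ a, i 1 a = 0 := fun a => by rw [hi.one]; rfl
  induction x using env_induction A.deg with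
  | hA a => rw [envContraction_envIn, h1, map_zero]
  | hD a =>
    rw [envContraction_envDiff, lieOp_apply, h1, h1, Bialgebra.counit_one]
    simp
  | hadd x y hx hy => rw [map_add, hx, hy, add_zero]
  | hmul x y hx hy =>
    rw [envContraction_mul, IsBilin.sw_one, hx, hy]
    · simp
    · constructor <;> simp [add_mul, mul_add]

theorem envLie_envLie (h g : H) (x : Env A.deg) :
    envLie hi h (envLie hi g x) = envLie hi (h * g) x := by
  induction x using env_induction A.deg generalizing h g with
  | hA a => rw [envLie_envIn, envLie_envIn, envLie_envIn, hi.lieOp_lieOp]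
  | hD a => rw [envLie_envDiff, envLie_envDiff, envLie_envDiff, hi.lieOp_lieOp]
  | hadd x y hx hy => simp only [map_add, hx, hy]
  | hmul x y hx hy =>
    rw [envLie_mul, envLie_mul, map_sw, IsBilin.sw_mul]
    · simp only [envLie_mul, hx, hy]
      exact sw_comm _ _ _
    · constructor <;> simp [add_mul, mul_add]

/-- The main term in the product case of the relation for `i_g L_h`. Distributing `L_{h⁽¹⁾}` over
the product and regrouping by coassociativity puts two adjacent legs of `h` around the coproduct of
`ad(h)g`, where `IsBilin.sw_comul_adR` applies; a second regrouping gives the right side. -/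
theorem sw_envLie_mul (g h : H) (x y : Env A.deg) :
    (sw K h fun a b => sw K (adR K H b g) fun u v =>
      envLie hi a (envContraction hi u x * envLie hi v y)) =
    sw K h fun a b => sw K g fun u v =>
      (sw K a fun c d => envLie hi c (envContraction hi (adR K H d u) x)) *
        envLie hi (v * b) y := by
  have hB : ∀ c e, IsBilin K fun u v : H =>
      envLie hi c (envContraction hi u x) * envLie hi e (envLie hi v y) := fun c e => by
    constructor <;> simp [add_mul, mul_add]
  have h1 : ∀ a b, (sw K (adR K H b g) fun u v =>
      envLie hi a (envContraction hi u x * envLie hi v y)) =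
      sw K a fun c e => sw K (adR K H b g) fun u v =>
        envLie hi c (envContraction hi u x) * envLie hi e (envLie hi v y) := fun a b => by
    simp only [envLie_mul]
    exact sw_comm _ _ _
  simp only [h1]
  rw [IsTrilin.sw_assoc]
  · have h2 : ∀ c b, (sw K b fun e b => sw K (adR K H b g) fun u v =>
        envLie hi c (envContraction hi u x) * envLie hi e (envLie hi v y)) =
        sw K b fun a b => sw K g fun u v =>
          envLie hi c (envContraction hi (adR K H a u) x) * envLie hi (v * b) y := fun c b => by
      simp only [envLie_envLie]
      exact IsBilin.sw_comul_adR (K := K) (F := fun u v =>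
        envLie hi c (envContraction hi u x) * envLie hi v y)
        (by constructor <;> simp [add_mul, mul_add]) g b
    simp only [h2]
    simp only [sw_mul_const]
    rw [← IsTrilin.sw_assoc (F := fun c a b => sw K g fun u v =>
      envLie hi c (envContraction hi (adR K H a u) x) * envLie hi (v * b) y)]
    · exact sw_congr _ fun a b => sw_comm _ _ _
    · constructor <;> simp [add_mul, mul_add, sw_add, smul_sw]
  · constructor
    · simp [add_mul, sw_add]
    · simp [smul_sw]
    · simp [mul_add, sw_add]
    · simp [smul_sw]
    · intro c e b b'
      simp only [map_add, LinearMap.add_apply, (hB c e).sw_add]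
    · intro r c e b
      simp only [map_smul, LinearMap.smul_apply, (hB c e).sw_smul]

/-- On `da` the relation splits into three: `∑ L_{h⁽¹⁾} L_{ad(h⁽²⁾)g} = L_{gh}` by `sw_mul_adR`, the
relation already valid on `A` for the part in `d`, and `counit_adR` for the counit part. On
products, the term in which `i_g` meets the first factor is `sw_envLie_mul` and the other is
coassociativity. -/
theorem envContraction_envLie (g h : H) (x : Env A.deg) :
    envContraction hi g (envLie hi h x) =
      sw K h fun a b => envLie hi a (envContraction hi (adR K H b g) x) := by
  induction x using env_induction A.deg generalizing g h with
  | hA a =>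
    simp only [envLie_envIn, envContraction_envIn, hi.apply_lieOp]
    exact map_sw (envIn A.deg).toLinearMap _ _
  | hD a =>
    simp only [envLie_envDiff, envContraction_envDiff, map_sub, map_smul, envLie_envIn, sw_sub,
      hi.apply_lieOp, hi.lieOp_lieOp, map_sw, counit_adR]
    congr 2
    · rw [← sw_mul_adR (K := K)]
      exact map_sw ((inLie i).flip a) _ _
    · exact (Eq.trans (sw_congr _ fun c d => mul_smul _ _ _)
        (sw_smul_counit (counit (R := K) g • (inLie i).flip a) h)).symm
  | hadd x y hx hy => simp only [map_add, hx, hy, sw_add]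
  | hmul x y hx hy =>
    have h1 : (sw K h fun a b => sw K b fun c d => envLie hi a (gradeInv (envDeg A.deg) x) *
        envLie hi c (envContraction hi (adR K H d g) y)) =
        sw K h fun a b => envLie hi a (gradeInv (envDeg A.deg) x *
          envContraction hi (adR K H b g) y) := by
      simp only [envLie_mul]
      refine (IsTrilin.sw_assoc (F := fun a c d => envLie hi a (gradeInv (envDeg A.deg) x) *
        envLie hi c (envContraction hi (adR K H d g) y)) ?_ h).symm
      constructor <;> simp [add_mul, mul_add]
    rw [envLie_mul, map_sw]
    simp only [envContraction_mul, map_add, sw_add, map_sw, sw_envLie_mul, ← h1, hx, hy,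
      gradeInv_envLie, mul_sw, envLie_envLie]

/-- The extension of an operation of `H` in `A` to an operation in `Ω_gr(A)`. -/
theorem isOperation_envContraction : IsOperation (envelope A.deg) (envContraction hi) where
  deg_zero h x hx := (Submodule.mem_bot K).1 (envContraction_mem hi h 0 x hx)
  deg_succ h n x hx := envContraction_mem hi h (n + 1) x hx
  one := LinearMap.ext (envContraction_one hi)
  mul h n x y hx := by
    rw [sweedler_eq, lieOp_envContraction, ← smul_mul_assoc, ← gradeInv_of_mem _ hx]
    exact envContraction_mul hi h x y
  comp_lie g h := by
    rw [sweedler_eq, lieOp_envContraction]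
    refine LinearMap.ext fun x => ?_
    rw [sw_apply]
    exact envContraction_envLie hi g h x
  lie_lie h g := by
    rw [lieOp_envContraction]
    exact LinearMap.ext (envLie_envLie hi h g)

omit hi in
/-- An operation in `Ω_gr(A)` is determined by the restrictions of the operators `i_h` and `L_h`
to `A`. -/
theorem IsOperation.eq_of_envIn {j j' : H →ₗ[K] Module.End K (envelope A.deg)}
    (hj : IsOperation (envelope A.deg) j) (hj' : IsOperation (envelope A.deg) j')
    (hc : ∀ h a, j h (envIn A.deg a) = j' h (envIn A.deg a))
    (hl : ∀ h a, lieOp (envelope A.deg) j h (envIn A.deg a) =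
      lieOp (envelope A.deg) j' h (envIn A.deg a)) : j = j' := by
  suffices h : ∀ x : Env A.deg, (∀ h, j h x = j' h x) ∧
      ∀ h, lieOp (envelope A.deg) j h x = lieOp (envelope A.deg) j' h x from
    LinearMap.ext fun g => LinearMap.ext fun x => (h x).1 g
  intro x
  induction x using env_induction A.deg with
  | hA a => exact ⟨fun h => hc h a, fun h => hl h a⟩
  | hD a =>
    rw [← envD_envIn]
    refine ⟨fun h => ?_, fun h => ?_⟩
    -- In `L_h(a) = d(i_h(a)) + i_h(da) + ε(h) a` every term except `i_h(da)` is known to agree.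
    · have := hl h a
      rw [lieOp_apply, lieOp_apply, hc] at this
      exact add_left_cancel (add_right_cancel this)
    · have h1 := lieOp_d (envelope A.deg) j h (envIn A.deg a)
      have h2 := lieOp_d (envelope A.deg) j' h (envIn A.deg a)
      rw [hl] at h1
      exact h1.trans h2.symm
  | hadd x y hx hy =>
    exact ⟨fun h => by rw [map_add, map_add, hx.1, hy.1],
      fun h => by rw [map_add, map_add, hx.2, hy.2]⟩
  | hmul x y hx hy =>
    refine ⟨fun h => ?_, fun h => ?_⟩
    · have h1 := hj.apply_mul h x y
      have h2 := hj'.apply_mul h x y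
      simp only [hx.1, hy.1, hy.2] at h1
      exact h1.trans h2.symm
    · have h1 := hj.lieOp_mul h x y
      have h2 := hj'.lieOp_mul h x y
      simp only [hx.2, hy.2] at h1
      exact h1.trans h2.symm

end EnvelopeOperation

/-! ### The operation in the Weil algebra and its canonical connection. -/

section WeilOperation

variable (K : Type u) [Field K] (H : Type v) [Ring H] [HopfAlgebra K H]

/-- The operation of `H` in the Weil algebra `W(H)`. -/
def weilContraction : H →ₗ[K] Module.End K (weilAlgebra K H) :=
  envContraction (isOperation_cochainContraction K H)

theorem isOperation_weilContraction : IsOperation (weilAlgebra K H) (weilContraction K H) :=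
  isOperation_envContraction (isOperation_cochainContraction K H)

theorem isConnection_weilConnection :
    IsConnection (weilAlgebra K H) (weilContraction K H) (weilConnection K H) where
  deg _ _ hΨ := envIn_mem _ hΨ
  contraction h Ψ := envContraction_envIn (isOperation_cochainContraction K H) h Ψ
  lie h Ψ := by
    rw [weilContraction, lieOp_envContraction]
    exact envLie_envIn (isOperation_cochainContraction K H) h Ψ

end WeilOperation

end WeilHopf

end

theorem proposition5p2 (K : Type*) [Field K] (H : Type*) [Ring H] [HopfAlgebra K H] :
    (∃! i : H →ₗ[K] Module.End K (WeilHopf.weilAlgebra K H),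
      WeilHopf.IsOperation (WeilHopf.weilAlgebra K H) i ∧
        WeilHopf.IsConnection (WeilHopf.weilAlgebra K H) i (WeilHopf.weilConnection K H)) ∧
    ∀ Ψ : WeilHopf.cochainAlgebra K H,
      WeilHopf.curvature (WeilHopf.weilAlgebra K H) (WeilHopf.weilConnection K H) Ψ =
        (WeilHopf.weilAlgebra K H).d (WeilHopf.weilConnection K H Ψ) -
          WeilHopf.weilConnection K H ((WeilHopf.cochainAlgebra K H).d Ψ) := by
  refine ⟨⟨WeilHopf.weilContraction K H, ⟨WeilHopf.isOperation_weilContraction K H,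
    WeilHopf.isConnection_weilConnection K H⟩, ?_⟩, fun Ψ => rfl⟩
  rintro j ⟨hj, hα⟩
  -- Both conditions on a connection are used: the one on `i_h` fixes the operation on the image of
  -- `α_W`, and the one on `L_h` fixes it on the differentials of that image, which `α_W` does not
  -- reach by commuting with `d`.
  refine hj.eq_of_envIn (WeilHopf.isOperation_weilContraction K H) (fun h Ψ => ?_) (fun h Ψ => ?_)
  · exact (hα.contraction h Ψ).trans
      ((WeilHopf.isConnection_weilConnection K H).contraction h Ψ).symm
  · exact (hα.lie h Ψ).trans ((WeilHopf.isConnection_weilConnection K H).lie h Ψ).symm
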